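/- All graphs are finite and simple. A virtual graph diagram of a graph $G$ is a generic immersion of $G$ in the plane (vertices at distinct points, crossings being transverse double points in the interiors of edges) in which every crossing is labelled either classical, with over/under information, or virtual. Any family of at least two pairwise disjoint cycles of $G$ gives a virtual link diagram, namely the part of the diagram formed by these cycles; virtual link diagrams are considered up to the Reidemeister moves I, II, III, their purely virtual versions I*, II*, III*, and the mixed move V* (a strand with two virtual crossings is moved across a classical crossing). A virtual link is trivial if it is equivalent to disjoint circles without crossings. It is split if it has a diagram in which two complementary nonempty sets of components have no crossing in common. For $n\ge 0$, $G$ is *intrinsically virtually linked of degree $n$* ($n$-IVL) if every virtual graph diagram of $G$ with at most $n$ virtual crossings contains a nontrivial virtual link whose (at least two) components are disjoint cycles of $G$. Let $G_7$ be obtained from $K_6$ by a $\Delta Y$-exchange (the edges of a triangle are deleted and a new vertex adjacent to the three vertices of the triangle is added), $G_8$ from $G_7$ by a $\Delta Y$-exchange on a triangle that contains a vertex of the first triangle, $G_9$ from $G_8$ by a $\Delta Y$-exchange on any triangle (each of these graphs is unique up to isomorphism), let $P$ be the Petersen graph, and let $K_{4,4}\setminus e$ be $K_{4,4}$ with one edge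 deleted. Then: 1. All seven graphs $K_6$, $K_{3,3,1}$, $K_{4,4}\setminus e$, $G_7$, $G_8$, $G_9$, $P$ of the Petersen family are $1$-IVL. 2. $K_6$, $K_{3,3,1}$, $K_{4,4}\setminus e$ and $G_7$ are $2$-IVL but not $3$-IVL. 3. Each of $G_8$, $G_9$ and $P$ has a virtual graph diagram with exactly two virtual crossings in which every link formed by at least two disjoint cycles is trivial; hence none of them is $2$-IVL. 4. $K_6$, $K_{3,3,1}$, $K_{4,4}\setminus e$ and $G_7$ are minor-minimal with respect to being $2$-IVL: each is $2$-IVL, and no proper minor (a minor not isomorphic to the graph itself) is $2$-IVL. All of this also holds if "nontrivial" is replaced by "nonsplit" in the definition of $n$-IVL. -/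

import Mathlib

/-! ### Combinatorial planarity

A drawing on the oriented sphere is encoded by its finite set `E` of *ends* (half-segments),
the relation `rot p q` ("`q` is the next end after `p`, counterclockwise, around the point from
which `p` emanates") and the relation `seg p q` ("`p` and `q` are the two ends of one segment").
Points, segments, faces and connected components are the classes generated by `rot`, by `seg`,
by `rot ∘ seg`, and by `rot` and `seg` together. The drawing is planar if its Euler
characteristic is twice the number of components, i.e. if every component has genus zero. -/

def IsPlanarMap {E : Type*} (rot seg : E → E → Prop) : Prop :=
  Nat.card (Quot rot) + Nat.card (Quot fun p r => ∃ q, seg p q ∧ rot q r) =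
    Nat.card (Quot seg) + 2 * Nat.card (Quot fun p q => rot p q ∨ seg p q)

/-! ### Virtual graph diagrams

A crossing `x` has four ends `(x, 0), (x, 1), (x, 2), (x, 3)`, in counterclockwise order. Two
strands pass through it: one joins `(x, 0)` and `(x, 2)`, the other joins `(x, 1)` and `(x, 3)`.
If the crossing is classical, the first of them is the over-strand. A passage of a directed curve
through `x` is recorded by the end at which the curve *leaves* `x`; it enters at the opposite
end. -/

/-- The opposite end at the same crossing. -/
def oppositeEnd {X : Type*} (p : X × ZMod 4) : X × ZMod 4 := (p.1, p.2 + 2)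

/-- The ends of the over-strand of a classical crossing. -/
def IsOverEnd (i : ZMod 4) : Prop := i = 0 ∨ i = 2

/-- A virtual graph diagram of the graph `G`. It is given by the counterclockwise cyclic order of
the edges at every vertex and, for every edge in both directions, the list of its successive
passages through crossings. The dart `d` also serves as the end of its edge at the vertex
`d.fst`. -/
structure VirtualDiagram {V : Type*} (G : SimpleGraph V) where
  /-- the number of crossings, classical and virtual -/
  m : ℕ
  /-- which crossings are virtual -/
  virt : Fin m → Bool
  /-- the next edge end around a vertex -/
  vertexRot : Equiv.Perm G.Dart
  vertexRot_sameCycle : ∀ d e : G.Dart, vertexRot.SameCycle d e ↔ d.fst = e.fst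
  /-- the passages met when the edge is traversed in the direction of the dart -/
  word : G.Dart → List (Fin m × ZMod 4)
  word_symm : ∀ d : G.Dart, word d.symm = (word d).reverse.map oppositeEnd
  /-- every crossing is left exactly once through each of its four ends when all edges are
  traversed in both directions -/
  word_unique : ∀ p : Fin m × ZMod 4, ∃! t : G.Dart × ℕ, (word t.1)[t.2]? = some p
  planar : IsPlanarMap (E := G.Dart ⊕ (Fin m × ZMod 4))
    (fun p q => q = Sum.map vertexRot (fun a : Fin m × ZMod 4 => (a.1, a.2 + 1)) p)
    (fun p q => ∃ d : G.Dart, (p, q) ∈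
      (Sum.inl d :: (word d).map Sum.inr).zip
        ((word d).map (fun a => Sum.inr (oppositeEnd a)) ++ [Sum.inl d.symm]))

/-- The number of virtual crossings. -/
def VirtualDiagram.numVirtual {V : Type*} {G : SimpleGraph V} (D : VirtualDiagram G) : ℕ :=
  (Finset.univ.filter fun x => D.virt x = true).card

/-! ### Virtual links -/

/-- Names of the crossings of a link diagram. -/
structure Crossing where
  name : ℕ
  virt : Bool
deriving DecidableEq

/-- A diagram of an oriented link with components indexed by `Fin k`: for every component the
cyclic list of its passages, each recorded by the end at which the component leaves. A component
without crossings is a circle and has the empty list. -/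
abbrev LinkCode (k : ℕ) : Type := Fin k → List (Crossing × ZMod 4)

namespace LinkCode

variable {k : ℕ}

/-- All passages of all components. -/
def passages (L : LinkCode k) : List (Crossing × ZMod 4) := (List.ofFn L).flatten

/-- `x` is a crossing of the diagram. -/
def HasCrossing (L : LinkCode k) (x : Crossing) : Prop := ∃ p ∈ L.passages, p.1 = x

/-- `q` follows `p` in the cyclic order of some component. -/
def Next (L : LinkCode k) (p q : Crossing × ZMod 4) : Prop :=
  ∃ j, (p, q) ∈ (L j).zip ((L j).rotate 1)

/-- The ends `p` and `q` are joined by a segment of the diagram. -/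
def Seg (L : LinkCode k) (p q : Crossing × ZMod 4) : Prop :=
  L.Next p (oppositeEnd q) ∨ L.Next q (oppositeEnd p)

/-- `L` is the code of a diagram in the plane: each of the two strands of every crossing is
passed exactly once, and the resulting drawing is planar. -/
def IsDiagram (L : LinkCode k) : Prop :=
  (∀ x, L.HasCrossing x → ∀ i : ZMod 4,
    L.passages.count (x, i) + L.passages.count (x, i + 2) = 1) ∧
  IsPlanarMap (E := {p : Crossing × ZMod 4 // L.HasCrossing p.1})
    (fun p q => q.1 = (p.1.1, p.1.2 + 1)) (fun p q => L.Seg p.1 q.1)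

/-- Delete the crossings in `S`. -/
def erase (L : LinkCode k) (S : List Crossing) : LinkCode k :=
  fun j => (L j).filter fun p => p.1 ∉ S

/-- For a triangular face with corners between the ends `a, a + 1` of `x`, the ends `b, b + 1` of
`y`, and the ends `c, c + 1` of `z` (counterclockwise `x, y, z`): interchange the two passages of
each of the three strands. -/
def triangleSwap (x : Crossing) (a : ZMod 4) (y : Crossing) (b : ZMod 4)
    (z : Crossing) (c : ZMod 4) : Equiv.Perm (Crossing × ZMod 4) :=
  Equiv.swap (x, a) (y, b + 3) * Equiv.swap (x, a + 2) (y, b + 1) *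
  (Equiv.swap (y, b) (z, c + 3) * Equiv.swap (y, b + 2) (z, c + 1)) *
  (Equiv.swap (z, c) (x, a + 3) * Equiv.swap (z, c + 2) (x, a + 1))

/-- The Reidemeister moves for virtual link diagrams; the first two rules only change the code of
one and the same diagram. -/
inductive Move : LinkCode k → LinkCode k → Prop
  /-- change the starting points on the components -/
  | rotate (L L' : LinkCode k) (h : ∀ j, L j ~r L' j) : Move L L'
  /-- rename the crossings and renumber their ends, keeping over- and under-strands -/
  | relabel (L : LinkCode k) (π : Equiv.Perm Crossing) (r : Crossing → ZMod 4)
      (hπ : ∀ x, (π x).virt = x.virt) (hr : ∀ x, x.virt = false → IsOverEnd (r x)) :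
      Move L fun j => (L j).map fun p => (π p.1, p.2 + r p.1)
  /-- moves I and I*: remove the crossing at a one-sided face -/
  | one (L : LinkCode k) (x : Crossing) (a : ZMod 4) (h : L.Seg (x, a) (x, a + 1)) :
      Move L (L.erase [x])
  /-- moves II and II*: remove the two crossings at a two-sided face; they are both virtual, or
  both classical with the same strand on top -/
  | two (L : LinkCode k) (x y : Crossing) (a b : ZMod 4) (hxy : x ≠ y)
      (h₁ : L.Seg (x, a) (y, b + 1)) (h₂ : L.Seg (y, b) (x, a + 1))
      (hkind : (x.virt = true ∧ y.virt = true) ∨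
        (x.virt = false ∧ y.virt = false ∧ (IsOverEnd a ↔ IsOverEnd (b + 1)))) :
      Move L (L.erase [x, y])
  /-- moves III, III* and V*: move a strand across the opposite corner of a three-sided face.
  Either at least two of the three crossings are virtual, or all three are classical and
  the strands do not lie above each other cyclically. -/
  | three (L : LinkCode k) (x y z : Crossing) (a b c : ZMod 4)
      (hxy : x ≠ y) (hyz : y ≠ z) (hxz : x ≠ z)
      (h₁ : L.Seg (x, a) (y, b + 1)) (h₂ : L.Seg (y, b) (z, c + 1)) (h₃ : L.Seg (z, c) (x, a + 1))
      (hkind : (x.virt = true ∧ y.virt = true) ∨ (y.virt = true ∧ z.virt = true) ∨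
        (x.virt = true ∧ z.virt = true) ∨
        (x.virt = false ∧ y.virt = false ∧ z.virt = false ∧
          ¬((IsOverEnd a ↔ IsOverEnd b) ∧ (IsOverEnd b ↔ IsOverEnd c)))) :
      Move L fun j => (L j).map (triangleSwap x a y b z c)

/-- Virtual equivalence of link diagrams, generated by the moves between planar diagrams. -/
def Equivalent (L L' : LinkCode k) : Prop :=
  Relation.EqvGen (fun A B : LinkCode k => A.IsDiagram ∧ B.IsDiagram ∧ Move A B) L L'

/-- The virtual link is trivial: equivalent to disjoint circles without crossings. -/
def IsTrivial (L : LinkCode k) : Prop := L.Equivalent fun _ => []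

/-- The virtual link is split: it has a diagram in which two complementary nonempty sets of
components have no crossing in common. -/
def IsSplit (L : LinkCode k) : Prop :=
  ∃ L' : LinkCode k, L.Equivalent L' ∧ L'.IsDiagram ∧
    ∃ S : Set (Fin k), S.Nonempty ∧ Sᶜ.Nonempty ∧
      ∀ i ∈ S, ∀ j ∈ Sᶜ, ∀ p ∈ L' i, ∀ q ∈ L' j, p.1 ≠ q.1

end LinkCode

/-! ### Intrinsically virtually linked graphs -/

section Linking

variable {V : Type*} {G : SimpleGraph V}

/-- At least two pairwise disjoint cycles, each with a direction and a starting point. -/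
def IsCycleLink {k : ℕ} (c : Fin k → Σ v : V, G.Walk v v) : Prop :=
  2 ≤ k ∧ (∀ j, (c j).2.IsCycle) ∧
    ∀ i j, i ≠ j → ∀ v, v ∈ (c i).2.support → v ∉ (c j).2.support

/-- All passages of the closed walk `c`, including those through crossings with other edges. -/
def VirtualDiagram.walkWord (D : VirtualDiagram G) (c : Σ v : V, G.Walk v v) :
    List (Crossing × ZMod 4) :=
  (c.2.darts.flatMap D.word).map fun p => (⟨p.1.val, D.virt p.1⟩, p.2)

/-- The diagram of the link formed by the cycles `c j`: the rest of the graph is deleted, so only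
the crossings that these cycles pass twice remain. -/
def VirtualDiagram.linkCode (D : VirtualDiagram G) {k : ℕ} (c : Fin k → Σ v : V, G.Walk v v) :
    LinkCode k :=
  fun j => (D.walkWord (c j)).filter fun p =>
    2 ≤ (LinkCode.passages fun i => D.walkWord (c i)).countP fun q => q.1 = p.1

/-- The diagram contains only trivial links. -/
def VirtualDiagram.IsLinkless (D : VirtualDiagram G) : Prop :=
  ∀ (k : ℕ) (c : Fin k → Σ v : V, G.Walk v v), IsCycleLink c → (D.linkCode c).IsTrivial

/-- The two usual meanings of "linked" for a virtual link. -/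
inductive LinkNotion
  | nontrivial
  | nonsplit

/-- The virtual link is linked in the chosen sense. -/
def LinkNotion.Holds : LinkNotion → ∀ {k : ℕ}, LinkCode k → Prop
  | .nontrivial, _, L => ¬ L.IsTrivial
  | .nonsplit, _, L => ¬ L.IsSplit

/-- `G` is intrinsically virtually linked of degree `n`. -/
def IsIVL (κ : LinkNotion) (n : ℕ) (G : SimpleGraph V) : Prop :=
  ∀ D : VirtualDiagram G, D.numVirtual ≤ n →
    ∃ (k : ℕ) (c : Fin k → Σ v : V, G.Walk v v), IsCycleLink c ∧ κ.Holds (D.linkCode c)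

end Linking

/-- `H` is a minor of `G`: there are disjoint connected branch sets in `G`, one for each vertex of
`H`, joined by an edge of `G` whenever the vertices are adjacent in `H`. -/
def IsGraphMinor {W V : Type*} (H : SimpleGraph W) (G : SimpleGraph V) : Prop :=
  ∃ B : W → Set V, (∀ w, (G.induce (B w)).Connected) ∧
    (∀ w w', w ≠ w' → Disjoint (B w) (B w')) ∧
    ∀ w w', H.Adj w w' → ∃ u ∈ B w, ∃ v ∈ B w', G.Adj u v

/-- `G` is intrinsically virtually linked of degree `n` and none of its proper minors is. -/
def IsMinorMinimalIVL {V : Type*} (κ : LinkNotion) (n : ℕ) (G : SimpleGraph V) : Prop :=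
  IsIVL κ n G ∧ ∀ (W : Type) [Finite W] (H : SimpleGraph W),
    IsGraphMinor H G → ¬ Nonempty (H ≃g G) → ¬ IsIVL κ n H

/-! ### The Petersen family -/

def graphK6 : SimpleGraph (Fin 6) := ⊤

/-- `K_{3,3,1}` with parts `{0, 1, 2}`, `{3, 4, 5}` and `{6}`. -/
def graphK331 : SimpleGraph (Fin 7) := SimpleGraph.fromEdgeSet
  {s(0, 3), s(0, 4), s(0, 5), s(1, 3), s(1, 4), s(1, 5), s(2, 3), s(2, 4), s(2, 5),
   s(0, 6), s(1, 6), s(2, 6), s(3, 6), s(4, 6), s(5, 6)}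

/-- `K_{4,4}` minus an edge. -/
def graphK44e : SimpleGraph (Fin 4 ⊕ Fin 4) :=
  (completeBipartiteGraph (Fin 4) (Fin 4)).deleteEdges {s(Sum.inl 0, Sum.inr 0)}

/-- `K_6` with the triangle `0 1 2` replaced by a star with centre `6`. -/
def graphG7 : SimpleGraph (Fin 7) := SimpleGraph.fromEdgeSet
  {s(0, 3), s(0, 4), s(0, 5), s(1, 3), s(1, 4), s(1, 5), s(2, 3), s(2, 4), s(2, 5),
   s(3, 4), s(3, 5), s(4, 5), s(0, 6), s(1, 6), s(2, 6)}

/-- `G_7` with the triangle `0 3 4` replaced by a star with centre `7`. -/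
def graphG8 : SimpleGraph (Fin 8) := SimpleGraph.fromEdgeSet
  {s(0, 5), s(1, 3), s(1, 4), s(1, 5), s(2, 3), s(2, 4), s(2, 5),
   s(3, 5), s(4, 5), s(0, 6), s(1, 6), s(2, 6), s(0, 7), s(3, 7), s(4, 7)}

/-- `G_8` with the triangle `1 3 5` replaced by a star with centre `8`. -/
def graphG9 : SimpleGraph (Fin 9) := SimpleGraph.fromEdgeSet
  {s(0, 5), s(1, 4), s(2, 3), s(2, 4), s(2, 5), s(4, 5),
   s(0, 6), s(1, 6), s(2, 6), s(0, 7), s(3, 7), s(4, 7), s(1, 8), s(3, 8), s(5, 8)}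

/-- The Petersen graph: outer cycle `0 1 2 3 4`, spokes, inner pentagram `5 7 9 6 8`. -/
def graphPetersen : SimpleGraph (Fin 10) := SimpleGraph.fromEdgeSet
  {s(0, 1), s(1, 2), s(2, 3), s(3, 4), s(4, 0), s(0, 5), s(1, 6), s(2, 7), s(3, 8), s(4, 9),
   s(5, 7), s(7, 9), s(9, 6), s(6, 8), s(8, 5)}

/-! Linking. A plane drawing has no first homology mod 2: every mod 2 cycle bounds a set of faces
(`isPlanarMap_iff_hasColorings`). Let `β` and `z` be mod 2 cycles of the graph, and colour the faces
so that the colour changes exactly across `z`. Summing `β` against the colours, once vertex by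
vertex and once edge by edge, shows that the parity of the crossings between `β` and `z` depends
only on the order of the edges at each vertex (`exists_position_form`). For a sum of products of
cycles whose symmetrization vanishes on distinct edges with a common vertex, even that order is
irrelevant (`sum_crossingForm_eq`). The sum of this symmetrization over all crossings, classical and
virtual, is then a constant of the graph.

For each of the seven graphs a `LinkCertificate` exhibits such a form `T` with constant 1. On each
ordered pair of edges `e`, `f` its symmetrization equals the sum of `a(e) b(f)` over the pairs `(a,
b)` in a list `P` of pairs of disjoint cycles. Evaluated on (over edge, under edge) and summed over
the classical crossings, it is therefore a sum of parities of the numbers of crossings of `a` over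
`b`. These parities are invariant under all virtual moves (`overLinking_eq_of_move`) and vanish for
split links. If every two-component link splits, the virtual crossings alone must contribute 1
(`sum_virtual`). Moreover `a` and `b` cross evenly often in total and evenly often at classical
crossings, hence also at virtual ones.

A single virtual crossing would be odd for `T` although no pair in `P` separates its two edges,
which disjointness of the cycles forbids (`false_of_single`). Two virtual crossings would be
separated by the same pairs. For `K_6`, `K_{3,3,1}`, `K_{4,4}` minus an edge and `G_7` the value of
`T` is a function of the set of separating pairs, so the two contributions cancel instead of adding
up to 1 (`isIVL_two`).

Linkless diagrams. By Euler's formula a link diagram with one to five crossings has a face with one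
or two sides. If all crossings are virtual, move I* or II* applies there, and induction gives a
trivial link (`isTrivial_of_virtual`). So explicit drawings with two or three crossings, all
declared virtual, prove the upper bounds.

Minors. A proper subgraph misses an edge, which a symmetry carries to a crossed edge of the drawing
with three crossings; two crossings are left. If an edge is contracted, either at most six vertices
remain and the minor is a proper subgraph of `K_6`, because at most 14 edges survive, or one edge of
`K_{4,4}` minus an edge has been contracted, and the result lies in `K_{3,3,1}` with a crossed edge
missing. -/

/-! ### Planarity and two-colourings of the faces -/

section Planarity

open scoped Classical

variable {E : Type*}

theorem quot_involution_eq_iff (σ : Equiv.Perm E) (hσ : ∀ p, σ (σ p) = p) (p q : E) :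
    Quot.mk (fun p q => q = σ p) p = Quot.mk (fun p q => q = σ p) q ↔ q = p ∨ q = σ p := by
  constructor
  · intro h
    replace h := Quot.eqvGen_exact h
    induction h with
    | rel x y h => exact Or.inr h
    | refl x => exact Or.inl rfl
    | symm x y h ih =>
      rcases ih with h | h
      · exact Or.inl h.symm
      · right; rw [h, hσ]
    | trans x y z h₁ h₂ ih₁ ih₂ =>
      rcases ih₁ with h | h <;> rcases ih₂ with h' | h' <;> subst h <;> subst h' <;> simp [hσ]
  · rintro (rfl | rfl)
    · rfl
    · exact Quot.sound rfl

theorem isPlanarMap_perm (ρ σ : Equiv.Perm E) :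
    IsPlanarMap (fun p q => q = ρ p) (fun p q => q = σ p) ↔
    Nat.card (Quot fun p q => q = ρ p) + Nat.card (Quot fun p q => q = ρ (σ p)) =
      Nat.card (Quot fun p q => q = σ p) + 2 * Nat.card (Quot fun p q => q = ρ p ∨ q = σ p) := by
  unfold IsPlanarMap
  simp only [exists_eq_left]

/-- A relation that matches the elements in pairs is given by an involution. -/
theorem exists_involution {seg : E → E → Prop} (hsymm : ∀ p q, seg p q → seg q p)
    (hirr : ∀ p, ¬ seg p p) (huniq : ∀ p, ∃! q, seg p q) :
    ∃ σ : Equiv.Perm E, (seg = fun p q => q = σ p) ∧ (∀ p, σ (σ p) = p) ∧ ∀ p, σ p ≠ p := by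
  choose f hf hf' using huniq
  have hff : ∀ p, f (f p) = p := fun p => (hf' _ _ (hsymm _ _ (hf p))).symm
  refine ⟨⟨f, f, hff, hff⟩, ?_, hff, ?_⟩
  · ext p q
    exact ⟨fun h => hf' _ _ h, fun h => h ▸ hf p⟩
  · intro p hp
    have := hf p
    rw [show f p = p from hp] at this
    exact hirr p this

variable [Fintype E]

noncomputable local instance quotFintype (r : E → E → Prop) : Fintype (Quot r) := Fintype.ofFinite _

/-- Every mod 2 cycle `z` of the map is the boundary of a set of faces; `h p` tells whether the
face to the right of the end `p` belongs to the set. -/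
def HasColorings (rot seg : E → E → Prop) : Prop :=
  ∀ z : E → ZMod 2, (∀ p q, seg p q → z p = z q) →
    (∀ p₀, ∑ p with Quot.mk rot p = Quot.mk rot p₀, z p = 0) →
    ∃ h : E → ZMod 2, (∀ p q, rot p q → h q = h p + z p) ∧ (∀ p q, seg p q → h q = h p + z p)

theorem zmod_two_add_eq_zero {a b : ZMod 2} : a + b = 0 ↔ a = b := by
  revert a b; decide

theorem zmod_two_eq_add_iff {a b c : ZMod 2} : a = b + c ↔ c = a + b := by
  revert a b c; decide

/-- Functions on the classes of `r` that descend to the classes of a coarser relation `s`. -/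
theorem finrank_invariant_functions (r s : E → E → Prop)
    (hrs : ∀ p q, r p q → Quot.mk s p = Quot.mk s q)
    (K : Submodule (ZMod 2) (Quot r → ZMod 2))
    (hK : ∀ g, g ∈ K ↔ ∀ p q, s p q → g (Quot.mk r p) = g (Quot.mk r q)) :
    Module.finrank (ZMod 2) K = Nat.card (Quot s) := by
  let π : Quot r → Quot s := Quot.lift (Quot.mk s) hrs
  have hπ : Function.Surjective π := by
    rintro ⟨p⟩; exact ⟨Quot.mk r p, rfl⟩
  let T : (Quot s → ZMod 2) →ₗ[ZMod 2] (Quot r → ZMod 2) := LinearMap.funLeft _ _ π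
  have hT : Function.Injective T := LinearMap.funLeft_injective_of_surjective _ _ _ hπ
  have hKT : K = LinearMap.range T := by
    ext g
    rw [hK]
    constructor
    · intro hg
      refine ⟨Quot.lift (fun p => g (Quot.mk r p)) hg, ?_⟩
      ext ⟨p⟩
      rfl
    · rintro ⟨k, rfl⟩ p q hpq
      show k (Quot.mk s p) = k (Quot.mk s q)
      rw [Quot.sound hpq]
  rw [hKT, LinearMap.finrank_range_of_inj hT, Module.finrank_fintype_fun_eq_card,
    Nat.card_eq_fintype_card]

variable (ρ σ : Equiv.Perm E)

/-- The incidence matrix of two partitions. -/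
noncomputable def incidence (r s : E → E → Prop) : Matrix (Quot r) (Quot s) (ZMod 2) :=
  fun c d => ∑ p : E, if Quot.mk r p = c ∧ Quot.mk s p = d then 1 else 0

theorem incidence_transpose (r s : E → E → Prop) :
    (incidence r s).transpose = incidence s r := by
  ext c d
  simp only [Matrix.transpose_apply, incidence, and_comm]

theorem incidence_mulVec (r s : E → E → Prop) (y : Quot s → ZMod 2) (c : Quot r) :
    ((incidence r s).mulVec y) c = ∑ p with Quot.mk r p = c, y (Quot.mk s p) := by
  simp only [Matrix.mulVec, dotProduct, incidence, Finset.sum_mul]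
  rw [Finset.sum_comm, Finset.sum_filter]
  refine Finset.sum_congr rfl fun p _ => ?_
  rw [Finset.sum_eq_single (Quot.mk s p)]
  · by_cases h : Quot.mk r p = c <;> simp [h]
  · intro d _ hd
    simp [hd.symm]
  · simp

/-- A segment has exactly two ends, so this incidence matrix is a mod 2 coboundary: of functions on
the points when `r` is the rotation, of functions on the faces when `r` is the face relation. -/
theorem incidence_involution_mulVec (hσ : ∀ p, σ (σ p) = p) (hne : ∀ p, σ p ≠ p)
    (r : E → E → Prop) (k : Quot r → ZMod 2) (p : E) :
    ((incidence (fun p q => q = σ p) r).mulVec k) (Quot.mk _ p) =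
      k (Quot.mk r p) + k (Quot.mk r (σ p)) := by
  rw [incidence_mulVec]
  have : (Finset.univ.filter fun q => Quot.mk (fun p q => q = σ p) q =
      Quot.mk (fun p q => q = σ p) p) = {p, σ p} := by
    ext q
    rw [Finset.mem_filter, eq_comm, quot_involution_eq_iff σ hσ]
    simp
  rw [this, Finset.sum_pair (hne p).symm]

/-- A function on the points with zero coboundary agrees at the two ends of every segment, hence
descends to the connected components. -/
theorem finrank_ker_incidence_rot (hσ : ∀ p, σ (σ p) = p) (hne : ∀ p, σ p ≠ p) :
    Module.finrank (ZMod 2)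
      (LinearMap.ker (incidence (fun p q => q = σ p) (fun p q : E => q = ρ p)).mulVecLin) =
    Nat.card (Quot fun p q => q = ρ p ∨ q = σ p) := by
  apply finrank_invariant_functions _ _ (fun p q h => Quot.sound (Or.inl h))
  intro g
  rw [LinearMap.mem_ker, Matrix.mulVecLin_apply, funext_iff]
  constructor
  · rintro h p q (rfl | rfl)
    · exact congrArg g (Quot.sound rfl)
    · have := h (Quot.mk _ p)
      rw [incidence_involution_mulVec σ hσ hne] at this
      exact zmod_two_add_eq_zero.1 this
  · rintro h ⟨p⟩
    rw [incidence_involution_mulVec σ hσ hne]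
    exact zmod_two_add_eq_zero.2 (h p (σ p) (Or.inr rfl))

/-- The dual statement: a set of faces with empty boundary is a union of components, because `σ` and
`ρ ∘ σ` generate the same classes as `ρ` and `σ`. -/
theorem finrank_ker_incidence_face (hσ : ∀ p, σ (σ p) = p) (hne : ∀ p, σ p ≠ p) :
    Module.finrank (ZMod 2)
      (LinearMap.ker (incidence (fun p q => q = σ p) (fun p q : E => q = ρ (σ p))).mulVecLin) =
    Nat.card (Quot fun p q => q = ρ p ∨ q = σ p) := by
  apply finrank_invariant_functions
  · rintro p q rfl
    have h₁ : Quot.mk (fun p q => q = ρ p ∨ q = σ p) p = Quot.mk _ (σ p) := Quot.sound (Or.inr rfl)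
    exact h₁.trans (Quot.sound (Or.inl rfl))
  intro g
  rw [LinearMap.mem_ker, Matrix.mulVecLin_apply, funext_iff]
  constructor
  · intro h
    have hs : ∀ p, g (Quot.mk _ p) = g (Quot.mk _ (σ p)) := by
      intro p
      have := h (Quot.mk _ p)
      rw [incidence_involution_mulVec σ hσ hne] at this
      exact zmod_two_add_eq_zero.1 this
    rintro p q (rfl | rfl)
    · rw [hs p]
      exact congrArg g (Quot.sound (by rw [hσ]))
    · exact hs p
  · rintro h ⟨p⟩
    rw [incidence_involution_mulVec σ hσ hne]
    exact zmod_two_add_eq_zero.2 (h p (σ p) (Or.inr rfl))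

theorem sum_add_perm_eq_zero (k : E → ZMod 2) (c : Quot fun p q => q = ρ p) :
    ∑ p with Quot.mk (fun p q => q = ρ p) p = c, (k p + k (ρ p)) = 0 := by
  rw [Finset.sum_add_distrib, zmod_two_add_eq_zero]
  symm
  refine Finset.sum_equiv ρ ?_ fun _ _ => rfl
  intro p
  simp only [Finset.mem_filter, Finset.mem_univ, true_and]
  rw [show Quot.mk (fun p q => q = ρ p) p = Quot.mk (fun p q => q = ρ p) (ρ p) from
    Quot.sound rfl]

/-- The boundary of a boundary vanishes: around a point each face colour occurs once on either side
of an end, so the sum of the differences telescopes. -/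
theorem range_face_le_ker_boundary (hσ : ∀ p, σ (σ p) = p) (hne : ∀ p, σ p ≠ p) :
    LinearMap.range (incidence (fun p q => q = σ p) (fun p q : E => q = ρ (σ p))).mulVecLin ≤
      LinearMap.ker (incidence (fun p q : E => q = ρ p) (fun p q => q = σ p)).mulVecLin := by
  rintro _ ⟨k, rfl⟩
  rw [LinearMap.mem_ker]
  ext c
  rw [Matrix.mulVecLin_apply, Matrix.mulVecLin_apply, incidence_mulVec, Pi.zero_apply,
    ← sum_add_perm_eq_zero ρ (fun p => k (Quot.mk _ p)) c]
  refine Finset.sum_congr rfl fun p _ => ?_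
  rw [incidence_involution_mulVec σ hσ hne]
  congr 2
  exact Quot.sound (by rw [hσ])

/-- The boundary matrix is the transpose of the coboundary matrix, whose rank is the number of
points minus the number of components. Rank-nullity then gives the dimension of the cycle space. -/
theorem finrank_ker_boundary (hσ : ∀ p, σ (σ p) = p) (hne : ∀ p, σ p ≠ p) :
    Module.finrank (ZMod 2)
      (LinearMap.ker (incidence (fun p q : E => q = ρ p) (fun p q => q = σ p)).mulVecLin) +
      Nat.card (Quot fun p q => q = ρ p) =
    Nat.card (Quot fun p q => q = σ p) + Nat.card (Quot fun p q => q = ρ p ∨ q = σ p) := by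
  have h₁ := LinearMap.finrank_range_add_finrank_ker
    (incidence (fun p q : E => q = ρ p) (fun p q => q = σ p)).mulVecLin
  have h₂ := LinearMap.finrank_range_add_finrank_ker
    (incidence (fun p q => q = σ p) (fun p q : E => q = ρ p)).mulVecLin
  have h₃ := Matrix.rank_transpose (incidence (fun p q : E => q = ρ p) (fun p q => q = σ p))
  rw [incidence_transpose] at h₃
  unfold Matrix.rank at h₃
  rw [finrank_ker_incidence_rot ρ σ hσ hne] at h₂
  rw [Module.finrank_fintype_fun_eq_card, ← Nat.card_eq_fintype_card] at h₁ h₂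
  omega

theorem finrank_range_face (hσ : ∀ p, σ (σ p) = p) (hne : ∀ p, σ p ≠ p) :
    Module.finrank (ZMod 2)
      (LinearMap.range (incidence (fun p q => q = σ p) (fun p q : E => q = ρ (σ p))).mulVecLin) +
      Nat.card (Quot fun p q => q = ρ p ∨ q = σ p) = Nat.card (Quot fun p q => q = ρ (σ p)) := by
  have h₂ := LinearMap.finrank_range_add_finrank_ker
    (incidence (fun p q => q = σ p) (fun p q : E => q = ρ (σ p))).mulVecLin
  rwa [finrank_ker_incidence_face ρ σ hσ hne, Module.finrank_fintype_fun_eq_card,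
    ← Nat.card_eq_fintype_card] at h₂

/-- This is the vanishing of the first homology: cycles form the kernel on the right, boundaries of
sets of faces the range, and a colouring of ends is a colouring of faces in disguise. -/
theorem hasColorings_iff_ker_le_range (hσ : ∀ p, σ (σ p) = p) (hne : ∀ p, σ p ≠ p) :
    HasColorings (fun p q => q = ρ p) (fun p q => q = σ p) ↔
      LinearMap.ker (incidence (fun p q : E => q = ρ p) (fun p q => q = σ p)).mulVecLin ≤
      LinearMap.range
        (incidence (fun p q => q = σ p) (fun p q : E => q = ρ (σ p))).mulVecLin := by
  constructor
  · intro H y hy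
    rw [LinearMap.mem_ker, Matrix.mulVecLin_apply] at hy
    obtain ⟨h, h₁, h₂⟩ := H (fun p => y (Quot.mk _ p))
      (fun p q hpq => congrArg y (Quot.sound hpq))
      (fun p₀ => by rw [← incidence_mulVec, hy]; rfl)
    refine ⟨Quot.lift h ?_, ?_⟩
    -- One step along a face changes the colour by `z p` on the segment and by `z (σ p) = z p`
    -- around the point, so not at all.
    · rintro p q rfl
      rw [h₁ _ _ rfl, h₂ _ _ rfl, add_assoc, zmod_two_eq_add_iff, ← zmod_two_add_eq_zero]
      have : y (Quot.mk (fun p q => q = σ p) (σ p)) = y (Quot.mk _ p) :=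
        (congrArg y (Quot.sound rfl : Quot.mk (fun p q => q = σ p) p = Quot.mk _ (σ p))).symm
      rw [this]
      generalize y _ = a
      generalize h p = b
      revert a b; decide
    · ext ⟨p⟩
      rw [Matrix.mulVecLin_apply, incidence_involution_mulVec σ hσ hne]
      show h p + h (σ p) = _
      rw [h₂ _ _ rfl, ← add_assoc, CharTwo.add_self_eq_zero, zero_add]
  · intro H z hz₁ hz₂
    obtain ⟨k, hk⟩ := H (x := Quot.lift z hz₁) (by
      rw [LinearMap.mem_ker, Matrix.mulVecLin_apply]
      ext ⟨p₀⟩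
      rw [incidence_mulVec]
      exact hz₂ p₀)
    have hk' : ∀ p, k (Quot.mk _ p) + k (Quot.mk _ (σ p)) = z p := by
      intro p
      rw [← incidence_involution_mulVec σ hσ hne, ← Matrix.mulVecLin_apply, hk]
    refine ⟨fun p => k (Quot.mk _ p), ?_, ?_⟩
    · rintro p q rfl
      rw [← hk' p, ← add_assoc, CharTwo.add_self_eq_zero, zero_add]
      exact congrArg k (Quot.sound (by rw [hσ])).symm
    · rintro p q rfl
      rw [← hk' p, ← add_assoc, CharTwo.add_self_eq_zero, zero_add]

/-- With `V`, `E`, `F`, `C` the numbers of points, segments, faces and components, cycles have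
dimension `E - V + C` and boundaries `F - C`. They coincide exactly when Euler's formula holds. -/
theorem isPlanarMap_iff_hasColorings (ρ : Equiv.Perm E) {seg : E → E → Prop}
    (hsymm : ∀ p q, seg p q → seg q p) (hirr : ∀ p, ¬ seg p p) (huniq : ∀ p, ∃! q, seg p q) :
    IsPlanarMap (fun p q => q = ρ p) seg ↔ HasColorings (fun p q => q = ρ p) seg := by
  obtain ⟨σ, rfl, hσ, hne⟩ := exists_involution hsymm hirr huniq
  rw [hasColorings_iff_ker_le_range ρ σ hσ hne, isPlanarMap_perm]
  have h₁ := finrank_ker_boundary ρ σ hσ hne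
  have h₂ := finrank_range_face ρ σ hσ hne
  have h₃ := range_face_le_ker_boundary ρ σ hσ hne
  constructor
  · intro h
    exact (Submodule.eq_of_le_of_finrank_le h₃ (by omega)).ge
  · intro h
    have := le_antisymm h h₃
    rw [this] at h₁
    omega

/-- Boundaries are always cycles, so one inequality in Euler's formula is automatic. For explicit
drawings it is therefore enough to bound points and faces from below. -/
theorem hasColorings_of_le (ρ : Equiv.Perm E) (σ : Equiv.Perm E) (hσ : ∀ p, σ (σ p) = p)
    (hne : ∀ p, σ p ≠ p)
    (h : Nat.card (Quot fun p q => q = σ p) + 2 * Nat.card (Quot fun p q => q = ρ p ∨ q = σ p) ≤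
      Nat.card (Quot fun p q => q = ρ p) + Nat.card (Quot fun p q => q = ρ (σ p))) :
    HasColorings (fun p q => q = ρ p) (fun p q => q = σ p) := by
  rw [hasColorings_iff_ker_le_range ρ σ hσ hne]
  have h₁ := finrank_ker_boundary ρ σ hσ hne
  have h₂ := finrank_range_face ρ σ hσ hne
  have h₃ := range_face_le_ker_boundary ρ σ hσ hne
  exact (Submodule.eq_of_le_of_finrank_le h₃ (by omega)).ge

end Planarity

/-! ### Cyclic lists -/

section Cyclic

variable {α β : Type*}

/-- `q` follows `p` in the cyclic list `l`. -/
def CycNext (l : List α) (p q : α) : Prop := (p, q) ∈ l.zip (l.rotate 1)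

theorem cycNext_of_isRotated {l l' : List α} (h : l ~r l') {p q : α} (hp : CycNext l p q) :
    CycNext l' p q := by
  obtain ⟨n, rfl⟩ := h
  unfold CycNext at *
  rw [List.rotate_rotate, add_comm, ← List.rotate_rotate, List.zip,
    ← List.zipWith_rotate_distrib _ _ _ _ (by simp), List.mem_rotate]
  exact hp

theorem cycNext_of_isRotated_cons {l t : List α} {p q : α} (h : l ~r p :: t)
    (hq : (t ++ [p]).head? = some q) : CycNext l p q := by
  refine cycNext_of_isRotated h.symm ?_
  unfold CycNext
  rw [List.rotate_cons_succ, List.rotate_zero]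
  cases t with
  | nil => simp_all
  | cons a t => simp_all

theorem CycNext.mem_left {l : List α} {p q : α} (h : CycNext l p q) : p ∈ l :=
  (List.of_mem_zip h).1

theorem CycNext.mem_right {l : List α} {p q : α} (h : CycNext l p q) : q ∈ l :=
  List.mem_rotate.1 (List.of_mem_zip h).2

theorem isRotated_cons_of_mem {l : List α} {p : α} (h : p ∈ l) : ∃ t, l ~r p :: t := by
  obtain ⟨a, b, rfl⟩ := List.append_of_mem h
  exact ⟨b ++ a, List.isRotated_append⟩

theorem CycNext.head?_eq {l t : List α} (hl : l.Nodup) {p q : α} (ht : l ~r p :: t)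
    (h : CycNext l p q) : (t ++ [p]).head? = some q := by
  have hn : (p :: t).Nodup := ht.nodup_iff.1 hl
  have h' := cycNext_of_isRotated ht h
  unfold CycNext at h'
  rw [List.rotate_cons_succ, List.rotate_zero] at h'
  cases t with
  | nil => simp_all
  | cons a t =>
    rw [List.cons_append, List.zip_cons_cons, List.mem_cons] at h'
    rcases h' with h' | h'
    · simp_all
    · exact absurd (List.of_mem_zip h').1 (List.nodup_cons.1 hn).1

theorem isRotated_filter {l l' : List α} (h : l ~r l') (f : α → Bool) :
    l.filter f ~r l'.filter f := by
  obtain ⟨n, hn, rfl⟩ := List.isRotated_iff_mod.1 h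
  rw [List.rotate_eq_drop_append_take hn, List.filter_append]
  refine List.IsRotated.trans ?_ List.isRotated_append
  rw [← List.filter_append, List.take_append_drop]

theorem exists_cycNext {l : List α} {p : α} (h : p ∈ l) : ∃ q, CycNext l p q := by
  obtain ⟨t, ht⟩ := isRotated_cons_of_mem h
  cases t with
  | nil => exact ⟨p, cycNext_of_isRotated_cons ht rfl⟩
  | cons a t => exact ⟨a, cycNext_of_isRotated_cons ht rfl⟩

theorem exists_cycPrev {l : List α} {q : α} (h : q ∈ l) : ∃ p, CycNext l p q := by
  obtain ⟨t, ht⟩ := isRotated_cons_of_mem h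
  rcases List.eq_nil_or_concat t with rfl | ⟨s, a, rfl⟩
  · exact ⟨q, cycNext_of_isRotated_cons ht rfl⟩
  · refine ⟨a, cycNext_of_isRotated_cons (t := q :: s) (ht.trans ?_) rfl⟩
    have := List.isRotated_append (l := q :: s) (l' := [a])
    simpa using this

theorem CycNext.right_unique {l : List α} (hl : l.Nodup) {p q q' : α} (h : CycNext l p q)
    (h' : CycNext l p q') : q = q' := by
  obtain ⟨t, ht⟩ := isRotated_cons_of_mem h.mem_left
  exact Option.some_injective _ ((h.head?_eq hl ht).symm.trans (h'.head?_eq hl ht))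

theorem CycNext.left_unique {l : List α} (hl : l.Nodup) {p p' q : α} (h : CycNext l p q)
    (h' : CycNext l p' q) : p = p' := by
  have hl' : (l.rotate 1).Nodup := List.nodup_rotate.2 hl
  obtain ⟨i, hi, hp⟩ := List.mem_iff_getElem.1 h
  obtain ⟨j, hj, hp'⟩ := List.mem_iff_getElem.1 h'
  rw [List.getElem_zip, Prod.mk.injEq] at hp hp'
  have := (List.Nodup.getElem_inj_iff hl').1 (hp.2.trans hp'.2.symm)
  subst this
  exact hp.1.symm.trans hp'.1

theorem cycNext_map {f : α → β} (hf : Function.Injective f) {l : List α} {p q : α} :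
    CycNext (l.map f) (f p) (f q) ↔ CycNext l p q := by
  unfold CycNext
  rw [← List.map_rotate, List.zip_map, List.mem_map]
  constructor
  · rintro ⟨⟨a, b⟩, h, h'⟩
    simp only [Prod.map_apply, Prod.mk.injEq] at h'
    rw [← hf h'.1, ← hf h'.2]
    exact h
  · intro h
    exact ⟨(p, q), h, rfl⟩

/-- Successive elements of a filtered cyclic list are joined by a chain of discarded ones. -/
theorem CycNext.exists_chain {l : List α} (hl : l.Nodup) {f : α → Bool} {p q : α}
    (h : CycNext (l.filter f) p q) :
    ∃ a, Relation.ReflTransGen (fun a b => CycNext l a b ∧ f b = false) p a ∧ CycNext l a q := by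
  obtain ⟨t, ht⟩ := isRotated_cons_of_mem (List.mem_of_mem_filter h.mem_left)
  have hp : f p = true := (List.mem_filter.1 h.mem_left).2
  have hft := isRotated_filter ht f
  rw [List.filter_cons_of_pos hp] at hft
  have hq := h.head?_eq (hl.filter _) hft
  -- Walk along the list: `a` is the last element reached, `s` the part already passed (it starts
  -- with `p` unless `a = p`), and `t₂` the part still ahead.
  have key : ∀ (t₂ s : List α) (a : α),
      Relation.ReflTransGen (fun a b => CycNext l a b ∧ f b = false) p a →
      l ~r a :: (t₂ ++ s) → (s ++ [a]).head? = some p → (t₂.filter f ++ [p]).head? = some q →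
      ∃ a, Relation.ReflTransGen (fun a b => CycNext l a b ∧ f b = false) p a ∧
        CycNext l a q := by
    intro t₂
    induction t₂ with
    | nil =>
      intro s a ha hr hs hq
      refine ⟨a, ha, cycNext_of_isRotated_cons hr ?_⟩
      simp_all
    | cons b t₂ ih =>
      intro s a ha hr hs hq
      have hab : CycNext l a b := cycNext_of_isRotated_cons hr rfl
      by_cases hb : f b = true
      · rw [List.filter_cons_of_pos hb] at hq
        simp only [List.cons_append, List.head?_cons, Option.some.injEq] at hq
        exact ⟨a, ha, hq ▸ hab⟩
      · rw [List.filter_cons_of_neg hb] at hq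
        refine ih (s ++ [a]) b (ha.tail ⟨hab, by simpa using hb⟩) (hr.trans ?_) ?_ hq
        · have := List.isRotated_append (l := [a]) (l' := b :: (t₂ ++ s))
          simpa using this
        · cases s <;> simp_all
  exact key t [] p .refl (by simpa using ht) rfl hq

end Cyclic

/-! ### Parts of a planar map -/

section Traversal

open scoped Classical

variable {E : Type*}

/-- The value at `p` is read off where the forward orbit of `p` first meets `A`. Orbits that never
meet `A` get the default value, which is compatible with `π`. -/
theorem exists_extension {X : Type*} [Inhabited X] (π : E → E) (A : Set E) (f : E → X) :
    ∃ g : E → X, (∀ a ∈ A, g a = f a) ∧ ∀ p ∉ A, g p = g (π p) := by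
  refine ⟨fun p => if h : ∃ n, π^[n] p ∈ A then f (π^[Nat.find h] p) else default, ?_, ?_⟩
  · intro a ha
    have h : ∃ n, π^[n] a ∈ A := ⟨0, ha⟩
    simp only [dif_pos h]
    rw [(Nat.find_eq_zero h).2 ha]
    rfl
  · intro p hp
    by_cases h : ∃ n, π^[n] p ∈ A
    · have h' : ∃ n, π^[n] (π p) ∈ A := by
        obtain ⟨n, hn⟩ := h
        cases n with
        | zero => exact absurd hn hp
        | succ n => exact ⟨n, hn⟩
      have : Nat.find h = Nat.find h' + 1 := Nat.find_comp_succ h h' hp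
      simp only [dif_pos h, dif_pos h', this, Function.iterate_succ_apply]
    · have h' : ¬ ∃ n, π^[n] (π p) ∈ A := fun ⟨n, hn⟩ => h ⟨n + 1, hn⟩
      simp only [dif_neg h, dif_neg h']

theorem color_iterate {ρ : Equiv.Perm E} {z h : E → ZMod 2} {x : E}
    (hρ : ∀ p, h (ρ p) = h p + z p) {n : ℕ} (hn : 0 < n)
    (hz : ∀ m, 0 < m → m < n → z ((ρ ^ m) x) = 0) : h ((ρ ^ n) x) = h x + z x := by
  induction n with
  | zero => omega
  | succ n ih =>
    rw [pow_succ', Equiv.Perm.mul_apply, hρ]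
    rcases Nat.eq_zero_or_pos n with rfl | hn'
    · rfl
    · rw [ih hn' fun m h₁ h₂ => hz m h₁ (by omega), hz n hn' (by omega), add_zero]

theorem eq_of_sameCycle {ρ : Equiv.Perm E} {X : Type*} {S : E → X} (hS : ∀ p, S (ρ p) = S p)
    {p q : E} (h : ρ.SameCycle p q) : S q = S p := by
  obtain ⟨n, rfl⟩ := h
  have hS' : ∀ p, S (ρ⁻¹ p) = S p := fun p => by
    rw [← hS, Equiv.Perm.inv_def, Equiv.apply_symm_apply]
  induction n using Int.induction_on with
  | zero => rfl
  | succ n ih => rw [add_comm, zpow_add, zpow_one, Equiv.Perm.mul_apply, hS, ih]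
  | pred n ih => rw [sub_eq_neg_add, zpow_add, zpow_neg_one, Equiv.Perm.mul_apply, hS', ih]

variable [Fintype E]

theorem quot_perm_eq_iff (ρ : Equiv.Perm E) (p q : E) :
    Quot.mk (fun p q => q = ρ p) p = Quot.mk (fun p q => q = ρ p) q ↔ ρ.SameCycle p q := by
  constructor
  · intro h
    replace h := Quot.eqvGen_exact h
    induction h with
    | rel x y h =>
      rw [h]
      exact (Equiv.Perm.sameCycle_apply_right).2 (Equiv.Perm.SameCycle.refl _ _)
    | refl x => exact Equiv.Perm.SameCycle.refl _ _
    | symm x y h ih => exact ih.symm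
    | trans x y z h₁ h₂ ih₁ ih₂ => exact ih₁.trans ih₂
  · intro h
    obtain ⟨n, rfl⟩ := h.exists_nat_pow_eq
    induction n with
    | zero => rfl
    | succ n ih =>
      refine (ih ⟨n, by simp⟩).trans (Quot.sound ?_)
      rw [pow_succ', Equiv.Perm.mul_apply]

/-- Turning from `x` to `y` around their common point, the colour changes only at `x`, because the
ends strictly between them carry zero. -/
theorem color_eq_of_sameCycle {ρ : Equiv.Perm E} {z h : E → ZMod 2}
    (hρ : ∀ p, h (ρ p) = h p + z p) {x y : E} (hxy : x ≠ y) (hs : ρ.SameCycle x y)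
    (hz : ∀ r, ρ.SameCycle x r → r ≠ x → r ≠ y → z r = 0) : h y = h x + z x := by
  have hex : ∃ n, (ρ ^ n) x = y := hs.exists_nat_pow_eq
  have hn := Nat.find_spec hex
  have hmin := fun m => Nat.find_min hex (m := m)
  generalize Nat.find hex = n at hn hmin
  have hn0 : 0 < n := by
    rcases Nat.eq_zero_or_pos n with rfl | h0
    · exact absurd hn hxy
    · exact h0
  rw [← hn]
  refine color_iterate hρ hn0 fun m hm hmn => hz _ ⟨m, by simp⟩ ?_ (hmin m hmn)
  -- A return to `x` after `m` turns would bring `y` within `n - m` turns, against the minimality of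
  -- `n`.
  intro hmx
  refine hmin (n - m) (by omega) ?_
  rw [← hn]
  conv_rhs => rw [show n = (n - m) + m by omega, pow_add, Equiv.Perm.mul_apply, hmx]

/-- Colourings of a planar map give colourings of the map formed by closed curves in it. The
curves are given by the cyclic lists of their passages, each recorded by the end at which the curve
leaves; `inn` gives the end at which it enters, and `S` marks the ends at the points that are
kept. Cycles of the new map have to extend to the old one, without a change of colour along the
passages that are dropped. -/
theorem exists_coloring_of_extension {ρ : Equiv.Perm E} {seg : E → E → Prop}
    (hcol : HasColorings (fun p q => q = ρ p) seg) {k : ℕ} (Q : Fin k → List E)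
    (hQ : ∀ j, (Q j).Nodup) (hdisj : ∀ i j q, q ∈ Q i → q ∈ Q j → i = j)
    (inn : E → E) (S : E → Bool)
    (hinn : ∀ j p q, CycNext (Q j) p q → seg p (inn q))
    (hSinn : ∀ j, ∀ q ∈ Q j, S (inn q) = S q)
    (hSρ : ∀ p, S (ρ p) = S p)
    (hsurv : ∀ p, S p = true → ∃ j, p ∈ Q j ∨ ∃ q ∈ Q j, p = inn q)
    (hext : ∀ g : E → ZMod 2,
      (∀ j p q, CycNext (Q j) p q → S q = false → g q = g p) →
      ∃ z : E → ZMod 2, (∀ j, ∀ q ∈ Q j, z q = g q) ∧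
        (∀ j p q, CycNext (Q j) p q → z (inn q) = g p) ∧ (∀ p q, seg p q → z p = z q) ∧
        (∀ p₀, S p₀ = false → ∑ p with ρ.SameCycle p p₀, z p = 0) ∧
        ∀ h : E → ZMod 2, (∀ p, h (ρ p) = h p + z p) → (∀ p q, seg p q → h q = h p + z p) →
          ∀ j, ∀ q ∈ Q j, S q = false → h q = h (inn q) + z (inn q))
    (z' : E → ZMod 2)
    (hz₁ : ∀ j p q, CycNext ((Q j).filter S) p q → z' (inn q) = z' p)
    (hz₂ : ∀ p₀, S p₀ = true → ∑ p with ρ.SameCycle p p₀, z' p = 0) :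
    ∃ h : E → ZMod 2, (∀ p, S p = true → h (ρ p) = h p + z' p) ∧
      ∀ j p q, CycNext ((Q j).filter S) p q → h (inn q) = h p + z' p := by
  have hS := fun p q => eq_of_sameCycle (p := p) (q := q) hSρ
  have hprev : ∀ q, ∃ p, ∀ j, q ∈ Q j → CycNext (Q j) p q := by
    intro q
    by_cases hq : ∃ j, q ∈ Q j
    · obtain ⟨j, hj⟩ := hq
      obtain ⟨p, hp⟩ := exists_cycPrev hj
      exact ⟨p, fun i hi => by rwa [hdisj i j q hi hj]⟩
    · exact ⟨q, fun j hj => absurd ⟨j, hj⟩ hq⟩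
  choose prev hprev using hprev
  have hprev_eq : ∀ j p q, CycNext (Q j) p q → prev q = p := fun j p q h =>
    (hprev q j h.mem_right).left_unique (hQ j) h
  -- Dropped passages inherit the value of `z'` from the last kept passage before them.
  obtain ⟨g, hgS, hg⟩ := exists_extension prev {p | S p = true} z'
  have hgnext : ∀ j p q, CycNext (Q j) p q → S q = false → g q = g p := fun j p q h hq => by
    rw [hg q (by simp [hq]), hprev_eq j p q h]
  have hchain : ∀ j p a, Relation.ReflTransGen (fun a b => CycNext (Q j) a b ∧ S b = false) p a →
      g a = g p := by
    intro j p a h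
    induction h with
    | refl => rfl
    | tail _ hbc ih => rw [hgnext j _ _ hbc.1 hbc.2, ih]
  obtain ⟨z, hzU, hzinn, hzseg, hzsum, hzpass⟩ := hext g hgnext
  have hzS : ∀ p, S p = true → z p = z' p := by
    intro p hp
    obtain ⟨j, hj | ⟨q, hq, rfl⟩⟩ := hsurv p hp
    · rw [hzU j p hj, hgS p hp]
    · have hSq : S q = true := by rw [← hSinn j q hq, hp]
      obtain ⟨p₁, hp₁⟩ := exists_cycPrev (List.mem_filter.2 ⟨hq, hSq⟩)
      obtain ⟨a, ha, haq⟩ := hp₁.exists_chain (hQ j)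
      rw [hzinn j a q haq, hchain j _ _ ha, hgS _ (List.mem_filter.1 hp₁.mem_left).2,
        hz₁ j p₁ q hp₁]
  obtain ⟨h, hh₁, hh₂⟩ := hcol z hzseg (by
    intro p₀
    simp only [quot_perm_eq_iff]
    by_cases hp₀ : S p₀ = true
    · rw [← hz₂ p₀ hp₀]
      refine Finset.sum_congr rfl fun p hp => hzS p ?_
      rw [← hS p p₀ (Finset.mem_filter.1 hp).2, hp₀]
    · exact hzsum p₀ (by simpa using hp₀))
  have hρ : ∀ p, h (ρ p) = h p + z p := fun p => hh₁ p _ rfl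
  refine ⟨h, fun p hp => by rw [hρ, hzS p hp], ?_⟩
  intro j p q hpq
  obtain ⟨a, ha, haq⟩ := hpq.exists_chain (hQ j)
  have hSp := (List.mem_filter.1 hpq.mem_left).2
  -- Along the dropped passages after `p`, the change of colour on each segment cancels the change
  -- at the dropped point that follows.
  have hha : h a = h p := by
    clear haq
    induction ha with
    | refl => rfl
    | @tail b c hpb hbc ih =>
      rw [← ih, hzpass h hρ hh₂ j c hbc.1.mem_right hbc.2, hh₂ _ _ (hinn j b c hbc.1),
        hzinn j b c hbc.1, hzU j b hbc.1.mem_left, add_assoc, CharTwo.add_self_eq_zero, add_zero]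
  rw [hh₂ _ _ (hinn j a q haq), hha, hzU j a haq.mem_left, hchain j _ _ ha, hgS p hSp]

/-- The case in which each point that is dropped is passed at most once. -/
theorem exists_coloring_of_traversal {ρ : Equiv.Perm E} {seg : E → E → Prop}
    (hcol : HasColorings (fun p q => q = ρ p) seg) (hsymm : ∀ p q, seg p q → seg q p)
    (huniq : ∀ p q q', seg p q → seg p q' → q = q') {k : ℕ} (Q : Fin k → List E)
    (hQ : ∀ j, (Q j).Nodup) (hdisj : ∀ i j q, q ∈ Q i → q ∈ Q j → i = j)
    (inn : E → E) (S : E → Bool)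
    (hinn : ∀ j p q, CycNext (Q j) p q → seg p (inn q))
    (hpoint : ∀ j, ∀ q ∈ Q j, ρ.SameCycle q (inn q))
    (hnot : ∀ i j, ∀ q ∈ Q i, inn q ∉ Q j)
    (hSρ : ∀ p, S (ρ p) = S p)
    (hpass : ∀ j, ∀ q ∈ Q j, S q = false → ∀ r, ρ.SameCycle q r →
      r = q ∨ r = inn q ∨ ((∀ i, r ∉ Q i) ∧ ∀ i, ∀ q' ∈ Q i, r ≠ inn q'))
    (hsurv : ∀ p, S p = true → ∃ j, p ∈ Q j ∨ ∃ q ∈ Q j, p = inn q)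
    (z' : E → ZMod 2)
    (hz₁ : ∀ j p q, CycNext ((Q j).filter S) p q → z' (inn q) = z' p)
    (hz₂ : ∀ p₀, S p₀ = true → ∑ p with ρ.SameCycle p p₀, z' p = 0) :
    ∃ h : E → ZMod 2, (∀ p, S p = true → h (ρ p) = h p + z' p) ∧
      ∀ j p q, CycNext ((Q j).filter S) p q → h (inn q) = h p + z' p := by
  have hS := fun p q => eq_of_sameCycle (p := p) (q := q) hSρ
  refine exists_coloring_of_extension hcol Q hQ hdisj inn S hinn
    (fun j q hq => hS _ _ (hpoint j q hq)) hSρ hsurv ?_ z' hz₁ hz₂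
  intro g hg
  -- The cycle of the old map is supported on the curves: `g` at the ends where a curve leaves, the
  -- same value at the other end of that segment, and 0 elsewhere.
  obtain ⟨z, hzU, hzN, hz0⟩ : ∃ z : E → ZMod 2, (∀ j, ∀ p ∈ Q j, z p = g p) ∧
      (∀ p, (∀ j, p ∉ Q j) → ∀ j, ∀ a ∈ Q j, seg p a → z p = g a) ∧
      (∀ p, (∀ j, p ∉ Q j) → (∀ j, ∀ a ∈ Q j, ¬ seg p a) → z p = 0) := by
    refine ⟨fun p => if ∃ j, p ∈ Q j then g p else
      if h : ∃ a, (∃ j, a ∈ Q j) ∧ seg p a then g h.choose else 0, ?_, ?_, ?_⟩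
    · intro j p hp
      exact if_pos ⟨j, hp⟩
    · intro p hp j a ha hpa
      have h : ∃ a, (∃ j, a ∈ Q j) ∧ seg p a := ⟨a, ⟨j, ha⟩, hpa⟩
      dsimp only
      rw [if_neg (fun ⟨j, hj⟩ => hp j hj), dif_pos h, huniq _ _ _ h.choose_spec.2 hpa]
    · intro p hp hp'
      dsimp only
      rw [if_neg (fun ⟨j, hj⟩ => hp j hj), dif_neg]
      rintro ⟨a, ⟨j, ha⟩, hpa⟩
      exact hp' j a ha hpa
  have hsegQ : ∀ i j p q, p ∈ Q i → seg p q → q ∉ Q j := by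
    intro i j p q hp hpq
    obtain ⟨b, hb⟩ := exists_cycNext hp
    rw [huniq _ _ _ hpq (hinn i p b hb)]
    exact hnot i j b hb.mem_right
  have hzinn : ∀ j p q, CycNext (Q j) p q → z (inn q) = g p := fun j p q h =>
    hzN _ (fun i => hnot j i q h.mem_right) j p h.mem_left (hsymm _ _ (hinn j p q h))
  have hzoff : ∀ r, (∀ i, r ∉ Q i) → (∀ i, ∀ q' ∈ Q i, r ≠ inn q') → z r = 0 := by
    intro r h₁ h₂
    refine hz0 r h₁ fun j a ha hra => ?_
    obtain ⟨b, hb⟩ := exists_cycNext ha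
    exact h₂ j b hb.mem_right (huniq _ _ _ (hsymm _ _ hra) (hinn j a b hb))
  refine ⟨z, hzU, hzinn, ?_, ?_, ?_⟩
  · intro p q hpq
    by_cases hp : ∃ j, p ∈ Q j
    · obtain ⟨j, hp⟩ := hp
      rw [hzU j p hp, hzN q (fun i => hsegQ j i p q hp hpq) j p hp (hsymm _ _ hpq)]
    · push Not at hp
      by_cases hq : ∃ j, q ∈ Q j
      · obtain ⟨j, hq⟩ := hq
        rw [hzU j q hq, hzN p hp j q hq hpq]
      · push Not at hq
        rw [hz0 p hp fun j a ha hpa => hq j (huniq _ _ _ hpq hpa ▸ ha),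
          hz0 q hq fun j a ha hqa => hp j (huniq _ _ _ (hsymm _ _ hpq) hqa ▸ ha)]
  · intro p₀ hp₀
    by_cases hex : ∃ j, ∃ q ∈ Q j, ρ.SameCycle q p₀
    · obtain ⟨j, q, hq, hqp⟩ := hex
      have hSq : S q = false := by rw [← hS q p₀ hqp, hp₀]
      have hne : q ≠ inn q := fun h => hnot j j q hq (h ▸ hq)
      -- A dropped point that is met is passed only once, and the two ends of that passage carry
      -- equal values.
      rw [← Finset.sum_subset (s₁ := {q, inn q}), Finset.sum_pair hne]
      · obtain ⟨a, ha⟩ := exists_cycPrev hq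
        rw [hzU j q hq, hzinn j a q ha, hg j a q ha hSq, CharTwo.add_self_eq_zero]
      · intro r hr
        rw [Finset.mem_filter]
        simp only [Finset.mem_insert, Finset.mem_singleton] at hr
        rcases hr with rfl | rfl
        · exact ⟨Finset.mem_univ _, hqp⟩
        · exact ⟨Finset.mem_univ _, (hpoint j q hq).symm.trans hqp⟩
      · intro r hr hr'
        simp only [Finset.mem_insert, Finset.mem_singleton, not_or] at hr'
        rcases hpass j q hq hSq r (hqp.trans (Finset.mem_filter.1 hr).2.symm) with h | h | h
        · exact absurd h hr'.1
        · exact absurd h hr'.2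
        · exact hzoff r h.1 h.2
    · push Not at hex
      refine Finset.sum_eq_zero fun r hr => ?_
      have hr := (Finset.mem_filter.1 hr).2
      refine hzoff r (fun i hi => hex i r hi hr) fun i q' hq' hrq => ?_
      exact hex i q' hq' ((hpoint i q' hq').trans (hrq ▸ hr))
  · intro h hρ _ j c hc hSc
    refine color_eq_of_sameCycle hρ (fun h => hnot j j c hc (by rw [h]; exact hc))
      (hpoint j c hc).symm fun r hr hr₁ hr₂ => ?_
    rcases hpass j c hc hSc r ((hpoint j c hc).trans hr) with h | h | h
    · exact absurd h hr₂
    · exact absurd h hr₁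
    · exact hzoff r h.1 h.2

end Traversal

/-! ### Planar link codes -/

theorem oppositeEnd_oppositeEnd {X : Type*} (p : X × ZMod 4) : oppositeEnd (oppositeEnd p) = p := by
  obtain ⟨x, i⟩ := p
  have h : ∀ i : ZMod 4, i + 2 + 2 = i := by decide
  simp [oppositeEnd, h]

theorem oppositeEnd_injective {X : Type*} : Function.Injective (oppositeEnd (X := X)) :=
  fun p q h => by rw [← oppositeEnd_oppositeEnd p, h, oppositeEnd_oppositeEnd]

@[simp] theorem oppositeEnd_fst {X : Type*} (p : X × ZMod 4) : (oppositeEnd p).1 = p.1 := rfl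

namespace LinkCode

variable {k : ℕ}

theorem mem_passages {L : LinkCode k} {p : Crossing × ZMod 4} :
    p ∈ L.passages ↔ ∃ j, p ∈ L j := by
  simp [passages, List.mem_flatten, List.mem_ofFn]

theorem hasCrossing_of_mem {L : LinkCode k} {p : Crossing × ZMod 4} {j : Fin k} (h : p ∈ L j) :
    L.HasCrossing p.1 := ⟨p, mem_passages.2 ⟨j, h⟩, rfl⟩

/-- Each of the two strands of every crossing is passed exactly once. -/
def IsTwiceMet (L : LinkCode k) : Prop :=
  ∀ x, L.HasCrossing x → ∀ i : ZMod 4,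
    L.passages.count (x, i) + L.passages.count (x, i + 2) = 1

namespace IsTwiceMet

variable {L : LinkCode k} (hL : L.IsTwiceMet)

include hL

theorem nodup_passages : L.passages.Nodup := by
  rw [List.nodup_iff_count_le_one]
  intro p
  by_cases hp : p ∈ L.passages
  · have := hL p.1 ⟨p, hp, rfl⟩ p.2
    rw [Prod.mk.eta] at this
    omega
  · rw [List.count_eq_zero_of_not_mem hp]
    omega

theorem nodup (j : Fin k) : (L j).Nodup :=
  (List.nodup_flatten.1 hL.nodup_passages).1 _ (List.mem_ofFn.2 ⟨j, rfl⟩)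

theorem eq_of_mem {i j : Fin k} {p : Crossing × ZMod 4} (hi : p ∈ L i) (hj : p ∈ L j) : i = j := by
  have h := (List.nodup_flatten.1 hL.nodup_passages).2
  rw [List.pairwise_ofFn] at h
  rcases lt_trichotomy i j with h' | h' | h'
  · exact absurd hj (h h' hi)
  · exact h'
  · exact absurd hi (h h' hj)

theorem not_mem_opposite {p : Crossing × ZMod 4} (hp : p ∈ L.passages) :
    oppositeEnd p ∉ L.passages := by
  intro h
  have h₁ := List.count_pos_iff.2 hp
  have h₂ := List.count_pos_iff.2 h
  have h₃ := hL p.1 ⟨p, hp, rfl⟩ p.2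
  rw [Prod.mk.eta] at h₃
  unfold oppositeEnd at h₂
  omega

theorem mem_or_opposite_mem {p : Crossing × ZMod 4} (hp : L.HasCrossing p.1) :
    p ∈ L.passages ∨ oppositeEnd p ∈ L.passages := by
  by_contra! h
  have h₁ := List.count_eq_zero_of_not_mem h.1
  have h₂ := List.count_eq_zero_of_not_mem h.2
  have h₃ := hL p.1 hp p.2
  rw [Prod.mk.eta] at h₃
  unfold oppositeEnd at h₂
  omega

theorem seg_irrefl {p : Crossing × ZMod 4} : ¬ L.Seg p p := by
  intro h
  obtain ⟨j, h⟩ : L.Next p (oppositeEnd p) := h.elim id id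
  exact hL.not_mem_opposite (mem_passages.2 ⟨j, CycNext.mem_left h⟩)
    (mem_passages.2 ⟨j, CycNext.mem_right h⟩)

theorem next_right_unique {p q q' : Crossing × ZMod 4} (h : L.Next p q) (h' : L.Next p q') :
    q = q' := by
  obtain ⟨i, h⟩ := h
  obtain ⟨j, h'⟩ := h'
  obtain rfl := hL.eq_of_mem (CycNext.mem_left h) (CycNext.mem_left h')
  exact CycNext.right_unique (hL.nodup i) h h'

theorem next_left_unique {p p' q : Crossing × ZMod 4} (h : L.Next p q) (h' : L.Next p' q) :
    p = p' := by
  obtain ⟨i, h⟩ := h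
  obtain ⟨j, h'⟩ := h'
  obtain rfl := hL.eq_of_mem (CycNext.mem_right h) (CycNext.mem_right h')
  exact CycNext.left_unique (hL.nodup i) h h'

theorem seg_unique {p q q' : Crossing × ZMod 4} (h : L.Seg p q) (h' : L.Seg p q') : q = q' := by
  have key : ∀ {q q'}, L.Next p (oppositeEnd q) → ¬ L.Next q' (oppositeEnd p) := by
    rintro q q' ⟨i, h⟩ ⟨j, h'⟩
    exact hL.not_mem_opposite (mem_passages.2 ⟨i, CycNext.mem_left h⟩)
      (mem_passages.2 ⟨j, CycNext.mem_right h'⟩)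
  rcases h with h | h <;> rcases h' with h' | h'
  · exact oppositeEnd_injective (hL.next_right_unique h h')
  · exact absurd h' (key h)
  · exact absurd h (key h')
  · exact hL.next_left_unique h h'

theorem exists_seg {p : Crossing × ZMod 4} (hp : L.HasCrossing p.1) :
    ∃ q, L.HasCrossing q.1 ∧ L.Seg p q := by
  rcases hL.mem_or_opposite_mem hp with h | h
  · obtain ⟨j, h⟩ := mem_passages.1 h
    obtain ⟨q, hq⟩ := exists_cycNext h
    refine ⟨oppositeEnd q, hasCrossing_of_mem (p := q) hq.mem_right, Or.inl ⟨j, ?_⟩⟩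
    rwa [oppositeEnd_oppositeEnd]
  · obtain ⟨j, h⟩ := mem_passages.1 h
    obtain ⟨q, hq⟩ := exists_cycPrev h
    exact ⟨q, hasCrossing_of_mem hq.mem_left, Or.inr ⟨j, hq⟩⟩

end IsTwiceMet

/-- The ends of a link diagram. -/
abbrev Ends (L : LinkCode k) : Type := {p : Crossing × ZMod 4 // L.HasCrossing p.1}

theorem finite_hasCrossing (L : LinkCode k) : {x | L.HasCrossing x}.Finite := by
  have : {x | L.HasCrossing x} = {x | x ∈ L.passages.map Prod.fst} := by
    ext x
    simp [HasCrossing, List.mem_map]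
  rw [this]
  exact List.finite_toSet _

instance finite_ends (L : LinkCode k) : Finite L.Ends := by
  have := L.finite_hasCrossing.to_subtype
  refine Finite.of_injective (β := {x | L.HasCrossing x} × ZMod 4)
    (fun p => (⟨p.1.1, p.2⟩, p.1.2)) ?_
  rintro ⟨⟨x, i⟩, hp⟩ ⟨⟨y, j⟩, hq⟩ h
  simp_all

noncomputable instance fintype_ends (L : LinkCode k) : Fintype L.Ends := Fintype.ofFinite _

/-- The next end at the same crossing. -/
def endRot (L : LinkCode k) : Equiv.Perm L.Ends where
  toFun p := ⟨(p.1.1, p.1.2 + 1), p.2⟩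
  invFun p := ⟨(p.1.1, p.1.2 - 1), p.2⟩
  left_inv p := by ext <;> simp
  right_inv p := by ext <;> simp

theorem endRot_pow (L : LinkCode k) (p : L.Ends) (n : ℕ) :
    (L.endRot ^ n) p = ⟨(p.1.1, p.1.2 + n), p.2⟩ := by
  induction n with
  | zero => simp
  | succ n ih =>
    rw [pow_succ', Equiv.Perm.mul_apply, ih]
    simp only [endRot, Equiv.coe_fn_mk, Nat.cast_succ, add_assoc]

theorem sameCycle_endRot {L : LinkCode k} {p q : L.Ends} :
    L.endRot.SameCycle p q ↔ p.1.1 = q.1.1 := by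
  constructor
  · intro h
    obtain ⟨n, rfl⟩ := h.exists_nat_pow_eq
    rw [endRot_pow]
  · intro h
    refine ⟨((q.1.2 - p.1.2).val : ℕ), ?_⟩
    rw [zpow_natCast, endRot_pow]
    exact Subtype.ext (Prod.ext h (by simp))

theorem sum_sameCycle_endRot {L : LinkCode k} (p : L.Ends)
    {_ : DecidablePred fun q => L.endRot.SameCycle q p} (f : L.Ends → ZMod 2) :
    ∑ q with L.endRot.SameCycle q p, f q = ∑ i : ZMod 4, f ⟨(p.1.1, i), p.2⟩ := by
  symm
  refine Finset.sum_bij (fun i _ => ⟨(p.1.1, i), p.2⟩) ?_ ?_ ?_ fun _ _ => rfl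
  · intro i _
    simp [sameCycle_endRot]
  · intro i _ j _ h
    simpa using h
  · rintro ⟨⟨x, i⟩, hq⟩ h
    have h : x = p.1.1 := by simpa [sameCycle_endRot] using h
    subst h
    exact ⟨i, Finset.mem_univ _, rfl⟩

theorem isPlanarMap_iff {L : LinkCode k} (hL : L.IsTwiceMet) :
    IsPlanarMap (E := L.Ends) (fun p q => q.1 = (p.1.1, p.1.2 + 1))
      (fun p q => L.Seg p.1 q.1) ↔
    HasColorings (fun p q => q = L.endRot p) (fun p q : L.Ends => L.Seg p.1 q.1) := by
  have : (fun p q : L.Ends => q.1 = (p.1.1, p.1.2 + 1)) = fun p q => q = L.endRot p := by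
    ext p q
    rw [Subtype.ext_iff]
    rfl
  rw [this]
  apply isPlanarMap_iff_hasColorings
  · intro p q h
    exact h.symm
  · intro p
    exact hL.seg_irrefl
  · intro p
    obtain ⟨q, hq, h⟩ := hL.exists_seg p.2
    exact ⟨⟨q, hq⟩, h, fun q' h' => Subtype.ext (hL.seg_unique h' h)⟩

/-- Planarity of a link code in terms of colourings. -/
theorem isDiagram_iff {L : LinkCode k} : L.IsDiagram ↔ L.IsTwiceMet ∧
    ∀ z : Crossing × ZMod 4 → ZMod 2,
      (∀ j p q, CycNext (L j) p q → z p = z (oppositeEnd q)) →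
      (∀ x, L.HasCrossing x → ∑ i : ZMod 4, z (x, i) = 0) →
      ∃ h : Crossing × ZMod 4 → ZMod 2,
        (∀ x, L.HasCrossing x → ∀ i, h (x, i + 1) = h (x, i) + z (x, i)) ∧
        ∀ j p q, CycNext (L j) p q → h (oppositeEnd q) = h p + z p := by
  classical
  show L.IsTwiceMet ∧ _ ↔ _
  refine and_congr_right fun hL => ?_
  rw [isPlanarMap_iff hL]
  constructor
  · intro H z hz₁ hz₂
    obtain ⟨h, hh₁, hh₂⟩ := H (fun p => z p.1) (by
      rintro p q (⟨j, h⟩ | ⟨j, h⟩)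
      · rw [hz₁ j _ _ h, oppositeEnd_oppositeEnd]
      · rw [hz₁ j _ _ h, oppositeEnd_oppositeEnd]) (by
      intro p₀
      simp only [quot_perm_eq_iff]
      rw [sum_sameCycle_endRot p₀ (fun p => z p.1)]
      exact hz₂ _ p₀.2)
    refine ⟨fun p => if hp : L.HasCrossing p.1 then h ⟨p, hp⟩ else 0, ?_, ?_⟩
    · intro x hx i
      simp only [dif_pos hx]
      exact hh₁ ⟨(x, i), hx⟩ _ rfl
    · intro j p q hpq
      have hp : L.HasCrossing p.1 := hasCrossing_of_mem hpq.mem_left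
      have hq : L.HasCrossing (oppositeEnd q).1 := hasCrossing_of_mem (p := q) hpq.mem_right
      simp only [dif_pos hp, dif_pos hq]
      refine hh₂ ⟨p, hp⟩ ⟨_, hq⟩ (Or.inl ⟨j, ?_⟩)
      rw [oppositeEnd_oppositeEnd]
      exact hpq
  · intro H z hz₁ hz₂
    obtain ⟨h, hh₁, hh₂⟩ := H (fun p => if hp : L.HasCrossing p.1 then z ⟨p, hp⟩ else 0) (by
      intro j p q hpq
      have hp : L.HasCrossing p.1 := hasCrossing_of_mem hpq.mem_left
      have hq : L.HasCrossing (oppositeEnd q).1 := hasCrossing_of_mem (p := q) hpq.mem_right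
      simp only [dif_pos hp, dif_pos hq]
      refine hz₁ ⟨p, hp⟩ ⟨_, hq⟩ (Or.inl ⟨j, ?_⟩)
      rw [oppositeEnd_oppositeEnd]
      exact hpq) (by
      intro x hx
      simp only [dif_pos hx]
      have := hz₂ ⟨(x, 0), hx⟩
      simp only [quot_perm_eq_iff] at this
      rwa [sum_sameCycle_endRot] at this)
    refine ⟨fun p => h p.1, ?_, ?_⟩
    · rintro ⟨⟨x, i⟩, hx⟩ q rfl
      have := hh₁ x hx i
      simp only [dif_pos hx] at this
      exact this
    · rintro ⟨p, hp⟩ ⟨q, hq⟩ (⟨j, hpq⟩ | ⟨j, hpq⟩)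
      · have := hh₂ j _ _ hpq
        rw [oppositeEnd_oppositeEnd, dif_pos hp] at this
        exact this
      · have h₁ := hh₂ j _ _ hpq
        rw [oppositeEnd_oppositeEnd, dif_pos hq] at h₁
        have h₂ := hz₁ ⟨p, hp⟩ ⟨q, hq⟩ (Or.inr ⟨j, hpq⟩)
        rw [h₂]
        show h q = h p + _
        rw [h₁, add_assoc, CharTwo.add_self_eq_zero, add_zero]

end LinkCode

/-! ### Small diagrams with only virtual crossings are trivial -/

namespace LinkCode

variable {k : ℕ}

theorem mem_erase {L : LinkCode k} {S : List Crossing} {j : Fin k} {p : Crossing × ZMod 4} :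
    p ∈ L.erase S j ↔ p ∈ L j ∧ p.1 ∉ S := by
  simp [erase]

theorem hasCrossing_erase {L : LinkCode k} {S : List Crossing} {x : Crossing} :
    (L.erase S).HasCrossing x ↔ L.HasCrossing x ∧ x ∉ S := by
  simp only [HasCrossing, mem_passages, mem_erase]
  constructor
  · rintro ⟨p, ⟨j, h₁, h₂⟩, rfl⟩
    exact ⟨⟨p, ⟨j, h₁⟩, rfl⟩, h₂⟩
  · rintro ⟨⟨p, ⟨j, h₁⟩, rfl⟩, h₂⟩
    exact ⟨p, ⟨j, h₁, h₂⟩, rfl⟩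

theorem passages_erase (L : LinkCode k) (S : List Crossing) :
    (L.erase S).passages = L.passages.filter fun p => p.1 ∉ S := by
  unfold passages
  rw [List.filter_flatten, List.map_ofFn]
  rfl

theorem IsTwiceMet.erase {L : LinkCode k} (hL : L.IsTwiceMet) (S : List Crossing) :
    (L.erase S).IsTwiceMet := by
  intro x hx i
  obtain ⟨hx, hxS⟩ := hasCrossing_erase.1 hx
  rw [passages_erase, List.count_filter (by simpa using hxS),
    List.count_filter (by simpa using hxS)]
  exact hL x hx i

/-- Deleting crossings from a planar diagram leaves a planar diagram if the inner ends of the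
deleted crossings are joined to each other in such a way that the colours agree outside. -/
theorem IsDiagram.erase_of_inner {L : LinkCode k} (hL : L.IsDiagram) (S : List Crossing)
    (I : Crossing × ZMod 4 → Prop) (hIS : ∀ p, p.1 ∈ S ↔ I p ∨ I (oppositeEnd p))
    (hIopp : ∀ p, I p → ¬ I (oppositeEnd p)) (hIseg : ∀ p, I p → ∃ q, I q ∧ L.Seg p q)
    (hpass : ∀ z h : Crossing × ZMod 4 → ZMod 2,
      (∀ p q, L.Seg p q → z p = z q) → (∀ p, p.1 ∈ S → z (oppositeEnd p) = z p) →
      (∀ x ∈ S, ∀ i, h (x, i + 1) = h (x, i) + z (x, i)) →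
      (∀ p q, L.Seg p q → h q = h p + z p) →
      ∀ p q, I p → I q → L.Seg p q → h (oppositeEnd q) = h (oppositeEnd p) + z (oppositeEnd p)) :
    (L.erase S).IsDiagram := by
  classical
  have hT : L.IsTwiceMet := hL.1
  have hcol := (isPlanarMap_iff hT).1 hL.2
  refine isDiagram_iff.2 ⟨hT.erase S, fun z₀ hz₁ hz₂ => ?_⟩
  -- Inner ends are joined to inner ends, so a passage that leaves inwards is followed by one that
  -- enters from inside and leaves outwards. The deleted crossings are thus traversed in pairs of
  -- passages.
  have hI₁ : ∀ j r s, I r → CycNext (L j) r s → ¬ I s ∧ I (oppositeEnd s) := by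
    intro j r s hr hrs
    obtain ⟨q, hq, hrq⟩ := hIseg r hr
    have : q = oppositeEnd s := hT.seg_unique hrq (Or.inl ⟨j, by
      rw [oppositeEnd_oppositeEnd]; exact hrs⟩)
    subst this
    refine ⟨?_, hq⟩
    have := hIopp _ hq
    rwa [oppositeEnd_oppositeEnd] at this
  have hI₂ : ∀ j r s, CycNext (L j) r s → s.1 ∈ S → ¬ I s → I r := by
    intro j r s hrs hs hIs
    obtain ⟨q, hq, hsq⟩ := hIseg _ (((hIS s).1 hs).resolve_left hIs)
    have : q = r := hT.seg_unique hsq (Or.inr ⟨j, by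
      rw [oppositeEnd_oppositeEnd]; exact hrs⟩)
    exact this ▸ hq
  have hISr : ∀ r, I r → r.1 ∈ S := fun r hr => (hIS r).2 (Or.inl hr)
  have hprev : ∀ q, ∃ p, ∀ j, q ∈ L j → CycNext (L j) p q := by
    intro q
    by_cases hq : ∃ j, q ∈ L j
    · obtain ⟨j, hj⟩ := hq
      obtain ⟨p, hp⟩ := exists_cycPrev hj
      exact ⟨p, fun i hi => by rwa [hT.eq_of_mem hi hj]⟩
    · exact ⟨q, fun j hj => absurd ⟨j, hj⟩ hq⟩
  choose prev hprev using hprev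
  have hprev_eq : ∀ j p q, CycNext (L j) p q → prev q = p := fun j p q h =>
    (hprev q j h.mem_right).left_unique (hT.nodup j) h
  -- the outer passages
  let Q : Fin k → List L.Ends := fun j =>
    ((L j).pmap Subtype.mk fun p hp => hasCrossing_of_mem hp).filter fun p => ¬ I p.1
  have hQmap : ∀ j, (Q j).map Subtype.val = (L j).filter fun p => ¬ I p := by
    intro j
    simp only [Q]
    show List.map _ (List.filter ((fun p => decide (¬ I p)) ∘ Subtype.val) _) = _
    rw [← List.filter_map, List.map_pmap]
    simp
  have hQmem : ∀ j (q : L.Ends), q ∈ Q j ↔ q.1 ∈ L j ∧ ¬ I q.1 := by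
    intro j q
    have : q ∈ Q j ↔ q.1 ∈ (Q j).map Subtype.val := by
      rw [List.mem_map]
      constructor
      · intro h; exact ⟨q, h, rfl⟩
      · rintro ⟨q', h, h'⟩
        rwa [← Subtype.ext h']
    rw [this, hQmap]
    simp
  have hQnext : ∀ j (p q : L.Ends), CycNext (Q j) p q →
      CycNext (L j) p.1 q.1 ∨ ∃ r, I r ∧ CycNext (L j) p.1 r ∧ CycNext (L j) r q.1 := by
    intro j p q h
    rw [← cycNext_map Subtype.val_injective, hQmap] at h
    obtain ⟨a, ha, haq⟩ := h.exists_chain (hT.nodup j)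
    rcases Relation.ReflTransGen.cases_tail ha with rfl | ⟨b, hb, hba, hIa⟩
    · exact Or.inl haq
    · have hIa : I a := by simpa using hIa
      rcases Relation.ReflTransGen.cases_tail hb with rfl | ⟨c, -, -, hIb⟩
      · exact Or.inr ⟨a, hIa, hba, haq⟩
      · exact absurd hIa (hI₁ j b a (by simpa using hIb) hba).1
  let T : L.Ends → Bool := fun p => p.1.1 ∉ S
  have hQfnext : ∀ j (p q : L.Ends), CycNext ((Q j).filter T) p q ↔
      CycNext (L.erase S j) p.1 q.1 := by
    intro j p q
    have : ((Q j).filter T).map Subtype.val = L.erase S j := by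
      show List.map _ (List.filter
        ((fun p : Crossing × ZMod 4 => decide (p.1 ∉ S)) ∘ Subtype.val) _) = _
      rw [← List.filter_map, hQmap, List.filter_filter]
      unfold LinkCode.erase
      refine List.filter_congr fun p _ => ?_
      by_cases hp : p.1 ∈ S
      · simp [hp]
      · have : ¬ I p := fun h => hp (hISr p h)
        simp [hp, this]
    rw [← this, cycNext_map Subtype.val_injective]
  -- An outer passage preceded by an inner one is merged with it, and the merged passage enters
  -- where the inner one did.
  let innEnd : Crossing × ZMod 4 → Crossing × ZMod 4 := fun q =>
    if I (prev q) then oppositeEnd (prev q) else oppositeEnd q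
  let inn : L.Ends → L.Ends := fun q =>
    if h : L.HasCrossing (innEnd q.1).1 then ⟨innEnd q.1, h⟩ else q
  have hinn₁ : ∀ j p (q : L.Ends), CycNext (L j) p q.1 → ¬ I p → (inn q).1 = oppositeEnd q.1 := by
    intro j p q h hp
    have : innEnd q.1 = oppositeEnd q.1 := by
      simp only [innEnd, hprev_eq j p q.1 h, if_neg hp]
    simp only [inn, this]
    rw [dif_pos (by exact q.2)]
  have hinn₂ : ∀ j p (q : L.Ends), CycNext (L j) p q.1 → I p → (inn q).1 = oppositeEnd p := by
    intro j p q h hp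
    have : innEnd q.1 = oppositeEnd p := by
      simp only [innEnd, hprev_eq j p q.1 h, if_pos hp]
    simp only [inn, this]
    rw [dif_pos (by exact hasCrossing_of_mem (p := p) h.mem_left)]
  have hQprev : ∀ j (q : L.Ends), q ∈ Q j → ∃ p, CycNext (L j) p q.1 :=
    fun j q hq => exists_cycPrev ((hQmem j q).1 hq).1
  have hinnT : ∀ j (q : L.Ends), q.1 ∈ L j → q.1.1 ∉ S → (inn q).1 = oppositeEnd q.1 := by
    intro j q hq hqS
    obtain ⟨p, hp⟩ := exists_cycPrev hq
    refine hinn₁ j p q hp fun hIp => hqS ?_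
    exact (hIS _).2 (Or.inr (hI₁ j p q.1 hIp hp).2)
  have hlift : ∀ f : L.Ends → ZMod 2, ∃ f' : Crossing × ZMod 4 → ZMod 2,
      ∀ p : L.Ends, f' p.1 = f p := fun f =>
    ⟨fun p => if h : L.HasCrossing p.1 then f ⟨p, h⟩ else 0, fun p => dif_pos p.2⟩
  have hsegmem : ∀ {p q}, L.Seg p q → L.HasCrossing p.1 := by
    rintro p q (⟨j, h⟩ | ⟨j, h⟩)
    · exact hasCrossing_of_mem (CycNext.mem_left h)
    · exact hasCrossing_of_mem (p := oppositeEnd p) (CycNext.mem_right h)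
  have hScross : ∀ p : Crossing × ZMod 4, p.1 ∈ S → L.HasCrossing p.1 := by
    intro p hp
    rcases (hIS p).1 hp with h | h
    · obtain ⟨q, -, hq⟩ := hIseg _ h
      exact hsegmem hq
    · obtain ⟨q, -, hq⟩ := hIseg _ h
      exact hsegmem (p := oppositeEnd p) hq
  obtain ⟨h, hh₁, hh₂⟩ := exists_coloring_of_extension hcol Q
    (fun j => List.Nodup.of_map Subtype.val (by rw [hQmap]; exact (hT.nodup j).filter _))
    (fun i j q hi hj => hT.eq_of_mem ((hQmem i q).1 hi).1 ((hQmem j q).1 hj).1) inn T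
    (by
      intro j p q hpq
      rcases hQnext j p q hpq with h | ⟨r, hr, hpr, hrq⟩
      · rw [hinn₁ j p.1 q h ((hQmem j p).1 hpq.mem_left).2]
        exact Or.inl ⟨j, by rw [oppositeEnd_oppositeEnd]; exact h⟩
      · rw [hinn₂ j r q hrq hr]
        exact Or.inl ⟨j, by rw [oppositeEnd_oppositeEnd]; exact hpr⟩)
    (by
      intro j q hq
      obtain ⟨p, hp⟩ := hQprev j q hq
      by_cases hIp : I p
      · have h₁ : p.1 ∈ S := hISr p hIp
        have h₂ : q.1.1 ∈ S := (hIS _).2 (Or.inr (hI₁ j p q.1 hIp hp).2)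
        simp only [T, hinn₂ j p q hp hIp, oppositeEnd_fst, h₁, h₂]
      · simp only [T, hinn₁ j p q hp hIp, oppositeEnd_fst])
    (fun p => rfl)
    (by
      intro p hp
      have hpS : p.1.1 ∉ S := by simpa [T] using hp
      rcases hT.mem_or_opposite_mem p.2 with h | h
      · obtain ⟨j, h⟩ := mem_passages.1 h
        exact ⟨j, Or.inl ((hQmem j p).2 ⟨h, fun hI => hpS (hISr _ hI)⟩)⟩
      · obtain ⟨j, h⟩ := mem_passages.1 h
        refine ⟨j, Or.inr ⟨⟨oppositeEnd p.1, p.2⟩, (hQmem j _).2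
          ⟨h, fun hI => hpS (hISr (oppositeEnd p.1) hI)⟩, Subtype.ext ?_⟩⟩
        rw [hinnT j ⟨oppositeEnd p.1, p.2⟩ h hpS, oppositeEnd_oppositeEnd])
    (by
      intro g hg
      obtain ⟨g', hg'⟩ := hlift g
      -- On an inner segment the cycle takes the value of the outer passage just before it, so it
      -- runs straight through the deleted crossings.
      let V : Crossing × ZMod 4 → ZMod 2 := fun r => if I r then g' (prev r) else g' r
      have hVI : ∀ j p r, CycNext (L j) p r → I r → V r = g' p := by
        intro j p r hpr hr
        simp only [V, if_pos hr, hprev_eq j p r hpr]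
      have hVN : ∀ r, ¬ I r → V r = g' r := fun r hr => if_neg hr
      let z : Crossing × ZMod 4 → ZMod 2 := fun p =>
        if p ∈ L.passages then V p else V (prev (oppositeEnd p))
      have hzP : ∀ j p, p ∈ L j → z p = V p := fun j p hp => if_pos (mem_passages.2 ⟨j, hp⟩)
      have hzO : ∀ j p q, CycNext (L j) p q → z (oppositeEnd q) = V p := by
        intro j p q h
        simp only [z, if_neg (hT.not_mem_opposite (mem_passages.2 ⟨j, h.mem_right⟩)),
          oppositeEnd_oppositeEnd, hprev_eq j p q h]
      have hzseg : ∀ p q, L.Seg p q → z p = z q := by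
        rintro p q (⟨j, h⟩ | ⟨j, h⟩)
        · have := hzO j _ _ h
          rw [oppositeEnd_oppositeEnd] at this
          rw [this, hzP j p (CycNext.mem_left h)]
        · have := hzO j _ _ h
          rw [oppositeEnd_oppositeEnd] at this
          rw [this, hzP j q (CycNext.mem_left h)]
      have hzopp' : ∀ j r, r ∈ L j → r.1 ∈ S → z (oppositeEnd r) = z r := by
        intro j r hr hrS
        obtain ⟨b, hb⟩ := exists_cycPrev hr
        rw [hzO j b r hb, hzP j r hr]
        by_cases hIr : I r
        · rw [hVI j b r hb hIr, hVN b fun hIb => (hI₁ j b r hIb hb).1 hIr]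
        · have hIb := hI₂ j b r hb hrS hIr
          obtain ⟨c, hc⟩ := exists_cycPrev hb.mem_left
          rw [hVI j c b hc hIb, hVN r hIr]
          have hrc : L.HasCrossing r.1 := hasCrossing_of_mem hr
          obtain ⟨p, hp⟩ := exists_cycPrev ((hQmem j ⟨r, hrc⟩).2 ⟨hr, hIr⟩)
          have hpc : p.1 = c := by
            rcases hQnext j p _ hp with h | ⟨r', -, hpr, hrr⟩
            · have := ((hQmem j p).1 hp.mem_left).2
              rw [CycNext.left_unique (hT.nodup j) h hb] at this
              exact absurd hIb this
            · rw [CycNext.left_unique (hT.nodup j) hrr hb] at hpr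
              exact CycNext.left_unique (hT.nodup j) hpr hc
          have := hg j p ⟨r, hrc⟩ hp (by simp [T, hrS])
          rw [← hpc, hg' p, ← this, ← hg' ⟨r, hrc⟩]
      have hzopp : ∀ p : Crossing × ZMod 4, p.1 ∈ S → z (oppositeEnd p) = z p := by
        intro p hp
        rcases hT.mem_or_opposite_mem (hScross p hp) with h | h
        · obtain ⟨j, h⟩ := mem_passages.1 h
          exact hzopp' j p h hp
        · obtain ⟨j, h⟩ := mem_passages.1 h
          have := hzopp' j _ h hp
          rw [oppositeEnd_oppositeEnd] at this
          exact this.symm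
      refine ⟨fun p => z p.1, ?_, ?_, fun p q => hzseg p.1 q.1, ?_, ?_⟩
      · intro j q hq
        obtain ⟨h₁, h₂⟩ := (hQmem j q).1 hq
        show z q.1 = g q
        rw [hzP j _ h₁, hVN _ h₂, hg']
      · intro j p q hpq
        have hp := ((hQmem j p).1 hpq.mem_left).2
        show z (inn q).1 = g p
        rcases hQnext j p q hpq with h | ⟨r, hr, hpr, hrq⟩
        · rw [hinn₁ j p.1 q h hp, hzO j _ _ h, hVN _ hp, hg']
        · rw [hinn₂ j r q hrq hr, hzO j _ _ hpr, hVN _ hp, hg']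
      · intro p₀ hp₀
        have hpS : p₀.1.1 ∈ S := by simpa [T] using hp₀
        refine (sum_sameCycle_endRot p₀ (fun p => z p.1)).trans ?_
        have h₀ := hzopp (p₀.1.1, 0) hpS
        have h₁ := hzopp (p₀.1.1, 1) hpS
        show z (p₀.1.1, 0) + (z (p₀.1.1, 1) + (z (p₀.1.1, 0 + 2) + (z (p₀.1.1, 1 + 2) + 0))) = 0
        unfold oppositeEnd at h₀ h₁
        dsimp only at h₀ h₁
        rw [h₀, h₁]
        generalize z (p₀.1.1, 0) = u
        generalize z (p₀.1.1, 1) = v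
        revert u v; decide
      · intro h hρ hs j q hq hTq
        have hqS : q.1.1 ∈ S := by simpa [T] using hTq
        obtain ⟨b, hb⟩ := hQprev j q hq
        have hIb := hI₂ j b q.1 hb hqS ((hQmem j q).1 hq).2
        obtain ⟨h', hh'⟩ := hlift h
        have key := hpass z h' hzseg hzopp (by
            intro x hx i
            have hx' := hScross (x, i) hx
            have := hρ ⟨(x, i), hx'⟩
            rw [← hh' ⟨(x, i), hx'⟩, ← hh' (L.endRot _)] at this
            exact this) (by
            intro p q hpq
            have hp := hsegmem hpq
            have hq := hsegmem (Or.symm hpq)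
            rw [hh' ⟨p, hp⟩, hh' ⟨q, hq⟩]
            exact hs ⟨p, hp⟩ ⟨q, hq⟩ hpq) b (oppositeEnd q.1) hIb
            (hI₁ j b q.1 hIb hb).2 (Or.inl ⟨j, by rw [oppositeEnd_oppositeEnd]; exact hb⟩)
        rw [oppositeEnd_oppositeEnd, ← hinn₂ j b q hb hIb, hh', hh'] at key
        exact key)
    (fun p => z₀ p.1)
    (by
      intro j p q hpq
      have hq := List.mem_filter.1 hpq.mem_right
      rw [hinnT j q ((hQmem j q).1 hq.1).1 (by simpa [T] using hq.2)]
      exact (hz₁ j _ _ ((hQfnext j p q).1 hpq)).symm)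
    (by
      intro p₀ hp₀
      refine (sum_sameCycle_endRot p₀ (fun p => z₀ p.1)).trans ?_
      exact hz₂ _ (hasCrossing_erase.2 ⟨p₀.2, by simpa [T] using hp₀⟩))
  obtain ⟨h', hh'⟩ := hlift h
  refine ⟨h', ?_, ?_⟩
  · intro x hx i
    obtain ⟨hx, hxS⟩ := hasCrossing_erase.1 hx
    have := hh₁ ⟨(x, i), hx⟩ (by simpa [T] using hxS)
    rw [← hh' ⟨(x, i), hx⟩, ← hh' (L.endRot _)] at this
    exact this
  · intro j p q hpq
    have hp := mem_erase.1 hpq.mem_left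
    have hq := mem_erase.1 hpq.mem_right
    have := hh₂ j ⟨p, hasCrossing_of_mem hp.1⟩ ⟨q, hasCrossing_of_mem hq.1⟩ ((hQfnext j _ _).2 hpq)
    rw [← hh' (inn _), ← hh' ⟨p, _⟩, hinnT j ⟨q, _⟩ hq.1 hq.2] at this
    exact this

end LinkCode

/-! ### Removing one-sided and two-sided faces -/

namespace LinkCode

variable {k : ℕ}

theorem zmod_four_cases (a c : ZMod 4) : c = a ∨ c = a + 1 ∨ c = a + 2 ∨ c = a + 3 := by
  revert a c; decide

theorem fst_eq_iff_near_or_opposite {X : Type*} (p : X × ZMod 4) (x : X) (a : ZMod 4) :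
    p.1 = x ↔ (p = (x, a) ∨ p = (x, a + 1)) ∨
      (oppositeEnd p = (x, a) ∨ oppositeEnd p = (x, a + 1)) := by
  obtain ⟨y, c⟩ := p
  have : ∀ a c : ZMod 4, (c = a ∨ c = a + 1) ∨ (c + 2 = a ∨ c + 2 = a + 1) := by decide
  simp only [oppositeEnd, Prod.mk.injEq, ← and_or_left]
  exact (and_iff_left (this a c)).symm

/-- The relations between colours and cycle at a crossing that is passed straight. -/
theorem color_at_crossing {X : Type*} {z h : X × ZMod 4 → ZMod 2} {x : X}
    (hz : ∀ p : X × ZMod 4, p.1 = x → z (oppositeEnd p) = z p)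
    (hh : ∀ i, h (x, i + 1) = h (x, i) + z (x, i)) (a : ZMod 4) :
    z (x, a + 2) = z (x, a) ∧ z (x, a + 3) = z (x, a + 1) ∧ h (x, a + 1) = h (x, a) + z (x, a) ∧
    h (x, a + 2) = h (x, a) + z (x, a) + z (x, a + 1) ∧ h (x, a + 3) = h (x, a) + z (x, a + 1) := by
  have e : a + 1 + 2 = a + 3 := by ring
  have e' : a + 1 + 1 = a + 2 := by ring
  have e'' : a + 2 + 1 = a + 3 := by ring
  have h₁ := hz (x, a) rfl
  have h₂ := hz (x, a + 1) rfl
  have h₃ := hh a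
  have h₄ := hh (a + 1)
  have h₅ := hh (a + 2)
  simp only [oppositeEnd] at h₁ h₂
  rw [e] at h₂
  rw [e'] at h₄
  rw [e''] at h₅
  refine ⟨h₁, h₂, h₃, by rw [h₄, h₃], ?_⟩
  rw [h₅, h₄, h₃, h₁]
  generalize h (x, a) = u
  generalize z (x, a) = v
  generalize z (x, a + 1) = w
  revert u v w; decide

/-- The inner ends are those of the loop. The loop forces the same value of the cycle on both
strands at `x`, and then the colours at the two outer ends fit together. -/
theorem IsDiagram.erase_monogon {L : LinkCode k} (hL : L.IsDiagram) {x : Crossing} {a : ZMod 4}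
    (h : L.Seg (x, a) (x, a + 1)) : (L.erase [x]).IsDiagram := by
  have hT : L.IsTwiceMet := hL.1
  have e1 : ∀ a : ZMod 4, a + 1 + 2 = a + 3 := by decide
  have n1 : ∀ a : ZMod 4, a + 1 ≠ a ∧ a + 2 ≠ a ∧ a + 3 ≠ a ∧ a + 2 ≠ a + 1 ∧ a + 3 ≠ a + 1 := by
    decide
  refine hL.erase_of_inner [x] (fun p => p = (x, a) ∨ p = (x, a + 1)) ?_ ?_ ?_ ?_
  · intro p
    rw [List.mem_singleton]
    exact fst_eq_iff_near_or_opposite p x a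
  · rintro p (rfl | rfl) <;> simp [oppositeEnd, e1, n1]
  · rintro p (rfl | rfl)
    · exact ⟨_, Or.inr rfl, h⟩
    · exact ⟨_, Or.inl rfl, h.symm⟩
  · intro z c hz₁ hz₂ hc₁ hc₂ p q hp hq hpq
    obtain ⟨f₁, f₂, f₃, f₄, f₅⟩ := color_at_crossing (fun p hp => hz₂ p (by simp [hp]))
      (hc₁ x (by simp)) a
    have f₆ := hz₁ _ _ h
    rcases hp with rfl | rfl
    · rw [hT.seg_unique hpq h]
      simp only [oppositeEnd, e1, f₄, f₅, f₁, f₆]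
      grind
    · rw [hT.seg_unique hpq h.symm]
      simp only [oppositeEnd, e1, f₄, f₅, f₂, f₆]

/-- The inner ends are the four corners of the face. Each side lies on a strand through both
crossings, and the colours outside are compared through the colour of the face. -/
theorem IsDiagram.erase_bigon {L : LinkCode k} (hL : L.IsDiagram) {x y : Crossing} {a b : ZMod 4}
    (hxy : x ≠ y) (h₁ : L.Seg (x, a) (y, b + 1)) (h₂ : L.Seg (y, b) (x, a + 1)) :
    (L.erase [x, y]).IsDiagram := by
  have hT : L.IsTwiceMet := hL.1
  have e1 : ∀ a : ZMod 4, a + 1 + 2 = a + 3 := by decide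
  have n1 : ∀ a : ZMod 4, a + 1 ≠ a ∧ a + 2 ≠ a ∧ a + 3 ≠ a ∧ a + 2 ≠ a + 1 ∧ a + 3 ≠ a + 1 := by
    decide
  refine hL.erase_of_inner [x, y] (fun p => (p = (x, a) ∨ p = (x, a + 1)) ∨
    (p = (y, b) ∨ p = (y, b + 1))) ?_ ?_ ?_ ?_
  · intro p
    simp only [List.mem_cons, List.not_mem_nil, or_false]
    rw [fst_eq_iff_near_or_opposite p x a, fst_eq_iff_near_or_opposite p y b]
    tauto
  · rintro p ((rfl | rfl) | (rfl | rfl)) <;> simp [oppositeEnd, e1, n1, hxy, hxy.symm]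
  · rintro p ((rfl | rfl) | (rfl | rfl))
    · exact ⟨_, Or.inr (Or.inr rfl), h₁⟩
    · exact ⟨_, Or.inr (Or.inl rfl), h₂.symm⟩
    · exact ⟨_, Or.inl (Or.inr rfl), h₂⟩
    · exact ⟨_, Or.inl (Or.inl rfl), h₁.symm⟩
  · intro z c hz₁ hz₂ hc₁ hc₂ p q hp hq hpq
    obtain ⟨f₁, f₂, f₃, f₄, f₅⟩ := color_at_crossing
      (fun p hp => hz₂ p (by simp [hp])) (hc₁ x (by simp)) a
    obtain ⟨g₁, g₂, g₃, g₄, g₅⟩ := color_at_crossing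
      (fun p hp => hz₂ p (by simp [hp])) (hc₁ y (by simp)) b
    have f₆ := hz₁ _ _ h₁
    have f₇ := hz₁ _ _ h₂
    have f₈ := hc₂ _ _ h₁
    have f₉ := hc₂ _ _ h₂
    rw [g₃] at f₈
    rw [f₃] at f₉
    rcases hp with (rfl | rfl) | (rfl | rfl)
    · rw [hT.seg_unique hpq h₁]
      simp only [oppositeEnd, e1, f₄, f₁, g₅]
      grind
    · rw [hT.seg_unique hpq h₂.symm]
      simp only [oppositeEnd, e1, f₅, f₂, g₄]
      grind
    · rw [hT.seg_unique hpq h₂]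
      simp only [oppositeEnd, e1, f₅, g₁, g₄]
      grind
    · rw [hT.seg_unique hpq h₁.symm]
      simp only [oppositeEnd, e1, f₄, g₂, g₅]
      grind

/-! ### Counting faces -/

theorem mul_card_quot_le {E : Type*} [Finite E] {r : E → E → Prop} {n : ℕ}
    (h : ∀ p : E, ∃ f : Fin n → E, Function.Injective f ∧ ∀ i, Quot.mk r (f i) = Quot.mk r p) :
    n * Nat.card (Quot r) ≤ Nat.card E := by
  classical
  choose f hf hfr using h
  have : Function.Injective fun t : Fin n × Quot r => f t.2.out t.1 := by
    rintro ⟨i, c⟩ ⟨j, d⟩ hij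
    have hc : c = d := by
      have h₁ := hfr c.out i
      have h₂ := hfr d.out j
      dsimp only at hij
      rw [hij, h₂, Quot.out_eq, Quot.out_eq] at h₁
      exact h₁.symm
    subst hc
    exact congrArg (·, c) (hf _ hij)
  have := Nat.card_le_card_of_injective _ this
  rwa [Nat.card_prod, Nat.card_fin] at this

/-- A planar diagram with few crossings has a face with one or two sides. -/
theorem IsDiagram.exists_small_face {L : LinkCode k} (hL : L.IsDiagram)
    (hcard : Nat.card L.Ends < 24) (hne : Nonempty L.Ends) :
    (∃ x a, L.Seg (x, a) (x, a + 1)) ∨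
    ∃ x y a b, x ≠ y ∧ L.Seg (x, a) (y, b + 1) ∧ L.Seg (y, b) (x, a + 1) := by
  by_contra! hcon
  obtain ⟨hmono, hbi⟩ := hcon
  have hT : L.IsTwiceMet := hL.1
  obtain ⟨σ, hσ, hσσ, hσne⟩ := exists_involution (seg := fun p q : L.Ends => L.Seg p.1 q.1)
    (fun p q h => h.symm) (fun p => hT.seg_irrefl) (by
      intro p
      obtain ⟨q, hq, h⟩ := hT.exists_seg p.2
      exact ⟨⟨q, hq⟩, h, fun q' h' => Subtype.ext (hT.seg_unique h' h)⟩)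
  have hrot : (fun p q : L.Ends => q.1 = (p.1.1, p.1.2 + 1)) = fun p q => q = L.endRot p := by
    ext p q
    rw [Subtype.ext_iff]
    rfl
  have hplanar := hL.2
  have hseg : ∀ p q : L.Ends, L.Seg p.1 q.1 ↔ q = σ p := fun p q => by
    rw [← show _ = _ from congrFun (congrFun hσ p) q]
  change IsPlanarMap (E := L.Ends) _ _ at hplanar
  rw [hrot, hσ, isPlanarMap_perm] at hplanar
  set ρ := L.endRot with hρ
  have hv : 4 * Nat.card (Quot fun p q => q = ρ p) ≤ Nat.card L.Ends := by
    apply mul_card_quot_le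
    intro p
    refine ⟨fun i => ⟨(p.1.1, (i : ℕ)), p.2⟩, ?_, ?_⟩
    · intro i j hij
      have : ((i : ℕ) : ZMod 4) = (j : ℕ) := by simpa using hij
      clear hij
      revert i j
      decide
    · intro i
      rw [quot_perm_eq_iff]
      exact sameCycle_endRot.2 rfl
  have hσseg : ∀ p, L.Seg p.1 (σ p).1 := fun p => (hseg p _).2 rfl
  -- A fixed point of the face permutation is a one-sided face.
  have hφ : ∀ p, ρ (σ p) ≠ p := by
    intro p hp
    refine hmono (σ p).1.1 (σ p).1.2 ?_
    have := hσseg p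
    rw [← hp] at this
    rw [hp] at this
    have hp' : p.1 = ((σ p).1.1, (σ p).1.2 + 1) := congrArg Subtype.val hp.symm
    rw [← hp']
    exact this.symm
  have hφφ : ∀ p, ρ (σ (ρ (σ p))) ≠ p := by
    intro p hp
    have h₁ := hσseg p
    have h₂ := hσseg (ρ (σ p))
    have hp' : p.1 = ((σ (ρ (σ p))).1.1, (σ (ρ (σ p))).1.2 + 1) := congrArg Subtype.val hp.symm
    have hq' : (ρ (σ p)).1 = ((σ p).1.1, (σ p).1.2 + 1) := rfl
    rw [hp'] at h₁
    rw [hq'] at h₂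
    generalize (σ (ρ (σ p))).1 = q at h₁ h₂
    generalize (σ p).1 = r at h₁ h₂
    obtain ⟨x, a⟩ := q
    obtain ⟨y, b⟩ := r
    -- If both corners lie at one crossing, one of the two segments either bounds a one-sided face
    -- or joins an end to itself.
    by_cases hxy : x = y
    · subst hxy
      dsimp only at h₁ h₂
      rcases zmod_four_cases a b with rfl | rfl | rfl | rfl
      · exact hmono x b h₁.symm
      · exact hT.seg_irrefl h₁
      · refine hmono x (a + 1) ?_
        rwa [show a + 1 + 1 = a + 2 by ring]
      · rw [show ∀ a : ZMod 4, a + 3 + 1 = a by decide] at h₂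
        exact hT.seg_irrefl h₂
    · exact hbi x y a b hxy h₂.symm h₁.symm
  have hf : 3 * Nat.card (Quot fun p q => q = ρ (σ p)) ≤ Nat.card L.Ends := by
    apply mul_card_quot_le
    intro p
    refine ⟨![p, ρ (σ p), ρ (σ (ρ (σ p)))], ?_, ?_⟩
    · intro i j hij
      fin_cases i <;> fin_cases j
      all_goals first
        | rfl
        | exact absurd hij (hφ p).symm
        | exact absurd hij (hφ p)
        | exact absurd hij (hφφ p).symm
        | exact absurd hij (hφφ p)
        | exact absurd hij (hφ (ρ (σ p))).symm
        | exact absurd hij (hφ (ρ (σ p)))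
    · have h₁ : ∀ p, Quot.mk (fun p q => q = ρ (σ p)) (ρ (σ p)) = Quot.mk _ p :=
        fun p => (Quot.sound rfl : Quot.mk (fun p q => q = ρ (σ p)) p = Quot.mk _ (ρ (σ p))).symm
      intro i
      fin_cases i
      · rfl
      · exact h₁ p
      · exact (h₁ _).trans (h₁ p)
  have he : Nat.card L.Ends ≤ Nat.card (Quot fun p q => q = σ p) * 2 := by
    classical
    have hinj : Function.Injective fun p : L.Ends =>
        (Quot.mk (fun p q => q = σ p) p,
          decide (p = (Quot.mk (fun p q => q = σ p) p).out)) := by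
      intro p q hpq
      obtain ⟨h₁, h₂⟩ := Prod.mk.injEq _ _ _ _ ▸ hpq
      rcases (quot_involution_eq_iff σ hσσ p q).1 h₁ with h | h
      · exact h.symm
      · exfalso
        have hne := hσne p
        rw [← h] at hne
        rw [decide_eq_decide, ← h₁] at h₂
        rcases (quot_involution_eq_iff σ hσσ p _).1
          (Quot.out_eq (Quot.mk (fun p q => q = σ p) p)).symm with h₃ | h₃
        · rw [h₃] at h₂
          exact hne (h₂.1 rfl)
        · rw [h₃, ← h] at h₂
          exact hne (h₂.2 rfl).symm
    have := Nat.card_le_card_of_injective _ hinj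
    rwa [Nat.card_prod, Nat.card_eq_fintype_card (α := Bool), Fintype.card_bool] at this
  have hc : 1 ≤ Nat.card (Quot fun p q => q = ρ p ∨ q = σ p) := by
    have : Nonempty (Quot fun p q => q = ρ p ∨ q = σ p) := hne.map (Quot.mk _)
    exact Nat.one_le_iff_ne_zero.2 (Nat.card_ne_zero.2 ⟨this, inferInstance⟩)
  -- With `N` ends, Euler's formula and the four bounds give `N/4 + N/3 ≥ N/2 + 2`, hence `N ≥ 24`.
  omega

theorem card_ends_erase_lt {L : LinkCode k} {S : List Crossing} {x : Crossing}
    (hx : L.HasCrossing x) (hxS : x ∈ S) : Nat.card (L.erase S).Ends < Nat.card L.Ends := by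
  show Nat.card ↥{p : Crossing × ZMod 4 | (L.erase S).HasCrossing p.1} <
    Nat.card ↥{p : Crossing × ZMod 4 | L.HasCrossing p.1}
  rw [Nat.card_coe_set_eq, Nat.card_coe_set_eq]
  have hfin : {p : Crossing × ZMod 4 | L.HasCrossing p.1}.Finite :=
    Set.finite_coe_iff.1 (finite_ends L)
  refine Set.ncard_lt_ncard ⟨fun p hp => (hasCrossing_erase.1 hp).1, fun h => ?_⟩ hfin
  exact (hasCrossing_erase.1 (h (a := (x, 0)) hx)).2 hxS

theorem Seg.hasCrossing {L : LinkCode k} {p q : Crossing × ZMod 4} (h : L.Seg p q) :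
    L.HasCrossing p.1 := by
  rcases h with ⟨j, h⟩ | ⟨j, h⟩
  · exact hasCrossing_of_mem (CycNext.mem_left h)
  · exact hasCrossing_of_mem (p := oppositeEnd p) (CycNext.mem_right h)

/-- A diagram with at most five crossings, all virtual, is trivial. -/
theorem IsDiagram.isTrivial_of_virtual {L : LinkCode k} (hL : L.IsDiagram)
    (hvirt : ∀ x, L.HasCrossing x → x.virt = true) (hcard : Nat.card L.Ends < 24) :
    L.IsTrivial := by
  induction hn : Nat.card L.Ends using Nat.strong_induction_on generalizing L with
  | _ n ih =>
    have step : ∀ (S : List Crossing) (x : Crossing), x ∈ S → L.HasCrossing x →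
        (L.erase S).IsDiagram → Move L (L.erase S) → L.IsTrivial := by
      intro S x hxS hx hD hM
      have hlt := card_ends_erase_lt hx hxS
      refine .trans _ _ _ (.rel _ _ ⟨hL, hD, hM⟩) (ih _ (hn ▸ hlt) hD ?_ (by omega) rfl)
      exact fun y hy => hvirt y (hasCrossing_erase.1 hy).1
    rcases isEmpty_or_nonempty L.Ends with hE | hE
    · have : L = fun _ => [] := by
        funext j
        refine List.eq_nil_iff_forall_not_mem.2 fun p hp => ?_
        exact hE.false ⟨p, hasCrossing_of_mem hp⟩
      rw [this]
      exact .refl _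
    -- For virtual crossings the moves I* and II* carry no condition on over- and under-strands, so
    -- any such face can be removed.
    · rcases hL.exists_small_face (by omega) hE with ⟨x, a, h⟩ | ⟨x, y, a, b, hxy, h₁, h₂⟩
      · exact step [x] x (by simp) h.hasCrossing (hL.erase_monogon h) (.one L x a h)
      · refine step [x, y] x (by simp) h₁.hasCrossing (hL.erase_bigon hxy h₁ h₂)
          (.two L x y a b hxy h₁ h₂ (Or.inl ⟨hvirt x h₁.hasCrossing, hvirt y h₂.hasCrossing⟩))

end LinkCode

/-! ### The mod 2 linking numbers of a virtual link -/

namespace LinkCode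

variable {k : ℕ}

/-- The strand through the end `p` belongs to the component `j`. -/
def Strand (L : LinkCode k) (j : Fin k) (p : Crossing × ZMod 4) : Prop :=
  p ∈ L j ∨ oppositeEnd p ∈ L j

/-- The classical crossings at which the component `i` passes over the component `j`. -/
def overCrossings (L : LinkCode k) (i j : Fin k) : Set Crossing :=
  {x | x.virt = false ∧ L.Strand i (x, 0) ∧ L.Strand j (x, 1)}

/-- The mod 2 linking number of the component `i` over the component `j`. -/
noncomputable def overLinking (L : LinkCode k) (i j : Fin k) : ZMod 2 :=
  ((L.overCrossings i j).ncard : ZMod 2)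

theorem strand_oppositeEnd {L : LinkCode k} {j : Fin k} {p : Crossing × ZMod 4} :
    L.Strand j (oppositeEnd p) ↔ L.Strand j p := by
  unfold Strand
  rw [oppositeEnd_oppositeEnd, or_comm]

theorem strand_of_isOverEnd {L : LinkCode k} {j : Fin k} {x : Crossing} {c : ZMod 4}
    (hc : IsOverEnd c) : L.Strand j (x, c) ↔ L.Strand j (x, 0) := by
  rcases hc with rfl | rfl
  · rfl
  · exact strand_oppositeEnd (p := (x, 0))

theorem strand_of_not_isOverEnd {L : LinkCode k} {j : Fin k} {x : Crossing} {c : ZMod 4}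
    (hc : ¬ IsOverEnd c) : L.Strand j (x, c) ↔ L.Strand j (x, 1) := by
  have : ∀ c : ZMod 4, ¬ (c = 0 ∨ c = 2) → c = 1 ∨ c = 3 := by decide
  rcases this c hc with rfl | rfl
  · rfl
  · exact strand_oppositeEnd (p := (x, 1))

theorem isOverEnd_add_one (c : ZMod 4) : IsOverEnd (c + 1) ↔ ¬ IsOverEnd c := by
  unfold IsOverEnd
  revert c
  decide

theorem isOverEnd_add (c r : ZMod 4) (hr : IsOverEnd r) : IsOverEnd (c + r) ↔ IsOverEnd c := by
  unfold IsOverEnd at *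
  revert c r
  decide

theorem Strand.hasCrossing {L : LinkCode k} {j : Fin k} {p : Crossing × ZMod 4}
    (h : L.Strand j p) : L.HasCrossing p.1 := by
  rcases h with h | h
  · exact hasCrossing_of_mem h
  · exact hasCrossing_of_mem (p := oppositeEnd p) h

theorem finite_overCrossings (L : LinkCode k) (i j : Fin k) : (L.overCrossings i j).Finite :=
  L.finite_hasCrossing.subset fun _ hx => hx.2.1.hasCrossing

theorem IsTwiceMet.strand_unique {L : LinkCode k} (hL : L.IsTwiceMet) {i j : Fin k}
    {p : Crossing × ZMod 4} (hi : L.Strand i p) (hj : L.Strand j p) : i = j := by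
  rcases hi with hi | hi <;> rcases hj with hj | hj
  · exact hL.eq_of_mem hi hj
  · exact absurd (mem_passages.2 ⟨j, hj⟩) (hL.not_mem_opposite (mem_passages.2 ⟨i, hi⟩))
  · exact absurd (mem_passages.2 ⟨i, hi⟩) (hL.not_mem_opposite (mem_passages.2 ⟨j, hj⟩))
  · exact hL.eq_of_mem hi hj

theorem IsTwiceMet.mem_iff_of_seg {L : LinkCode k} (hL : L.IsTwiceMet) {p q : Crossing × ZMod 4}
    (h : L.Seg p q) (j : Fin k) : p ∈ L j ↔ oppositeEnd q ∈ L j := by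
  rcases h with ⟨i, h⟩ | ⟨i, h⟩
  · have h₁ := CycNext.mem_left h
    have h₂ := CycNext.mem_right h
    exact ⟨fun hp => hL.eq_of_mem h₁ hp ▸ h₂, fun hq => hL.eq_of_mem h₂ hq ▸ h₁⟩
  · have h₁ := hL.not_mem_opposite (mem_passages.2 ⟨i, CycNext.mem_left h⟩)
    have h₂ := hL.not_mem_opposite (mem_passages.2 ⟨i, CycNext.mem_right h⟩)
    rw [oppositeEnd_oppositeEnd] at h₂
    exact ⟨fun hp => absurd (mem_passages.2 ⟨j, hp⟩) h₂,
      fun hq => absurd (mem_passages.2 ⟨j, hq⟩) h₁⟩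

theorem IsTwiceMet.strand_iff_of_seg {L : LinkCode k} (hL : L.IsTwiceMet)
    {p q : Crossing × ZMod 4} (h : L.Seg p q) (j : Fin k) : L.Strand j p ↔ L.Strand j q := by
  unfold Strand
  rw [hL.mem_iff_of_seg h j, hL.mem_iff_of_seg (Or.symm h) j, or_comm]

theorem strand_erase {L : LinkCode k} {S : List Crossing} {j : Fin k} {p : Crossing × ZMod 4} :
    (L.erase S).Strand j p ↔ L.Strand j p ∧ p.1 ∉ S := by
  unfold Strand
  rw [mem_erase, mem_erase, oppositeEnd_fst, or_and_right]

theorem overCrossings_erase {L : LinkCode k} {S : List Crossing} {i j : Fin k} :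
    (L.erase S).overCrossings i j = L.overCrossings i j \ {x | x ∈ S} := by
  ext x
  simp only [overCrossings, Set.mem_ofPred_eq, strand_erase, Set.mem_sdiff]
  tauto

theorem overCrossings_congr {L L' : LinkCode k} (h : ∀ j p, p ∈ L j ↔ p ∈ L' j) (i j : Fin k) :
    L.overCrossings i j = L'.overCrossings i j := by
  simp only [overCrossings, Strand, h]

theorem mem_map_swap_iff {l : List (Crossing × ZMod 4)} {σ : Equiv.Perm (Crossing × ZMod 4)}
    (h : ∀ p, σ p ∈ l ↔ p ∈ l) (p : Crossing × ZMod 4) : p ∈ l.map σ ↔ p ∈ l := by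
  rw [List.mem_map]
  constructor
  · rintro ⟨q, hq, rfl⟩
    exact (h q).2 hq
  · intro hp
    refine ⟨σ.symm p, ?_, σ.apply_symm_apply p⟩
    rw [← h, σ.apply_symm_apply]
    exact hp

theorem swap_mem_iff {l : List (Crossing × ZMod 4)} {u v : Crossing × ZMod 4}
    (h : u ∈ l ↔ v ∈ l) (p : Crossing × ZMod 4) : Equiv.swap u v p ∈ l ↔ p ∈ l := by
  by_cases hu : p = u
  · subst hu; rw [Equiv.swap_apply_left]; exact h.symm
  · by_cases hv : p = v
    · subst hv; rw [Equiv.swap_apply_right]; exact h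
    · rw [Equiv.swap_apply_of_ne_of_ne hu hv]

/-- The two passages exchanged by each transposition run in the same direction along one side of the
triangle, so a component contains both or neither. A third move only reorders the passages of each
component. -/
theorem IsTwiceMet.triangleSwap_mem_iff {L : LinkCode k} (hL : L.IsTwiceMet) {x y z : Crossing}
    {a b c : ZMod 4} (h₁ : L.Seg (x, a) (y, b + 1)) (h₂ : L.Seg (y, b) (z, c + 1))
    (h₃ : L.Seg (z, c) (x, a + 1)) (j : Fin k) (p : Crossing × ZMod 4) :
    triangleSwap x a y b z c p ∈ L j ↔ p ∈ L j := by
  have key : ∀ {x y : Crossing} {a b : ZMod 4}, L.Seg (x, a) (y, b + 1) →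
      ((x, a) ∈ L j ↔ (y, b + 3) ∈ L j) ∧ ((x, a + 2) ∈ L j ↔ (y, b + 1) ∈ L j) := by
    intro x y a b h
    have e : b + 1 + 2 = b + 3 := by ring
    have h₁ := hL.mem_iff_of_seg h j
    have h₂ := hL.mem_iff_of_seg (Or.symm h) j
    simp only [oppositeEnd, e] at h₁ h₂
    exact ⟨h₁, h₂.symm⟩
  unfold triangleSwap
  simp only [Equiv.Perm.mul_apply]
  rw [swap_mem_iff (key h₁).1, swap_mem_iff (key h₁).2, swap_mem_iff (key h₂).1,
    swap_mem_iff (key h₂).2, swap_mem_iff (key h₃).1, swap_mem_iff (key h₃).2]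

/-- The linking numbers are invariant under the Reidemeister moves. -/
theorem overLinking_eq_of_move {A B : LinkCode k} (hA : A.IsDiagram) (h : Move A B)
    {i j : Fin k} (hij : i ≠ j) : A.overLinking i j = B.overLinking i j := by
  have hT : A.IsTwiceMet := hA.1
  unfold overLinking
  cases h with
  | rotate _ h =>
    rw [overCrossings_congr fun j p => (h j).mem_iff]
  | relabel π r hπ hr =>
    let f : Crossing × ZMod 4 → Crossing × ZMod 4 := fun p => (π p.1, p.2 + r p.1)
    have hf : Function.Injective f := by
      rintro ⟨x, a⟩ ⟨y, b⟩ h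
      simp only [f, Prod.mk.injEq] at h
      obtain rfl := π.injective h.1
      rw [add_right_cancel h.2]
    have hopp : ∀ p, oppositeEnd (f p) = f (oppositeEnd p) := by
      rintro ⟨x, a⟩
      simp only [f, oppositeEnd, Prod.mk.injEq, true_and]
      ring
    have hstrand : ∀ (j : Fin k) p, Strand (fun j => (A j).map f) j (f p) ↔ A.Strand j p := by
      intro j p
      unfold Strand
      rw [hopp, List.mem_map_of_injective hf, List.mem_map_of_injective hf]
    have : overCrossings (fun j => (A j).map f) i j = π '' A.overCrossings i j := by
      ext y
      obtain ⟨x, rfl⟩ := π.surjective y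
      rw [π.injective.mem_set_image]
      simp only [overCrossings, Set.mem_ofPred_eq, hπ]
      refine and_congr_right fun hx => ?_
      have h₀ : IsOverEnd (0 + r x) := (isOverEnd_add 0 _ (hr x hx)).2 (Or.inl rfl)
      have h₁ : ¬ IsOverEnd (1 + r x) := by
        rw [isOverEnd_add 1 _ (hr x hx)]
        unfold IsOverEnd
        decide
      rw [← strand_of_isOverEnd h₀, ← strand_of_not_isOverEnd h₁]
      exact and_congr (hstrand i (x, 0)) (hstrand j (x, 1))
    rw [this, Set.ncard_image_of_injective _ π.injective]
  | one x a h =>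
    -- The loop joins the two strands at `x`, so `x` is a crossing of a component with itself.
    have hx : x ∉ A.overCrossings i j := by
      rintro ⟨-, h₀, h₁⟩
      apply hij
      have hs := hT.strand_iff_of_seg h
      by_cases ha : IsOverEnd a
      · have ha' : ¬ IsOverEnd (a + 1) := by rwa [isOverEnd_add_one, not_not]
        simp only [strand_of_isOverEnd ha, strand_of_not_isOverEnd ha'] at hs
        exact hT.strand_unique ((hs i).1 h₀) h₁
      · have ha' : IsOverEnd (a + 1) := by rwa [isOverEnd_add_one]
        simp only [strand_of_isOverEnd ha', strand_of_not_isOverEnd ha] at hs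
        exact hT.strand_unique ((hs i).2 h₀) h₁
    rw [overCrossings_erase]
    congr 2
    ext y
    simp only [List.mem_singleton, Set.mem_sdiff, Set.mem_ofPred_eq]
    refine ⟨fun hy => ⟨hy, ?_⟩, And.left⟩
    rintro rfl
    exact hx hy
  | two x y a b hxy h₁ h₂ hkind =>
    -- The same two strands meet at `x` and at `y`, with the same one on top.
    have key : x ∈ A.overCrossings i j ↔ y ∈ A.overCrossings i j := by
      unfold overCrossings
      rcases hkind with ⟨hx, hy⟩ | ⟨hx, hy, hab⟩
      · simp [hx, hy]
      · have hs₁ := hT.strand_iff_of_seg h₁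
        have hs₂ := hT.strand_iff_of_seg h₂
        simp only [Set.mem_ofPred_eq, hx, hy, true_and]
        by_cases ha : IsOverEnd a
        · have ha' : ¬ IsOverEnd (a + 1) := by rwa [isOverEnd_add_one, not_not]
          have hb := hab.1 ha
          have hb' : ¬ IsOverEnd b := (isOverEnd_add_one b).1 hb
          rw [← strand_of_isOverEnd ha, ← strand_of_not_isOverEnd ha', ← strand_of_isOverEnd hb,
            ← strand_of_not_isOverEnd hb', hs₁, hs₂]
        · have ha' : IsOverEnd (a + 1) := by rwa [isOverEnd_add_one]
          have hb := fun h => ha (hab.2 h)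
          have hb' : IsOverEnd b := by
            by_contra h
            exact hb ((isOverEnd_add_one b).2 h)
          rw [← strand_of_isOverEnd ha', ← strand_of_not_isOverEnd ha, ← strand_of_isOverEnd hb',
            ← strand_of_not_isOverEnd hb, hs₁, hs₂]
    rw [overCrossings_erase]
    have hset : {z | z ∈ [x, y]} = ({x, y} : Set Crossing) := by
      ext z; simp
    rw [hset]
    by_cases hx : x ∈ A.overCrossings i j
    · have hsub : ({x, y} : Set Crossing) ⊆ A.overCrossings i j := by
        rintro z (rfl | rfl)
        · exact hx
        · exact key.1 hx
      have := Set.ncard_sdiff_add_ncard_of_subset hsub (A.finite_overCrossings i j)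
      rw [Set.ncard_pair hxy] at this
      rw [← this, Nat.cast_add]
      -- The two crossings removed contribute `2 = 0` mod 2.
      exact add_zero _
    · rw [sdiff_eq_left.2]
      rw [Set.disjoint_right]
      rintro z (rfl | rfl)
      · exact hx
      · exact fun h => hx (key.2 h)
  | three x y z a b c hxy hyz hxz h₁ h₂ h₃ hkind =>
    rw [overCrossings_congr fun j p =>
      (mem_map_swap_iff (hT.triangleSwap_mem_iff h₁ h₂ h₃ j) p).symm]

theorem Equivalent.overLinking_eq {L L' : LinkCode k} (h : L.Equivalent L') {i j : Fin k}
    (hij : i ≠ j) : L.overLinking i j = L'.overLinking i j := by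
  induction h with
  | rel A B h => exact overLinking_eq_of_move h.1 h.2.2 hij
  | refl => rfl
  | symm _ _ _ ih => exact ih.symm
  | trans _ _ _ _ _ ih₁ ih₂ => exact ih₁.trans ih₂

/-- With two components, splitting separates one from the other, so the equivalent diagram has no
crossing between them to count. -/
theorem IsSplit.overLinking_eq_zero {L : LinkCode 2} (h : L.IsSplit) {i j : Fin 2}
    (hij : i ≠ j) : L.overLinking i j = 0 := by
  obtain ⟨L', hLL', -, S, ⟨s, hs⟩, ⟨t, ht⟩, hS⟩ := h
  rw [hLL'.overLinking_eq hij]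
  have hst : s ≠ t := fun h => ht (h ▸ hs)
  have hdisj : ∀ p ∈ L' i, ∀ q ∈ L' j, p.1 ≠ q.1 := by
    have : (i = s ∧ j = t) ∨ (i = t ∧ j = s) := by
      clear hs ht hS
      revert i j s t
      decide
    rcases this with ⟨rfl, rfl⟩ | ⟨rfl, rfl⟩
    · exact hS _ hs _ ht
    · exact fun p hp q hq => (hS _ hs _ ht q hq p hp).symm
  have : L'.overCrossings i j = ∅ := by
    refine Set.eq_empty_iff_forall_notMem.2 ?_
    rintro x ⟨-, h₀, h₁⟩
    rcases h₀ with h₀ | h₀ <;> rcases h₁ with h₁ | h₁ <;> exact hdisj _ h₀ _ h₁ rfl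
  rw [overLinking, this, Set.ncard_empty, Nat.cast_zero]

theorem isDiagram_nil : IsDiagram (fun _ : Fin k => []) := by
  refine isDiagram_iff.2 ⟨fun x hx => ?_, fun z _ _ => ⟨0, fun x hx => ?_, fun j p q h => ?_⟩⟩
  · obtain ⟨p, hp, -⟩ := hx
    obtain ⟨j, hj⟩ := mem_passages.1 hp
    simp at hj
  · obtain ⟨p, hp, -⟩ := hx
    obtain ⟨j, hj⟩ := mem_passages.1 hp
    simp at hj
  · exact absurd h.mem_left (List.not_mem_nil)

theorem IsTrivial.isSplit {L : LinkCode k} (h : L.IsTrivial) (hk : 2 ≤ k) : L.IsSplit := by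
  refine ⟨_, h, isDiagram_nil, {⟨0, by omega⟩}, ⟨_, rfl⟩, ⟨⟨1, by omega⟩, ?_⟩, ?_⟩
  · simp
  · intro i _ j _ p hp
    simp at hp

end LinkCode

/-- Trivial links with at least two components are split. Proving absence of links by triviality and
presence by nonsplitness therefore settles both notions at once. -/
theorem LinkNotion.not_holds_of_isTrivial (κ : LinkNotion) {k : ℕ} (hk : 2 ≤ k) {L : LinkCode k}
    (h : L.IsTrivial) : ¬ κ.Holds L := by
  cases κ
  · exact not_not.2 h
  · exact not_not.2 (h.isSplit hk)

theorem LinkNotion.holds_of_not_isSplit (κ : LinkNotion) {k : ℕ} (hk : 2 ≤ k) {L : LinkCode k}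
    (h : ¬ L.IsSplit) : κ.Holds L := by
  cases κ
  · exact fun h' => h (h'.isSplit hk)
  · exact h

/-! ### Segments and colourings of a virtual graph diagram -/

/-- The passages of the edges of a graph through crossings. -/
structure EdgeWords {V : Type*} (G : SimpleGraph V) (m : ℕ) where
  word : G.Dart → List (Fin m × ZMod 4)
  word_symm : ∀ d : G.Dart, word d.symm = (word d).reverse.map oppositeEnd
  word_unique : ∀ p : Fin m × ZMod 4, ∃! t : G.Dart × ℕ, (word t.1)[t.2]? = some p

namespace EdgeWords

variable {V : Type*} {G : SimpleGraph V} {m : ℕ} (D : EdgeWords G m)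

/-- The ends of the segments. -/
abbrev End (_ : EdgeWords G m) : Type _ := G.Dart ⊕ (Fin m × ZMod 4)

/-- The ends at which the segments of an edge begin. -/
def outEnds (d : G.Dart) : List D.End := Sum.inl d :: (D.word d).map Sum.inr

/-- The ends at which the segments of an edge arrive. -/
def inEnds (d : G.Dart) : List D.End :=
  (D.word d).map (fun a => Sum.inr (oppositeEnd a)) ++ [Sum.inl d.symm]

/-- The two ends of a segment. -/
def Seg (p q : D.End) : Prop := ∃ d : G.Dart, (p, q) ∈ (D.outEnds d).zip (D.inEnds d)

theorem length_outEnds (d : G.Dart) : (D.outEnds d).length = (D.word d).length + 1 := by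
  simp [outEnds]

theorem length_inEnds (d : G.Dart) : (D.inEnds d).length = (D.word d).length + 1 := by
  simp [inEnds]

theorem outEnds_symm (d : G.Dart) : D.outEnds d.symm = (D.inEnds d).reverse := by
  simp [outEnds, inEnds, D.word_symm, Function.comp_def]

theorem inEnds_symm (d : G.Dart) : D.inEnds d.symm = (D.outEnds d).reverse := by
  have := D.outEnds_symm d.symm
  rw [SimpleGraph.Dart.symm_symm] at this
  rw [this, List.reverse_reverse]

theorem seg_symm {p q : D.End} (h : D.Seg p q) : D.Seg q p := by
  obtain ⟨d, h⟩ := h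
  refine ⟨d.symm, ?_⟩
  rw [D.outEnds_symm, D.inEnds_symm, List.zip, ← List.reverse_zipWith (by
    rw [D.length_outEnds, D.length_inEnds]), List.mem_reverse, ← List.zip, ← List.zip_swap,
    List.mem_map]
  exact ⟨_, h, rfl⟩

/-- The edge, directed along the passage `p`. -/
noncomputable def dartAt (p : Fin m × ZMod 4) : G.Dart := (D.word_unique p).choose.1

theorem mem_word_iff {p : Fin m × ZMod 4} {d : G.Dart} : p ∈ D.word d ↔ D.dartAt p = d := by
  have h := (D.word_unique p).choose_spec
  constructor
  · intro hp
    obtain ⟨i, hi⟩ := List.mem_iff_getElem?.1 hp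
    exact (congrArg Prod.fst (h.2 (d, i) hi)).symm
  · rintro rfl
    exact List.mem_iff_getElem?.2 ⟨_, h.1⟩

theorem mem_word_dartAt (p : Fin m × ZMod 4) : p ∈ D.word (D.dartAt p) := D.mem_word_iff.2 rfl

theorem nodup_word (d : G.Dart) : (D.word d).Nodup := by
  rw [List.nodup_iff_getElem?_ne_getElem?]
  intro i j hij hj h
  rw [List.getElem?_eq_getElem hj] at h
  have := (D.word_unique (D.word d)[j]).unique (y₁ := (d, i)) (y₂ := (d, j)) h
    (List.getElem?_eq_getElem hj)
  rw [Prod.mk.injEq] at this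
  omega

theorem dartAt_oppositeEnd (p : Fin m × ZMod 4) :
    D.dartAt (oppositeEnd p) = (D.dartAt p).symm := by
  rw [← D.mem_word_iff, D.word_symm, List.mem_map]
  exact ⟨p, List.mem_reverse.2 (D.mem_word_dartAt p), rfl⟩

theorem mem_outEnds {p : D.End} {d : G.Dart} :
    p ∈ D.outEnds d ↔ Sum.elim id D.dartAt p = d := by
  rcases p with e | p
  · simp [outEnds]
  · simp [outEnds, D.mem_word_iff]

theorem nodup_outEnds (d : G.Dart) : (D.outEnds d).Nodup := by
  unfold outEnds
  rw [List.nodup_cons]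
  exact ⟨by simp, (D.nodup_word d).map Sum.inr_injective⟩

theorem mem_inEnds {p : D.End} {d : G.Dart} :
    p ∈ D.inEnds d ↔ Sum.elim id D.dartAt p = d.symm := by
  rw [← D.mem_outEnds, D.outEnds_symm, List.mem_reverse]

theorem exists_seg (p : D.End) : ∃ q, D.Seg p q := by
  obtain ⟨i, hi, hp⟩ := List.mem_iff_getElem.1 (D.mem_outEnds.2 (rfl : _ = Sum.elim id D.dartAt p))
  refine ⟨(D.inEnds (Sum.elim id D.dartAt p))[i]'(by
    rwa [D.length_inEnds, ← D.length_outEnds]), Sum.elim id D.dartAt p, ?_⟩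
  rw [List.mem_iff_getElem]
  refine ⟨i, by rw [List.length_zip, D.length_inEnds, ← D.length_outEnds, min_self]; exact hi, ?_⟩
  rw [List.getElem_zip, hp]

theorem seg_unique {p q q' : D.End} (h : D.Seg p q) (h' : D.Seg p q') : q = q' := by
  obtain ⟨d, h⟩ := h
  obtain ⟨d', h'⟩ := h'
  obtain rfl := (D.mem_outEnds.1 (List.of_mem_zip h).1).symm.trans
    (D.mem_outEnds.1 (List.of_mem_zip h').1)
  obtain ⟨i, hi, h⟩ := List.mem_iff_getElem.1 h
  obtain ⟨j, hj, h'⟩ := List.mem_iff_getElem.1 h'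
  rw [List.getElem_zip, Prod.mk.injEq] at h h'
  obtain rfl := (D.nodup_outEnds d).getElem_inj_iff.1 (h.1.trans h'.1.symm)
  exact h.2.symm.trans h'.2

theorem dartOf_seg {p q : D.End} (h : D.Seg p q) :
    Sum.elim id D.dartAt q = (Sum.elim id D.dartAt p).symm := by
  obtain ⟨d, h⟩ := h
  rw [D.mem_inEnds.1 (List.of_mem_zip h).2, D.mem_outEnds.1 (List.of_mem_zip h).1]

theorem seg_irrefl (p : D.End) : ¬ D.Seg p p := fun h =>
  SimpleGraph.Dart.symm_ne _ (D.dartOf_seg h).symm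

theorem existsUnique_seg (p : D.End) : ∃! q, D.Seg p q := by
  obtain ⟨q, h⟩ := D.exists_seg p
  exact ⟨q, h, fun _ h' => D.seg_unique h' h⟩

end EdgeWords

/-! ### Rotation of the ends at vertices and crossings -/

section MapRot

variable {V : Type*} {G : SimpleGraph V} {m : ℕ} {τ : Equiv.Perm G.Dart}

/-- The rotation of the ends at vertices and crossings. -/
def mapRot (m : ℕ) (τ : Equiv.Perm G.Dart) : Equiv.Perm (G.Dart ⊕ (Fin m × ZMod 4)) :=
  Equiv.sumCongr τ ((Equiv.refl _).prodCongr (Equiv.addRight 1))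

theorem mapRot_inr (p : Fin m × ZMod 4) :
    mapRot m τ (Sum.inr p) = Sum.inr (p.1, p.2 + 1) := rfl

theorem mapRot_eq_iff (p q : G.Dart ⊕ (Fin m × ZMod 4)) : q = mapRot m τ p ↔
    q = Sum.map τ (fun a : Fin m × ZMod 4 => (a.1, a.2 + 1)) p := by
  rcases p with p | p <;> rfl

variable (hτ : ∀ d e : G.Dart, τ.SameCycle d e ↔ d.fst = e.fst)

include hτ

theorem sameCycle_mapRot_inl {d : G.Dart} {q : G.Dart ⊕ (Fin m × ZMod 4)} :
    (mapRot m τ).SameCycle (Sum.inl d) q ↔ ∃ e : G.Dart, q = Sum.inl e ∧ e.fst = d.fst := by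
  have key : ∀ n : ℤ, (mapRot m τ ^ n) (Sum.inl d) = Sum.inl ((τ ^ n) d) := by
    intro n
    have : ∀ n : ℕ, ∀ d, (mapRot m τ ^ n) (Sum.inl d) = Sum.inl ((τ ^ n) d) := by
      intro n
      induction n with
      | zero => intro d; rfl
      | succ n ih => intro d; rw [pow_succ', Equiv.Perm.mul_apply, ih, pow_succ']; rfl
    cases n with
    | ofNat n => exact this n d
    | negSucc n =>
      rw [zpow_negSucc, zpow_negSucc, Equiv.Perm.inv_eq_iff_eq, this,
        Equiv.Perm.inv_def, Equiv.apply_symm_apply]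
  constructor
  · rintro ⟨n, rfl⟩
    exact ⟨_, key n, ((hτ _ _).1 ⟨n, rfl⟩).symm⟩
  · rintro ⟨e, rfl, he⟩
    obtain ⟨n, rfl⟩ := (hτ d e).2 he.symm
    exact ⟨n, key n⟩

theorem sameCycle_mapRot_inr {p : Fin m × ZMod 4} {q : G.Dart ⊕ (Fin m × ZMod 4)} :
    (mapRot m τ).SameCycle (Sum.inr p) q ↔ ∃ i, q = Sum.inr (p.1, i) := by
  have key : ∀ n : ℕ, (mapRot m τ ^ n) (Sum.inr p) = Sum.inr (p.1, p.2 + n) := by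
    intro n
    induction n with
    | zero => simp
    | succ n ih =>
      rw [pow_succ', Equiv.Perm.mul_apply, ih, mapRot_inr]
      push_cast
      rw [add_assoc]
  constructor
  · intro h
    rcases q with d | q
    · obtain ⟨e, he, -⟩ := (sameCycle_mapRot_inl hτ).1 h.symm
      cases he
    · have := eq_of_sameCycle (ρ := mapRot m τ) (S := Sum.elim (fun _ => p.1) Prod.fst)
        (by rintro (_ | _) <;> rfl) h
      exact ⟨q.2, by rw [← show q.1 = p.1 from this]⟩
  · rintro ⟨i, rfl⟩
    refine ⟨((i - p.2).val : ℕ), ?_⟩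
    rw [zpow_natCast, key, ZMod.natCast_zmod_val, add_sub_cancel]

theorem sum_sameCycle_mapRot_inl [Fintype G.Dart] [DecidableEq V] (d : G.Dart)
    {_ : DecidablePred fun q => (mapRot m τ).SameCycle q (Sum.inl d)}
      (f : G.Dart ⊕ (Fin m × ZMod 4) → ZMod 2) :
    ∑ q with (mapRot m τ).SameCycle q (Sum.inl d), f q =
      ∑ e : G.Dart with e.fst = d.fst, f (Sum.inl e) := by
  symm
  refine Finset.sum_bij (fun e _ => Sum.inl e) ?_ ?_ ?_ ?_
  · intro e he
    simp only [Finset.mem_filter, Finset.mem_univ, true_and] at he ⊢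
    exact Equiv.Perm.SameCycle.symm ((sameCycle_mapRot_inl hτ).2 ⟨e, rfl, he⟩)
  · intro a _ b _ h
    exact Sum.inl_injective h
  · intro q hq
    simp only [Finset.mem_filter, Finset.mem_univ, true_and] at hq
    obtain ⟨e, rfl, he⟩ := (sameCycle_mapRot_inl hτ).1 hq.symm
    exact ⟨e, by simpa using he, rfl⟩
  · intros; rfl

theorem sum_sameCycle_mapRot_inr [Fintype G.Dart] (p : Fin m × ZMod 4)
    {_ : DecidablePred fun q => (mapRot m τ).SameCycle q (Sum.inr p)}
      (f : G.Dart ⊕ (Fin m × ZMod 4) → ZMod 2) :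
    ∑ q with (mapRot m τ).SameCycle q (Sum.inr p), f q = ∑ i : ZMod 4, f (Sum.inr (p.1, i)) := by
  symm
  refine Finset.sum_bij (fun i _ => Sum.inr (p.1, i)) ?_ ?_ ?_ ?_
  · intro i _
    simp only [Finset.mem_filter, Finset.mem_univ, true_and]
    exact Equiv.Perm.SameCycle.symm ((sameCycle_mapRot_inr hτ).2 ⟨i, rfl⟩)
  · intro a _ b _ h
    simpa using h
  · intro q hq
    simp only [Finset.mem_filter, Finset.mem_univ, true_and] at hq
    obtain ⟨i, rfl⟩ := (sameCycle_mapRot_inr hτ).1 hq.symm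
    exact ⟨i, Finset.mem_univ _, rfl⟩
  · intros; rfl

end MapRot

namespace VirtualDiagram

variable {V : Type*} {G : SimpleGraph V} (D : VirtualDiagram G)

/-- The passages of the edges of the diagram. -/
def words : EdgeWords G D.m := ⟨D.word, D.word_symm, D.word_unique⟩

/-- The ends of the segments of the diagram. -/
abbrev End : Type _ := G.Dart ⊕ (Fin D.m × ZMod 4)

/-- The ends at which the segments of an edge begin. -/
def outEnds (d : G.Dart) : List D.End := Sum.inl d :: (D.word d).map Sum.inr

/-- The ends at which the segments of an edge arrive. -/
def inEnds (d : G.Dart) : List D.End :=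
  (D.word d).map (fun a => Sum.inr (oppositeEnd a)) ++ [Sum.inl d.symm]

/-- The two ends of a segment. -/
def Seg (p q : D.End) : Prop := ∃ d : G.Dart, (p, q) ∈ (D.outEnds d).zip (D.inEnds d)

/-- The edge, directed along the passage `p`. -/
noncomputable def dartAt (p : Fin D.m × ZMod 4) : G.Dart := D.words.dartAt p

theorem length_outEnds (d : G.Dart) : (D.outEnds d).length = (D.word d).length + 1 :=
  D.words.length_outEnds d

theorem length_inEnds (d : G.Dart) : (D.inEnds d).length = (D.word d).length + 1 :=
  D.words.length_inEnds d

theorem seg_symm {p q : D.End} (h : D.Seg p q) : D.Seg q p :=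
  D.words.seg_symm h

theorem mem_word_iff {p : Fin D.m × ZMod 4} {d : G.Dart} : p ∈ D.word d ↔ D.dartAt p = d :=
  D.words.mem_word_iff

theorem nodup_word (d : G.Dart) : (D.word d).Nodup :=
  D.words.nodup_word d

theorem dartAt_oppositeEnd (p : Fin D.m × ZMod 4) :
    D.dartAt (oppositeEnd p) = (D.dartAt p).symm :=
  D.words.dartAt_oppositeEnd p

theorem mem_outEnds {p : D.End} {d : G.Dart} :
    p ∈ D.outEnds d ↔ Sum.elim id D.dartAt p = d :=
  D.words.mem_outEnds

theorem nodup_outEnds (d : G.Dart) : (D.outEnds d).Nodup :=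
  D.words.nodup_outEnds d

theorem seg_unique {p q q' : D.End} (h : D.Seg p q) (h' : D.Seg p q') : q = q' :=
  D.words.seg_unique h h'

theorem dartOf_seg {p q : D.End} (h : D.Seg p q) :
    Sum.elim id D.dartAt q = (Sum.elim id D.dartAt p).symm :=
  D.words.dartOf_seg h

theorem seg_irrefl (p : D.End) : ¬ D.Seg p p :=
  D.words.seg_irrefl p

/-- The next end around a vertex or a crossing. -/
def rot : Equiv.Perm D.End := mapRot D.m D.vertexRot

@[simp] theorem rot_inr (p : Fin D.m × ZMod 4) : D.rot (Sum.inr p) = Sum.inr (p.1, p.2 + 1) := rfl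

theorem isPlanarMap_rot_seg : IsPlanarMap (fun p q => q = D.rot p) D.Seg := by
  have : (fun p q => q = D.rot p) =
      fun p q => q = Sum.map D.vertexRot (fun a : Fin D.m × ZMod 4 => (a.1, a.2 + 1)) p := by
    funext p q
    exact propext (mapRot_eq_iff p q)
  rw [this]
  exact D.planar

theorem hasColorings [Fintype G.Dart] : HasColorings (fun p q => q = D.rot p) D.Seg :=
  (isPlanarMap_iff_hasColorings (seg := D.Seg) D.rot (fun _ _ => D.seg_symm) D.seg_irrefl
    D.words.existsUnique_seg).1 D.isPlanarMap_rot_seg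

theorem sameCycle_rot_inl {d : G.Dart} {q : D.End} :
    D.rot.SameCycle (Sum.inl d) q ↔ ∃ e : G.Dart, q = Sum.inl e ∧ e.fst = d.fst :=
  sameCycle_mapRot_inl D.vertexRot_sameCycle

theorem sameCycle_rot_inr {p : Fin D.m × ZMod 4} {q : D.End} :
    D.rot.SameCycle (Sum.inr p) q ↔ ∃ i, q = Sum.inr (p.1, i) :=
  sameCycle_mapRot_inr D.vertexRot_sameCycle

theorem sum_sameCycle_inl [Fintype G.Dart] [DecidableEq V] (d : G.Dart)
    {_ : DecidablePred fun q => D.rot.SameCycle q (Sum.inl d)} (f : D.End → ZMod 2) :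
    ∑ q with D.rot.SameCycle q (Sum.inl d), f q = ∑ e : G.Dart with e.fst = d.fst, f (Sum.inl e) :=
  sum_sameCycle_mapRot_inl D.vertexRot_sameCycle d f

theorem sum_sameCycle_inr [Fintype G.Dart] (p : Fin D.m × ZMod 4)
    {_ : DecidablePred fun q => D.rot.SameCycle q (Sum.inr p)} (f : D.End → ZMod 2) :
    ∑ q with D.rot.SameCycle q (Sum.inr p), f q = ∑ i : ZMod 4, f (Sum.inr (p.1, i)) :=
  sum_sameCycle_mapRot_inr D.vertexRot_sameCycle p f

end VirtualDiagram

/-! ### The intersection form of a virtual graph diagram -/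

section Parity

variable {V : Type*} {G : SimpleGraph V}

/-- A mod 2 cycle of the graph `G`, as a function on its darts. -/
def IsEvenFunction [Fintype G.Dart] [DecidableEq V] (z : G.Dart → ZMod 2) : Prop :=
  (∀ d, z d.symm = z d) ∧ ∀ v, ∑ d : G.Dart with d.fst = v, z d = 0

theorem sum_zmod_four {M : Type*} [AddCommMonoid M] (f : ZMod 4 → M) :
    ∑ i, f i = f 0 + f 1 + f 2 + f 3 := Fin.sum_univ_four f

namespace VirtualDiagram

variable (D : VirtualDiagram G)

/-- An edge with `r` crossings has `r + 1` segments; the `2 * r + 1` contributions `c` add up to a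
single `c` mod 2. -/
theorem color_along {E X : Type*} {h : E → ZMod 2} {c : ZMod 2} {f : X → ZMod 2} {a b : X → E}
    (l : List X) (hl : ∀ x ∈ l, h (a x) = h (b x) + c + f x) (p q : E)
    (hs : ∀ r ∈ (p :: l.map a).zip (l.map b ++ [q]), h r.2 = h r.1 + c) :
    h q = h p + c + (l.map f).sum := by
  induction l generalizing p with
  | nil => simpa using hs (p, q) (by simp)
  | cons x l ih =>
    have h₁ := hs (p, b x) (by simp)
    have h₂ := hl x (by simp)
    have h₃ := ih (fun y hy => hl y (by simp [hy])) (a x) fun r hr => hs r (by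
      simp only [List.map_cons, List.cons_append, List.zip_cons_cons, List.mem_cons]
      exact Or.inr hr)
    simp only [List.map_cons, List.sum_cons]
    grind

/-- The cycle `z` is constant along each edge, so it is also a cycle at the crossings. Following an
edge, the colour of the face beside it changes whenever an edge of `z` is crossed; the extra `z d`
accounts for the change of side on reversal. -/
theorem exists_coloring [Fintype G.Dart] [DecidableEq V] {z : G.Dart → ZMod 2}
    (hz : IsEvenFunction z) :
    ∃ h : G.Dart → ZMod 2, (∀ d, h (D.vertexRot d) = h d + z d) ∧
      ∀ d, h d.symm = h d + z d +
        ((D.word d).map fun p => z (D.dartAt (p.1, p.2 + 1))).sum := by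
  have hopp : ∀ p, z (D.dartAt (oppositeEnd p)) = z (D.dartAt p) := fun p => by
    rw [D.dartAt_oppositeEnd, hz.1]
  obtain ⟨h, h₁, h₂⟩ := D.hasColorings (Sum.elim z fun p => z (D.dartAt p)) (by
      intro p q h
      have := D.dartOf_seg h
      have hr : ∀ p : D.End, Sum.elim z (fun p => z (D.dartAt p)) p =
          z (Sum.elim id D.dartAt p) := by
        rintro (_ | _) <;> rfl
      rw [hr, hr, this, hz.1]) (by
      rintro (d | p)
      · simp only [quot_perm_eq_iff]
        rw [sum_sameCycle_inl]
        exact hz.2 _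
      · simp only [quot_perm_eq_iff]
        rw [sum_sameCycle_inr, sum_zmod_four]
        have e₀ := hopp (p.1, 0)
        have e₁ := hopp (p.1, 1)
        simp only [oppositeEnd, show (0 : ZMod 4) + 2 = 2 from rfl,
          show (1 : ZMod 4) + 2 = 3 from rfl] at e₀ e₁
        simp only [Sum.elim_inr, e₀, e₁]
        grind)
  refine ⟨fun d => h (Sum.inl d), fun d => h₁ (Sum.inl d) _ rfl, fun d => ?_⟩
  refine color_along (a := Sum.inr) (b := fun p => Sum.inr (oppositeEnd p)) (D.word d) ?_
    (Sum.inl d) (Sum.inl d.symm) ?_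
  · intro p hp
    have e₁ := h₁ (Sum.inr p) _ rfl
    have e₂ := h₁ (Sum.inr (p.1, p.2 + 1)) _ rfl
    simp only [rot_inr, Sum.elim_inr, D.mem_word_iff.1 hp] at e₁ e₂
    rw [add_assoc, show (1 : ZMod 4) + 1 = 2 from rfl] at e₂
    show h (Sum.inr p) = h (Sum.inr (p.1, p.2 + 2)) + _ + _
    grind
  · intro r hr
    have := h₂ r.1 r.2 ⟨d, hr⟩
    rw [this]
    rcases r with ⟨e | p, q⟩
    · have := D.mem_outEnds.1 (List.of_mem_zip hr).1
      simp only [Sum.elim_inl, id] at this ⊢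
      rw [this]
    · have := D.mem_outEnds.1 (List.of_mem_zip hr).1
      simp only [Sum.elim_inr] at this ⊢
      rw [this]

theorem sum_word (f : Fin D.m × ZMod 4 → ZMod 2) (d : G.Dart) [DecidableEq G.Dart] :
    ((D.word d).map f).sum = ∑ p with D.dartAt p = d, f p := by
  rw [← List.sum_toFinset _ (D.nodup_word d)]
  refine Finset.sum_congr ?_ fun _ _ => rfl
  ext p
  simp [D.mem_word_iff]

/-- The contribution of the crossings to the intersection form of two mod 2 cycles. -/
noncomputable def crossingForm (β z : G.Dart → ZMod 2) (x : Fin D.m) : ZMod 2 :=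
  β (D.dartAt (x, 0)) * z (D.dartAt (x, 1)) + β (D.dartAt (x, 1)) * z (D.dartAt (x, 0))

end VirtualDiagram

end Parity

section Parity

variable {V : Type*} {G : SimpleGraph V} [DecidableEq V] [Fintype G.Dart]

namespace VirtualDiagram

variable (D : VirtualDiagram G)

/-- The edge ends at every vertex can be numbered along the rotation. -/
theorem exists_position : ∃ pos : G.Dart → ℕ,
    (∀ d e : G.Dart, d.fst = e.fst → pos d = pos e → d = e) ∧
    ∀ z h : G.Dart → ZMod 2, (∀ d, h (D.vertexRot d) = h d + z d) →
      ∃ H : V → ZMod 2, ∀ d : G.Dart,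
        h d = H d.fst + ∑ y : G.Dart with y.fst = d.fst ∧ pos y < pos d, z y := by
  classical
  -- A starting end is chosen at each vertex. It is phrased as a constant function of a dart so that
  -- it exists even if there are no darts.
  have hb : ∀ v, ∃ b : G.Dart → G.Dart, ∀ d : G.Dart, d.fst = v →
      (b d).fst = v ∧ ∀ e, b d = b e := by
    intro v
    by_cases h : ∃ d : G.Dart, d.fst = v
    · obtain ⟨d, hd⟩ := h
      exact ⟨fun _ => d, fun _ _ => ⟨hd, fun _ => rfl⟩⟩
    · exact ⟨id, fun d hd => absurd ⟨d, hd⟩ h⟩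
  choose b hb using hb
  let base : G.Dart → G.Dart := fun d => b d.fst d
  have hbase : ∀ d e : G.Dart, d.fst = e.fst → base d = base e := by
    intro d e h
    show b d.fst d = b e.fst e
    rw [h]
    exact (hb e.fst d h).2 e
  have hfst : ∀ d, (base d).fst = d.fst := fun d => (hb d.fst d rfl).1
  have hex : ∀ d, ∃ n : ℕ, (D.vertexRot ^ n) (base d) = d := fun d =>
    ((D.vertexRot_sameCycle (base d) d).2 (hfst d)).exists_nat_pow_eq
  have hrot : ∀ d, (D.vertexRot d).fst = d.fst := fun d =>
    ((D.vertexRot_sameCycle d (D.vertexRot d)).1 ⟨1, by simp⟩).symm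
  have hpow : ∀ d (n : ℕ), ((D.vertexRot ^ n) d).fst = d.fst := fun d n =>
    ((D.vertexRot_sameCycle d _).1 ⟨n, by simp⟩).symm
  have hinj : ∀ d e : G.Dart, d.fst = e.fst → Nat.find (hex d) = Nat.find (hex e) → d = e := by
    intro d e h₁ h₂
    rw [← Nat.find_spec (hex d), h₂, hbase d e h₁, Nat.find_spec (hex e)]
  refine ⟨fun d => Nat.find (hex d), hinj, fun z h hh => ?_⟩
  have hH : ∀ v, ∃ c, ∀ d : G.Dart, d.fst = v → h (base d) = c := by
    intro v
    by_cases h' : ∃ d : G.Dart, d.fst = v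
    · obtain ⟨d, hd⟩ := h'
      exact ⟨_, fun e he => congrArg h (hbase e d (he.trans hd.symm))⟩
    · exact ⟨0, fun d hd => absurd ⟨d, hd⟩ h'⟩
  choose H hH using hH
  refine ⟨H, ?_⟩
  have key : ∀ n : ℕ, ∀ d, Nat.find (hex d) = n →
      h d = H d.fst + ∑ y : G.Dart with y.fst = d.fst ∧ Nat.find (hex y) < n, z y := by
    intro n
    induction n with
    | zero =>
      intro d hd
      have := Nat.find_spec (hex d)
      rw [hd, pow_zero, Equiv.Perm.one_apply] at this
      rw [← hH d.fst d rfl, this]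
      simp
    | succ n ih =>
      intro d hd
      set d' := (D.vertexRot ^ n) (base d) with hd'
      have hdd' : D.vertexRot d' = d := by
        have := Nat.find_spec (hex d)
        rw [hd, pow_succ', Equiv.Perm.mul_apply] at this
        exact this
      have hf : d'.fst = d.fst := (hpow _ n).trans (hfst d)
      have hbd := hbase d' d hf
      have hn : Nat.find (hex d') = n := by
        apply le_antisymm
        · exact Nat.find_le (by rw [hbd])
        · by_contra! hlt
          have hle : Nat.find (hex d) ≤ Nat.find (hex d') + 1 := by
            apply Nat.find_le
            rw [pow_succ', Equiv.Perm.mul_apply, ← hbd, Nat.find_spec (hex d'), hdd']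
          omega
      rw [← hdd', hh, ih d' hn, hdd', hf, add_assoc]
      congr 1
      have : (Finset.univ.filter fun y : G.Dart => y.fst = d.fst ∧ Nat.find (hex y) < n + 1) =
          insert d' (Finset.univ.filter fun y : G.Dart =>
            y.fst = d.fst ∧ Nat.find (hex y) < n) := by
        ext y
        simp only [Finset.mem_filter, Finset.mem_univ, true_and, Finset.mem_insert]
        constructor
        · rintro ⟨h₁, h₂⟩
          by_cases h₃ : Nat.find (hex y) = n
          · exact Or.inl (hinj y d' (h₁.trans hf.symm) (h₃.trans hn.symm))
          · exact Or.inr ⟨h₁, by omega⟩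
        · rintro (rfl | ⟨h₁, h₂⟩)
          · exact ⟨hf, by omega⟩
          · exact ⟨h₁, by omega⟩
      rw [this, Finset.sum_insert, add_comm]
      simp only [Finset.mem_filter, not_and, not_lt]
      intro _ _
      exact hn.ge
  exact fun d => key _ d rfl

/-- The predicate `o` selects one direction of every edge, hence one end of each strand at a
crossing. The two selected ends contribute the two products in `crossingForm`. -/
theorem sum_crossing_eq {β z : G.Dart → ZMod 2} (hβ : ∀ d, β d.symm = β d)
    (hz : ∀ d, z d.symm = z d) {o : G.Dart → Prop} [DecidablePred o]
    (ho : ∀ d, o d.symm ↔ ¬ o d) :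
    ∑ d with o d, β d * ((D.word d).map fun p => z (D.dartAt (p.1, p.2 + 1))).sum =
      ∑ x, D.crossingForm β z x := by
  classical
  have h₁ : ∑ d with o d, β d * ((D.word d).map fun p => z (D.dartAt (p.1, p.2 + 1))).sum =
      ∑ d, ∑ p with D.dartAt p = d,
        if o (D.dartAt p) then β (D.dartAt p) * z (D.dartAt (p.1, p.2 + 1)) else 0 := by
    rw [Finset.sum_filter]
    refine Finset.sum_congr rfl fun d _ => ?_
    rw [D.sum_word]
    split_ifs with h
    · rw [Finset.mul_sum]
      refine Finset.sum_congr rfl fun p hp => ?_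
      obtain rfl := (Finset.mem_filter.1 hp).2
      rw [if_pos h]
    · refine (Finset.sum_eq_zero fun p hp => ?_).symm
      obtain rfl := (Finset.mem_filter.1 hp).2
      rw [if_neg h]
  rw [h₁, Finset.sum_fiberwise, Fintype.sum_prod_type]
  refine Finset.sum_congr rfl fun x _ => ?_
  rw [sum_zmod_four]
  have e₀ : D.dartAt (x, 2) = (D.dartAt (x, 0)).symm := D.dartAt_oppositeEnd (x, 0)
  have e₁ : D.dartAt (x, 3) = (D.dartAt (x, 1)).symm := D.dartAt_oppositeEnd (x, 1)
  simp only [show (0 : ZMod 4) + 1 = 1 from rfl, show (1 : ZMod 4) + 1 = 2 from rfl,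
    show (2 : ZMod 4) + 1 = 3 from rfl, show (3 : ZMod 4) + 1 = 0 from rfl, e₀, e₁, hβ, hz, ho,
    crossingForm]
  by_cases h₀ : o (D.dartAt (x, 0)) <;> by_cases h₁ : o (D.dartAt (x, 1)) <;>
    simp [h₀, h₁, add_comm]

/-- The number of crossings between two mod 2 cycles is determined mod 2 by the rotations at the
vertices. -/
theorem exists_position_form [Fintype V] {o : G.Dart → Prop} [DecidablePred o]
    (ho : ∀ d, o d.symm ↔ ¬ o d) : ∃ pos : G.Dart → ℕ,
    (∀ d e : G.Dart, d.fst = e.fst → pos d = pos e → d = e) ∧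
    ∀ β z : G.Dart → ZMod 2, IsEvenFunction β → IsEvenFunction z →
      ∑ x, D.crossingForm β z x = ∑ d with o d, β d * z d +
        ∑ d, ∑ y : G.Dart with y.fst = d.fst ∧ pos y < pos d, β d * z y := by
  obtain ⟨pos, hpos, hcol⟩ := D.exists_position
  refine ⟨pos, hpos, fun β z hβ hz => ?_⟩
  obtain ⟨h, h₁, h₂⟩ := D.exists_coloring hz
  obtain ⟨H, hH⟩ := hcol z h h₁
  -- Evaluation by vertices: the base colour `H` at a vertex is multiplied by the sum of `β` there,
  -- which is zero.
  have e₁ : ∑ d, β d * h d = ∑ d, ∑ y : G.Dart with y.fst = d.fst ∧ pos y < pos d, β d * z y := by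
    have : ∑ d : G.Dart, β d * H d.fst = 0 := by
      rw [← Finset.sum_fiberwise Finset.univ (fun d : G.Dart => d.fst)]
      refine Finset.sum_eq_zero fun v _ => ?_
      have : ∑ d : G.Dart with d.fst = v, β d * H d.fst =
          (∑ d : G.Dart with d.fst = v, β d) * H v := by
        rw [Finset.sum_mul]
        refine Finset.sum_congr rfl fun d hd => ?_
        rw [(Finset.mem_filter.1 hd).2]
      rw [this, hβ.2, zero_mul]
    rw [← zero_add (∑ d, ∑ y : G.Dart with y.fst = d.fst ∧ pos y < pos d, β d * z y), ← this,
      ← Finset.sum_add_distrib]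
    refine Finset.sum_congr rfl fun d _ => ?_
    rw [hH d, mul_add, Finset.mul_sum]
  -- Evaluation by edges: the two directions of an edge are combined, and `h₂` compares their
  -- colours.
  have e₂ : ∑ d, β d * h d = ∑ d with o d, β d * h d.symm + ∑ d with o d, β d * h d := by
    rw [← Finset.sum_filter_add_sum_filter_not Finset.univ o (fun d => β d * h d), add_comm]
    congr 1
    refine Finset.sum_bij (fun d _ => d.symm) ?_ ?_ ?_ ?_
    · intro d hd
      simpa [ho] using hd
    · intro a _ b _ hab
      exact SimpleGraph.Dart.symm_involutive.injective hab
    · intro d hd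
      exact ⟨d.symm, by simpa [ho] using hd, d.symm_symm⟩
    · intro d _
      rw [hβ.1, d.symm_symm]
  rw [← D.sum_crossing_eq hβ.1 hz.1 ho, ← e₁, e₂]
  rw [← Finset.sum_add_distrib, ← Finset.sum_add_distrib]
  refine Finset.sum_congr rfl fun d _ => ?_
  rw [h₂ d]
  have : ∀ a b c e : ZMod 2, a * b = a * c + (a * (e + c + b) + a * e) := by decide
  exact this _ _ _ _

/-- If the symmetrization of a sum of products of mod 2 cycles vanishes on pairs of edges with a
common vertex, then its sum over the crossings does not depend on the diagram. -/
theorem sum_crossingForm_eq [Fintype V] {o : G.Dart → Prop} [DecidablePred o]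
    (ho : ∀ d, o d.symm ↔ ¬ o d) {ι : Type*} [Fintype ι] {β z : ι → G.Dart → ZMod 2}
    (hβ : ∀ i, IsEvenFunction (β i)) (hz : ∀ i, IsEvenFunction (z i))
    (hadj : ∀ d e : G.Dart, d.fst = e.fst → d ≠ e →
      ∑ i, (β i d * z i e + β i e * z i d) = 0)
    {pos' : G.Dart → ℕ} (hpos' : ∀ d e : G.Dart, d.fst = e.fst → pos' d = pos' e → d = e) :
    ∑ x, ∑ i, D.crossingForm (β i) (z i) x = ∑ d with o d, ∑ i, β i d * z i d +
      ∑ d, ∑ y : G.Dart with y.fst = d.fst ∧ pos' y < pos' d, ∑ i, β i d * z i y := by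
  obtain ⟨pos, hpos, hform⟩ := D.exists_position_form ho
  have key : ∀ {p : G.Dart → ℕ} {q : G.Dart → ℕ},
      (∀ d e : G.Dart, d.fst = e.fst → p d = p e → d = e) →
      (∀ d e : G.Dart, d.fst = e.fst → q d = q e → d = e) →
      ∑ d, ∑ y : G.Dart with y.fst = d.fst ∧ p y < p d, ∑ i, β i d * z i y =
      ∑ d, ∑ y : G.Dart with y.fst = d.fst ∧ q y < q d, ∑ i, β i d * z i y := by
    intro p q hp hq
    -- `F` collects the pairs ordered alike by the two numberings, `F'` those ordered oppositely.
    -- Only `F'` changes when the numberings are exchanged, and `hadj` makes that change vanish.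
    let F : (G.Dart → ℕ) → (G.Dart → ℕ) → ZMod 2 := fun a b =>
      ∑ d, ∑ y, if y.fst = d.fst ∧ a y < a d ∧ b y < b d then ∑ i, β i d * z i y else 0
    let F' : (G.Dart → ℕ) → (G.Dart → ℕ) → ZMod 2 := fun a b =>
      ∑ d, ∑ y, if y.fst = d.fst ∧ a y < a d ∧ b d < b y then ∑ i, β i d * z i y else 0
    have split : ∀ a b : G.Dart → ℕ, (∀ d e : G.Dart, d.fst = e.fst → b d = b e → d = e) →
        ∑ d, ∑ y : G.Dart with y.fst = d.fst ∧ a y < a d, ∑ i, β i d * z i y = F a b + F' a b := by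
      intro a b hb
      simp only [F, F']
      rw [← Finset.sum_add_distrib]
      refine Finset.sum_congr rfl fun d _ => ?_
      rw [Finset.sum_filter, ← Finset.sum_add_distrib]
      refine Finset.sum_congr rfl fun y _ => ?_
      by_cases h : y.fst = d.fst ∧ a y < a d
      · rcases lt_trichotomy (b y) (b d) with h' | h' | h'
        · simp [h, h', h'.le]
        · obtain rfl := hb y d h.1 h'
          exact absurd h.2 (lt_irrefl _)
        · simp [h, h', h'.le]
      · rw [if_neg h, if_neg (fun h' => h ⟨h'.1, h'.2.1⟩), if_neg (fun h' => h ⟨h'.1, h'.2.1⟩),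
          add_zero]
    rw [split p q hq, split q p hp]
    congr 1
    · refine Finset.sum_congr rfl fun d _ => Finset.sum_congr rfl fun y _ => ?_
      simp only [and_comm (a := p y < p d)]
    · simp only [F']
      rw [Finset.sum_comm]
      refine Finset.sum_congr rfl fun d _ => Finset.sum_congr rfl fun y _ => ?_
      by_cases h : d.fst = y.fst ∧ p d < p y ∧ q y < q d
      · rw [if_pos h, if_pos ⟨h.1.symm, h.2.2, h.2.1⟩]
        have := hadj d y h.1 (by rintro rfl; exact lt_irrefl _ h.2.1)
        rw [Finset.sum_add_distrib] at this
        exact (zmod_two_add_eq_zero.1 this).symm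
      · rw [if_neg h, if_neg fun h' => h ⟨h'.1.symm, h'.2.2, h'.2.1⟩]
  rw [← key hpos hpos', Finset.sum_comm]
  simp only [hform _ _ (hβ _) (hz _)]
  rw [Finset.sum_add_distrib]
  congr 1
  · rw [Finset.sum_comm]
  · rw [Finset.sum_comm]
    refine Finset.sum_congr rfl fun d _ => ?_
    rw [Finset.sum_comm]

end VirtualDiagram

end Parity

/-! ### The diagrams of the links of a graph -/

section ListLemmas

variable {α β γ : Type*}

theorem flatMap_cons_shift (a : α → β) (w : α → List β) (d₀ : α) (ds : List α) (b : α) :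
    w d₀ ++ ds.flatMap (fun d => a d :: w d) ++ [a b] =
      ((d₀ :: ds).zip (ds ++ [b])).flatMap fun e => w e.1 ++ [a e.2] := by
  induction ds generalizing d₀ with
  | nil => simp
  | cons d₁ ds ih =>
    rw [List.cons_append, List.zip_cons_cons]
    simp only [List.flatMap_cons]
    rw [← ih d₁]
    simp

/-- Rotating by one regroups the departure ends of a closed walk: each edge keeps its own passages
and receives the start of the next edge as its last entry. -/
theorem rotate_flatMap_cons (a : α → β) (w : α → List β) (ds : List α) :
    (ds.flatMap fun d => a d :: w d).rotate 1 =
      (ds.zip (ds.rotate 1)).flatMap fun e => w e.1 ++ [a e.2] := by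
  cases ds with
  | nil => rfl
  | cons d ds =>
    rw [List.flatMap_cons, List.cons_append, List.rotate_cons_succ, List.rotate_zero,
      flatMap_cons_shift a w d ds d, List.rotate_cons_succ, List.rotate_zero]

theorem mem_zip_flatMap {f : α → List β} {g : α → List γ} {ds : List α}
    (h : ∀ d, (f d).length = (g d).length) {p : β × γ}
    (hp : p ∈ (ds.flatMap f).zip (ds.flatMap g)) : ∃ d ∈ ds, p ∈ (f d).zip (g d) := by
  induction ds with
  | nil => simp at hp
  | cons d ds ih =>
    rw [List.flatMap_cons, List.flatMap_cons, List.zip_append (h d), List.mem_append] at hp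
    rcases hp with hp | hp
    · exact ⟨d, List.mem_cons_self, hp⟩
    · obtain ⟨e, he, hp⟩ := ih hp
      exact ⟨e, List.mem_cons_of_mem _ he, hp⟩

theorem mem_zip_right_map {f : β → γ} {l : List α} {l' : List β} {p : α} {q : β}
    (h : (p, q) ∈ l.zip l') : (p, f q) ∈ l.zip (l'.map f) := by
  rw [List.zip_map_right, List.mem_map]
  exact ⟨_, h, rfl⟩

theorem List.Nodup.two_le_countP_iff {l : List α} (hl : l.Nodup) (f : α → Bool) :
    2 ≤ l.countP f ↔ ∃ a ∈ l, ∃ b ∈ l, a ≠ b ∧ f a = true ∧ f b = true := by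
  classical
  rw [List.countP_eq_length_filter, ← List.toFinset_card_of_nodup (hl.filter _)]
  show 1 < _ ↔ _
  rw [Finset.one_lt_card]
  simp only [List.mem_toFinset, List.mem_filter]
  constructor
  · rintro ⟨a, ⟨ha, ha'⟩, b, ⟨hb, hb'⟩, h⟩
    exact ⟨a, ha, b, hb, h, ha', hb'⟩
  · rintro ⟨a, ha, b, hb, h, ha', hb'⟩
    exact ⟨a, ⟨ha, ha'⟩, b, ⟨hb, hb'⟩, h⟩

end ListLemmas

/-! ### The darts of a cycle -/

section CycleDarts

variable {V : Type*} {G : SimpleGraph V} {v : V} {w : G.Walk v v}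

theorem cycNext_darts_fst_eq (w : G.Walk v v) {d e : G.Dart} (h : CycNext w.darts d e) :
    e.fst = d.snd := by
  have key : w.darts.map (·.snd) = (w.darts.map (·.fst)).rotate 1 := by
    have h₁ := w.cons_map_snd_darts
    have h₂ := w.map_fst_darts_append
    rcases hl : w.darts with _ | ⟨d, ds⟩
    · rfl
    · rw [hl] at h₁ h₂
      have h₃ := h₁.trans h₂.symm
      simp only [List.map_cons, List.cons_append, List.cons.injEq] at h₃
      simp only [List.map_cons, List.rotate_cons_succ, List.rotate_zero]
      rw [h₃.2, ← h₃.1]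
  obtain ⟨i, hi, h⟩ := List.mem_iff_getElem.1 h
  rw [List.getElem_zip, Prod.mk.injEq] at h
  have hi' : i < w.darts.length := by
    rw [List.length_zip, List.length_rotate, min_self] at hi
    exact hi
  have h₁ : (w.darts.map (·.snd))[i]'(by simpa using hi') = d.snd := by
    rw [List.getElem_map, h.1]
  have h₂ : ((w.darts.map (·.fst)).rotate 1)[i]'(by simpa using hi') = e.fst := by
    simp only [← List.map_rotate, List.getElem_map, h.2]
  rw [← h₁, ← h₂]
  simp only [key]

theorem SimpleGraph.Walk.IsCycle.nodup_darts (hw : w.IsCycle) : w.darts.Nodup :=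
  List.Nodup.of_map _ hw.isTrail.edges_nodup

theorem SimpleGraph.Walk.IsCycle.symm_notMem_darts (hw : w.IsCycle) {d : G.Dart}
    (hd : d ∈ w.darts) : d.symm ∉ w.darts := fun hd' =>
  d.symm_ne (List.inj_on_of_nodup_map hw.isTrail.edges_nodup hd' hd d.edge_symm)

theorem SimpleGraph.Walk.IsCycle.eq_of_fst_eq (hw : w.IsCycle) {d e : G.Dart} (hd : d ∈ w.darts)
    (he : e ∈ w.darts) (h : d.fst = e.fst) : d = e := by
  refine List.inj_on_of_nodup_map (f := fun d : G.Dart => d.fst) ?_ hd he h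
  rw [w.map_fst_darts]
  exact hw.nodup_dropLast_support

end CycleDarts

/-! ### The link diagram of a family of disjoint cycles -/

section LinkDiagram

variable {V : Type*} {G : SimpleGraph V} {k : ℕ} {c : Fin k → Σ v : V, G.Walk v v}

theorem IsCycleLink.eq_of_fst_mem (hc : IsCycleLink c) {i j : Fin k} {d e : G.Dart}
    (hd : d ∈ (c i).2.darts) {v : V} (hdv : v = d.fst ∨ v = d.snd) (he : e ∈ (c j).2.darts)
    (hev : v = e.fst ∨ v = e.snd) : i = j := by
  by_contra hij
  have h₁ : v ∈ (c i).2.support := by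
    rcases hdv with rfl | rfl
    · exact (c i).2.dart_fst_mem_support_of_mem_darts hd
    · exact (c i).2.dart_snd_mem_support_of_mem_darts hd
  have h₂ : v ∈ (c j).2.support := by
    rcases hev with rfl | rfl
    · exact (c j).2.dart_fst_mem_support_of_mem_darts he
    · exact (c j).2.dart_snd_mem_support_of_mem_darts he
  exact hc.2.2 i j hij v h₁ h₂

theorem IsCycleLink.eq_of_mem (hc : IsCycleLink c) {i j : Fin k} {d : G.Dart}
    (hi : d ∈ (c i).2.darts) (hj : d ∈ (c j).2.darts) : i = j :=
  hc.eq_of_fst_mem hi (Or.inl rfl) hj (Or.inl rfl)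

theorem IsCycleLink.symm_notMem (hc : IsCycleLink c) {i j : Fin k} {d : G.Dart}
    (hi : d ∈ (c i).2.darts) : d.symm ∉ (c j).2.darts := fun hj => by
  obtain rfl := hc.eq_of_fst_mem (v := d.fst) hi (Or.inl rfl) hj (Or.inr rfl)
  exact (hc.2.1 i).symm_notMem_darts hi hj

theorem IsCycleLink.eq_of_fst_eq (hc : IsCycleLink c) {i j : Fin k} {d e : G.Dart}
    (hi : d ∈ (c i).2.darts) (hj : e ∈ (c j).2.darts) (h : d.fst = e.fst) : d = e := by
  obtain rfl := hc.eq_of_fst_mem (v := d.fst) hi (Or.inl rfl) hj (Or.inl h)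
  exact (hc.2.1 i).eq_of_fst_eq hi hj h

namespace LinkCode

theorem nodup_passages_of {L : LinkCode k} (h : ∀ j, (L j).Nodup)
    (hdisj : ∀ i j p, p ∈ L i → p ∈ L j → i = j) : L.passages.Nodup := by
  unfold passages
  rw [List.nodup_flatten]
  refine ⟨fun l hl => ?_, ?_⟩
  · obtain ⟨j, rfl⟩ := List.mem_ofFn.1 hl
    exact h j
  · rw [List.pairwise_ofFn]
    intro i j hij p hp hq
    exact hij.ne (hdisj i j p hp hq)

end LinkCode

namespace VirtualDiagram

variable (D : VirtualDiagram G)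

/-- The name of a passage of the graph diagram in the diagrams of its links. -/
def cross (p : Fin D.m × ZMod 4) : Crossing × ZMod 4 := (⟨p.1.val, D.virt p.1⟩, p.2)

theorem cross_injective : Function.Injective D.cross := by
  rintro ⟨x, i⟩ ⟨y, j⟩ h
  simp only [cross, Prod.mk.injEq, Crossing.mk.injEq] at h
  exact Prod.ext (Fin.ext h.1.1) h.2

theorem cross_oppositeEnd (p : Fin D.m × ZMod 4) :
    D.cross (oppositeEnd p) = oppositeEnd (D.cross p) := rfl

theorem mem_walkWord {c : Σ v : V, G.Walk v v} {q : Crossing × ZMod 4} :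
    q ∈ D.walkWord c ↔ ∃ p, D.dartAt p ∈ c.2.darts ∧ D.cross p = q := by
  unfold walkWord
  rw [List.mem_map]
  refine exists_congr fun p => and_congr_left fun _ => ?_
  simp [List.mem_flatMap, D.mem_word_iff]

theorem cross_mem_walkWord {c : Σ v : V, G.Walk v v} {p : Fin D.m × ZMod 4} :
    D.cross p ∈ D.walkWord c ↔ D.dartAt p ∈ c.2.darts := by
  rw [mem_walkWord]
  exact ⟨fun ⟨q, hq, h⟩ => D.cross_injective h ▸ hq, fun h => ⟨p, h, rfl⟩⟩

theorem nodup_flatMap_word {l : List G.Dart} (hl : l.Nodup) : (l.flatMap D.word).Nodup := by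
  rw [List.nodup_flatMap]
  refine ⟨fun d _ => D.nodup_word d, hl.imp fun {d e} hde p hp hq => hde ?_⟩
  rw [← D.mem_word_iff.1 hp, D.mem_word_iff.1 hq]

theorem nodup_flatMap_outEnds {l : List G.Dart} (hl : l.Nodup) : (l.flatMap D.outEnds).Nodup := by
  rw [List.nodup_flatMap]
  refine ⟨fun d _ => D.nodup_outEnds d, hl.imp fun {d e} hde p hp hq => hde ?_⟩
  rw [← D.mem_outEnds.1 hp, D.mem_outEnds.1 hq]

/-- The link `c` contains both strands of the crossing `x`. -/
def Survives (c : Fin k → Σ v : V, G.Walk v v) (x : Fin D.m) : Prop :=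
  ∀ i : ZMod 4, ∃ j, D.dartAt (x, i) ∈ (c j).2.darts ∨ D.dartAt (x, i + 2) ∈ (c j).2.darts

variable {D}

/-- Disjoint cycles never use an edge in both directions, so two different passages of one crossing
lie on different strands. -/
theorem survives_iff (hc : IsCycleLink c) {p : Fin D.m × ZMod 4} :
    2 ≤ (LinkCode.passages fun i => D.walkWord (c i)).countP
      (fun q => q.1 = (D.cross p).1) ↔ D.Survives c p.1 := by
  have hnd : (LinkCode.passages fun i => D.walkWord (c i)).Nodup := by
    refine LinkCode.nodup_passages_of (fun j => ?_) fun i j q hi hj => ?_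
    · exact (D.nodup_flatMap_word (hc.2.1 j).nodup_darts).map D.cross_injective
    · obtain ⟨p, hp, rfl⟩ := D.mem_walkWord.1 hi
      exact hc.eq_of_mem hp (D.cross_mem_walkWord.1 hj)
  have hmem : ∀ q, q ∈ (LinkCode.passages fun i => D.walkWord (c i)) ↔
      ∃ j, q ∈ D.walkWord (c j) := fun q => LinkCode.mem_passages
  have hfst : ∀ p q : Fin D.m × ZMod 4, (D.cross q).1 = (D.cross p).1 → q.1 = p.1 := by
    intro p q h
    simp only [cross, Crossing.mk.injEq] at h
    exact Fin.ext h.1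
  rw [hnd.two_le_countP_iff]
  simp only [decide_eq_true_eq, hmem]
  obtain ⟨x, i₀⟩ := p
  constructor
  · rintro ⟨a, ⟨i, ha⟩, b, ⟨j, hb⟩, hab, hax, hbx⟩
    obtain ⟨⟨xa, ia⟩, ha', rfl⟩ := D.mem_walkWord.1 ha
    obtain ⟨⟨xb, ib⟩, hb', rfl⟩ := D.mem_walkWord.1 hb
    clear ha hb
    obtain rfl : xa = x := hfst (x, i₀) (xa, ia) hax
    obtain rfl : xb = xa := hfst (xa, i₀) (xb, ib) hbx
    have h₁ : ia ≠ ib := fun h => hab (by rw [h])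
    have h₂ : ib ≠ ia + 2 := by
      rintro rfl
      have := D.dartAt_oppositeEnd (xb, ia)
      rw [oppositeEnd] at this
      rw [this] at hb'
      exact hc.symm_notMem ha' hb'
    have h₃ : ∀ ia ib i : ZMod 4, ia ≠ ib → ib ≠ ia + 2 →
        i = ia ∨ i + 2 = ia ∨ i = ib ∨ i + 2 = ib := by decide
    intro l
    rcases h₃ ia ib l h₁ h₂ with rfl | h | rfl | h
    · exact ⟨i, Or.inl ha'⟩
    · exact ⟨i, Or.inr (h ▸ ha')⟩
    · exact ⟨j, Or.inl hb'⟩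
    · exact ⟨j, Or.inr (h ▸ hb')⟩
  · intro h
    have key : ∀ i, ∃ i', (i' = i ∨ i' = i + 2) ∧ ∃ j, D.dartAt (x, i') ∈ (c j).2.darts := by
      intro i
      obtain ⟨j, h | h⟩ := h i
      · exact ⟨i, Or.inl rfl, j, h⟩
      · exact ⟨i + 2, Or.inr rfl, j, h⟩
    obtain ⟨i₁, h₁, j₁, hj₁⟩ := key 0
    obtain ⟨i₂, h₂, j₂, hj₂⟩ := key 1
    refine ⟨D.cross (x, i₁), ⟨j₁, D.cross_mem_walkWord.2 hj₁⟩, D.cross (x, i₂),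
      ⟨j₂, D.cross_mem_walkWord.2 hj₂⟩, fun h => ?_, rfl, rfl⟩
    have : i₁ = i₂ := congrArg Prod.snd (D.cross_injective h)
    revert h₁ h₂ this
    clear * -
    revert i₁ i₂
    decide

theorem mem_linkCode (hc : IsCycleLink c) {j : Fin k} {q : Crossing × ZMod 4} :
    q ∈ D.linkCode c j ↔
      ∃ p, (D.dartAt p ∈ (c j).2.darts ∧ D.Survives c p.1) ∧ D.cross p = q := by
  unfold linkCode
  rw [List.mem_filter, mem_walkWord, decide_eq_true_eq]
  constructor
  · rintro ⟨⟨p, hp, rfl⟩, h⟩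
    exact ⟨p, ⟨hp, (survives_iff hc).1 h⟩, rfl⟩
  · rintro ⟨p, ⟨hp, hs⟩, rfl⟩
    exact ⟨⟨p, hp, rfl⟩, (survives_iff hc).2 hs⟩

theorem cross_mem_linkCode (hc : IsCycleLink c) {j : Fin k} {p : Fin D.m × ZMod 4} :
    D.cross p ∈ D.linkCode c j ↔ D.dartAt p ∈ (c j).2.darts ∧ D.Survives c p.1 := by
  rw [mem_linkCode hc]
  exact ⟨fun ⟨q, hq, h⟩ => D.cross_injective h ▸ hq, fun h => ⟨p, h, rfl⟩⟩

theorem hasCrossing_linkCode (hc : IsCycleLink c) {y : Crossing} :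
    (D.linkCode c).HasCrossing y ↔ ∃ x : Fin D.m, D.Survives c x ∧ y = ⟨x.val, D.virt x⟩ := by
  constructor
  · rintro ⟨q, hq, rfl⟩
    obtain ⟨j, hq⟩ := LinkCode.mem_passages.1 hq
    obtain ⟨p, hp, rfl⟩ := (mem_linkCode hc).1 hq
    exact ⟨p.1, hp.2, rfl⟩
  · rintro ⟨x, hx, rfl⟩
    obtain ⟨j, h | h⟩ := hx 0
    · exact LinkCode.hasCrossing_of_mem ((cross_mem_linkCode hc).2 ⟨h, hx⟩)
    · exact LinkCode.hasCrossing_of_mem ((cross_mem_linkCode hc).2 ⟨h, hx⟩)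

theorem isTwiceMet_linkCode (hc : IsCycleLink c) : (D.linkCode c).IsTwiceMet := by
  have hnd : (D.linkCode c).passages.Nodup := by
    refine LinkCode.nodup_passages_of (fun j => ?_) fun i j q hi hj => ?_
    · exact ((D.nodup_flatMap_word (hc.2.1 j).nodup_darts).map D.cross_injective).filter _
    · obtain ⟨p, hp, rfl⟩ := (mem_linkCode hc).1 hi
      exact hc.eq_of_mem hp.1 ((cross_mem_linkCode hc).1 hj).1
  intro y hy i
  obtain ⟨x, hx, rfl⟩ := (hasCrossing_linkCode hc).1 hy
  rw [hnd.count, hnd.count]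
  have key : ∀ t, ((⟨x.val, D.virt x⟩, t) ∈ (D.linkCode c).passages) ↔
      ∃ j, D.dartAt (x, t) ∈ (c j).2.darts := fun t =>
    LinkCode.mem_passages.trans (exists_congr fun j =>
      (cross_mem_linkCode hc (p := (x, t))).trans (and_iff_left hx))
  have hopp : D.dartAt (x, i + 2) = (D.dartAt (x, i)).symm := D.dartAt_oppositeEnd (x, i)
  obtain ⟨j, hj | hj⟩ := hx i
  · rw [if_pos ((key _).2 ⟨j, hj⟩), if_neg]
    rw [key]
    rintro ⟨j', hj'⟩
    rw [hopp] at hj'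
    exact hc.symm_notMem hj hj'
  · rw [if_neg, if_pos ((key _).2 ⟨j, hj⟩)]
    rw [key]
    rintro ⟨j', hj'⟩
    rw [hopp] at hj
    exact hc.symm_notMem hj' hj

/-- The part of a virtual graph diagram formed by disjoint cycles is a virtual link diagram. -/
theorem isDiagram_linkCode [Fintype G.Dart] (hc : IsCycleLink c) : (D.linkCode c).IsDiagram := by
  classical
  refine LinkCode.isDiagram_iff.2 ⟨isTwiceMet_linkCode hc, fun z hz₁ hz₂ => ?_⟩
  let Q : Fin k → List D.End := fun j => (c j).2.darts.flatMap D.outEnds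
  -- The preceding dart on the cycle through `d`; the default value is irrelevant off the cycles.
  let pre : G.Dart → G.Dart := fun d =>
    if h : ∃ j e, CycNext (c j).2.darts e d then h.choose_spec.choose else d
  have hpre : ∀ j d e, CycNext (c j).2.darts e d → pre d = e := by
    intro j d e h
    have hex : ∃ j e, CycNext (c j).2.darts e d := ⟨j, e, h⟩
    have hsp := hex.choose_spec.choose_spec
    show dite _ _ _ = _
    rw [dif_pos hex]
    have hj := hc.eq_of_mem hsp.mem_right h.mem_right
    exact CycNext.left_unique (hc.2.1 j).nodup_darts (hj ▸ hsp) h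
  let inn : D.End → D.End :=
    Sum.elim (fun d => Sum.inl (pre d).symm) fun p => Sum.inr (oppositeEnd p)
  -- The vertices of the graph are dropped too: each is passed at most once by the disjoint cycles,
  -- like a crossing with an edge outside the link.
  let S : D.End → Bool := Sum.elim (fun _ => false) fun p => decide (D.Survives c p.1)
  have hQmem : ∀ j q, q ∈ Q j ↔ Sum.elim id D.dartAt q ∈ (c j).2.darts := by
    intro j q
    simp [Q, List.mem_flatMap, D.mem_outEnds]
  have hprev : ∀ j, ∀ d ∈ (c j).2.darts, pre d ∈ (c j).2.darts ∧ (pre d).snd = d.fst := by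
    intro j d hd
    obtain ⟨e, he⟩ := exists_cycPrev hd
    rw [hpre j d e he]
    exact ⟨he.mem_left, (cycNext_darts_fst_eq _ he).symm⟩
  have hinnmem : ∀ j, ∀ q ∈ Q j, (Sum.elim id D.dartAt (inn q)).symm ∈ (c j).2.darts := by
    intro j q hq
    rw [hQmem] at hq
    rcases q with d | p
    · show (pre d).symm.symm ∈ _
      rw [SimpleGraph.Dart.symm_symm]
      exact (hprev j d hq).1
    · show (D.dartAt (oppositeEnd p)).symm ∈ _
      rw [D.dartAt_oppositeEnd, SimpleGraph.Dart.symm_symm]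
      exact hq
  have hfilter : ∀ j, ((Q j).filter S).map (Sum.elim (fun _ => (⟨0, false⟩, 0)) D.cross) =
      D.linkCode c j := by
    intro j
    have h₁ : ∀ l : List G.Dart, (l.flatMap D.outEnds).filter S =
        ((l.flatMap D.word).filter fun p => decide (D.Survives c p.1)).map Sum.inr := by
      intro l
      induction l with
      | nil => rfl
      | cons d l ih =>
        rw [List.flatMap_cons, List.flatMap_cons, List.filter_append, List.filter_append,
          List.map_append, ih]
        congr 1
        rw [outEnds, List.filter_cons_of_neg (by simp [S]), List.filter_map]
        rfl
    rw [h₁, List.map_map]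
    unfold linkCode walkWord
    rw [List.filter_map]
    show List.map D.cross _ = List.map D.cross _
    congr 1
    refine List.filter_congr fun p _ => ?_
    rw [Function.comp, decide_eq_decide]
    exact (survives_iff hc (p := p)).symm
  have hQnd : ∀ j, (Q j).Nodup := fun j => D.nodup_flatMap_outEnds (hc.2.1 j).nodup_darts
  have hcyc : ∀ j p q, CycNext ((Q j).filter S) p q →
      ∃ a b, p = Sum.inr a ∧ q = Sum.inr b ∧ CycNext (D.linkCode c j) (D.cross a) (D.cross b) := by
    intro j p q h
    have hp := (List.mem_filter.1 h.mem_left).2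
    have hq := (List.mem_filter.1 h.mem_right).2
    rcases p with p | a
    · simp [S] at hp
    rcases q with q | b
    · simp [S] at hq
    refine ⟨a, b, rfl, rfl, ?_⟩
    rw [← hfilter j]
    unfold CycNext at h ⊢
    rw [← List.map_rotate, List.zip_map, List.mem_map]
    exact ⟨_, h, rfl⟩
  obtain ⟨h, hh₁, hh₂⟩ : ∃ h : D.End → ZMod 2,
      (∀ p, S p = true →
        h (D.rot p) = h p + Sum.elim (fun _ => 0) (fun p => z (D.cross p)) p) ∧
      ∀ j p q, CycNext ((Q j).filter S) p q →
        h (inn q) = h p + Sum.elim (fun _ => 0) (fun p => z (D.cross p)) p := by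
    refine exists_coloring_of_traversal D.hasColorings (fun _ _ => D.seg_symm)
      (fun _ _ _ => D.seg_unique) Q hQnd ?_ inn S ?_ ?_ ?_ ?_ ?_ ?_ _ ?_ ?_
    · intro i j q hi hj
      exact hc.eq_of_mem ((hQmem i q).1 hi) ((hQmem j q).1 hj)
    · intro j p q hpq
      have h₁ := mem_zip_right_map (f := inn) hpq
      -- Paired with `Q j`, the entering ends of the following passages are the arrival ends of the
      -- segments, edge by edge.
      have h₂ : ((Q j).rotate 1).map inn = (c j).2.darts.flatMap D.inEnds := by
        have h₃ := rotate_flatMap_cons (fun d => (Sum.inl d : D.End))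
          (fun d => (D.word d).map Sum.inr) (c j).2.darts
        refine (congrArg (List.map inn) h₃).trans ?_
        rw [List.map_flatMap]
        have h₄ : ((c j).2.darts.zip ((c j).2.darts.rotate 1)).flatMap
            (fun e => List.map inn ((D.word e.1).map Sum.inr ++ [Sum.inl e.2])) =
            ((c j).2.darts.zip ((c j).2.darts.rotate 1)).flatMap (fun e => D.inEnds e.1) := by
          refine List.flatMap_congr fun e he => ?_
          rw [inEnds, List.map_append, List.map_map]
          congr 1
          show [Sum.inl (pre e.2).symm] = _
          rw [hpre j e.2 e.1 he]
        rw [h₄, ← List.flatMap_map Prod.fst D.inEnds, List.map_fst_zip (by simp)]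
      rw [h₂] at h₁
      obtain ⟨d, -, hd⟩ := mem_zip_flatMap
        (fun d => (D.length_outEnds d).trans (D.length_inEnds d).symm) h₁
      exact ⟨d, hd⟩
    · intro j q hq
      rcases q with d | p
      · refine D.sameCycle_rot_inl.2 ⟨_, rfl, ?_⟩
        exact (hprev j d ((hQmem _ _).1 hq)).2
      · exact D.sameCycle_rot_inr.2 ⟨_, rfl⟩
    · intro i j q hq hq'
      have h₁ := hinnmem i q hq
      exact hc.symm_notMem ((hQmem _ _).1 hq') h₁
    · rintro (d | p) <;> rfl
    · intro j q hq hSq r hr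
      rcases q with d | p
      · obtain ⟨e, rfl, he⟩ := D.sameCycle_rot_inl.1 hr
        have hd : d ∈ (c j).2.darts := (hQmem _ _).1 hq
        by_contra! hcon
        obtain ⟨h₁, h₂, h₃⟩ := hcon
        have h₄ : ∀ i, Sum.inl e ∉ Q i := fun i hi =>
          h₁ (congrArg Sum.inl (hc.eq_of_fst_eq ((hQmem _ _).1 hi) hd he))
        obtain ⟨i, q', hq', h₅⟩ := h₃ h₄
        rcases q' with d' | p'
        · have hd' : d' ∈ (c i).2.darts := (hQmem _ _).1 hq'
          have h₆ : e = (pre d').symm := Sum.inl_injective h₅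
          have h₇ : e.fst = d'.fst := by rw [h₆]; exact (hprev i d' hd').2
          obtain rfl := hc.eq_of_fst_eq hd' hd (h₇.symm.trans he)
          exact h₂ h₅
        · cases h₅
      · obtain ⟨i', rfl⟩ := D.sameCycle_rot_inr.1 hr
        by_contra! hcon
        obtain ⟨h₁, h₂, h₃⟩ := hcon
        obtain ⟨x, i⟩ := p
        have hi₁ : i' ≠ i := fun h => h₁ (by rw [h])
        have hi₂ : i' ≠ i + 2 := fun h => h₂ (by rw [h]; rfl)
        have hp : D.dartAt (x, i) ∈ (c j).2.darts := (hQmem _ _).1 hq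
        have hused : ∃ l, D.dartAt (x, i') ∈ (c l).2.darts ∨
            D.dartAt (x, i' + 2) ∈ (c l).2.darts := by
          by_cases h₄ : ∃ l, Sum.inr (x, i') ∈ Q l
          · obtain ⟨l, hl⟩ := h₄
            exact ⟨l, Or.inl ((hQmem _ _).1 hl)⟩
          · obtain ⟨l, q', hq', h₅⟩ := h₃ (not_exists.1 h₄)
            rcases q' with d' | p'
            · cases h₅
            · have h₆ : (x, i') = oppositeEnd p' := Sum.inr_injective h₅
              have h₇ : p' = (x, i' + 2) := by
                rw [← oppositeEnd_oppositeEnd p', ← h₆, oppositeEnd]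
              exact ⟨l, Or.inr (h₇ ▸ (hQmem _ _).1 hq')⟩
        -- A used end outside the passage `(x, i)` lies on the other strand, so the link contains
        -- both strands.
        have hS : D.Survives c x := by
          have hdec : ∀ i i' : ZMod 4, i' ≠ i → i' ≠ i + 2 → ∀ l, l = i ∨ l + 2 = i ∨ l = i' ∨
            (l = i' + 2 ∧ l + 2 = i') := by decide
          obtain ⟨l, hl⟩ := hused
          intro a
          rcases hdec i i' hi₁ hi₂ a with rfl | h | rfl | ⟨h, h'⟩
          · exact ⟨j, Or.inl hp⟩
          · exact ⟨j, Or.inr (h ▸ hp)⟩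
          · exact ⟨l, hl⟩
          · refine ⟨l, ?_⟩
            rw [h', h]
            exact hl.symm
        have : S (Sum.inr (x, i)) = true := decide_eq_true hS
        rw [this] at hSq
        cases hSq
    · intro p hp
      rcases p with d | p
      · cases hp
      · have hs : D.Survives c p.1 := of_decide_eq_true hp
        obtain ⟨j, h | h⟩ := hs p.2
        · exact ⟨j, Or.inl ((hQmem _ _).2 h)⟩
        · refine ⟨j, Or.inr ⟨Sum.inr (oppositeEnd p), (hQmem _ _).2 h, ?_⟩⟩
          show _ = Sum.inr (oppositeEnd (oppositeEnd p))
          rw [oppositeEnd_oppositeEnd]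
    · intro j p q hpq
      obtain ⟨a, b, rfl, rfl, hab⟩ := hcyc j p q hpq
      exact (hz₁ j _ _ hab).symm
    · rintro (d | p) hp
      · cases hp
      · have hs : D.Survives c p.1 := of_decide_eq_true hp
        refine (D.sum_sameCycle_inr p _).trans ?_
        exact hz₂ _ ((hasCrossing_linkCode hc).2 ⟨p.1, hs, rfl⟩)
  refine ⟨fun q => if hq : ∃ p, D.cross p = q then h (Sum.inr hq.choose) else 0, ?_, ?_⟩
  all_goals
    have hval : ∀ p : Fin D.m × ZMod 4,
        (if hq : ∃ p', D.cross p' = D.cross p then h (Sum.inr hq.choose) else 0) =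
          h (Sum.inr p) := by
      intro p
      have hq : ∃ p', D.cross p' = D.cross p := ⟨p, rfl⟩
      rw [dif_pos hq, D.cross_injective hq.choose_spec]
  · intro y hy i
    obtain ⟨x, hx, rfl⟩ := (hasCrossing_linkCode hc).1 hy
    refine (hval (x, i + 1)).trans ?_
    refine Eq.trans ?_ (congrArg (· + _) (hval (x, i)).symm)
    exact hh₁ (Sum.inr (x, i)) (by simpa [S] using hx)
  · intro j p q hpq
    rw [← hfilter j] at hpq
    unfold CycNext at hpq
    rw [← List.map_rotate, List.zip_map, List.mem_map] at hpq
    obtain ⟨⟨a, b⟩, hab, he⟩ := hpq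
    have hab' : CycNext ((Q j).filter S) a b := hab
    obtain ⟨a', b', rfl, rfl, -⟩ := hcyc j a b hab'
    simp only [Prod.map, Sum.elim_inr, Prod.mk.injEq] at he
    obtain ⟨rfl, rfl⟩ := he
    rw [← D.cross_oppositeEnd]
    refine (hval _).trans ?_
    refine Eq.trans ?_ (congrArg (· + _) (hval _).symm)
    exact hh₂ j _ _ hab'

/-- A diagram with at most five crossings, all of them virtual, is linkless. -/
theorem isLinkless_of_virtual [Fintype G.Dart] (hvirt : ∀ x, D.virt x = true) (hm : D.m ≤ 5) :
    D.IsLinkless := by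
  intro k c hc
  refine (isDiagram_linkCode hc).isTrivial_of_virtual (fun y hy => ?_) ?_
  · obtain ⟨x, -, rfl⟩ := (hasCrossing_linkCode hc).1 hy
    exact hvirt x
  · have hle : Nat.card (D.linkCode c).Ends ≤ Nat.card (Fin D.m × ZMod 4) := by
      have hex : ∀ q : (D.linkCode c).Ends, ∃ p : Fin D.m × ZMod 4, D.cross p = q.1 := by
        rintro ⟨⟨y, i⟩, hy⟩
        obtain ⟨x, -, rfl⟩ := (hasCrossing_linkCode hc).1 hy
        exact ⟨(x, i), rfl⟩
      choose f hf using hex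
      refine Nat.card_le_card_of_injective f fun a b h => Subtype.ext ?_
      rw [← hf a, ← hf b, h]
    have : Nat.card (Fin D.m × ZMod 4) = D.m * 4 := by
      rw [Nat.card_prod, Nat.card_eq_fintype_card, Nat.card_eq_fintype_card, Fintype.card_fin,
        ZMod.card]
    omega

/-- The classical crossings at which one component of a split link passes over the other one are
even in number. -/
theorem sum_classical_eq_zero {c : Fin 2 → Σ v : V, G.Walk v v} (hc : IsCycleLink c)
    (hs : (D.linkCode c).IsSplit) {a b : G.Dart → ZMod 2} {i j : Fin 2} (hij : i ≠ j)
    (ha : ∀ d, a d ≠ 0 ↔ d ∈ (c i).2.darts ∨ d.symm ∈ (c i).2.darts)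
    (hb : ∀ d, b d ≠ 0 ↔ d ∈ (c j).2.darts ∨ d.symm ∈ (c j).2.darts) :
    ∑ x with D.virt x = false, a (D.dartAt (x, 0)) * b (D.dartAt (x, 1)) = 0 := by
  classical
  have h := hs.overLinking_eq_zero hij
  have hval : ∀ t : ZMod 2, t = if t ≠ 0 then 1 else 0 := by decide
  have hover : (D.linkCode c).overCrossings i j =
      (fun x : Fin D.m => (⟨x.val, D.virt x⟩ : Crossing)) ''
        {x | D.virt x = false ∧ a (D.dartAt (x, 0)) ≠ 0 ∧ b (D.dartAt (x, 1)) ≠ 0} := by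
    have hopp : ∀ x i, D.dartAt (x, i + 2) = (D.dartAt (x, i)).symm :=
      fun x i => D.dartAt_oppositeEnd (x, i)
    have hstrand : ∀ l (x : Fin D.m) t, (D.linkCode c).Strand l (⟨x.val, D.virt x⟩, t) ↔
        D.Survives c x ∧ (D.dartAt (x, t) ∈ (c l).2.darts ∨
          (D.dartAt (x, t)).symm ∈ (c l).2.darts) := by
      intro l x t
      have h₁ := cross_mem_linkCode (D := D) hc (j := l) (p := (x, t))
      have h₂ := cross_mem_linkCode (D := D) hc (j := l) (p := (x, t + 2))
      simp only [cross] at h₁ h₂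
      unfold LinkCode.Strand
      simp only [oppositeEnd, h₁, h₂, hopp]
      tauto
    ext y
    simp only [LinkCode.overCrossings, Set.mem_ofPred_eq, Set.mem_image, ha, hb]
    constructor
    · rintro ⟨h₀, h₁, h₂⟩
      obtain ⟨x, hx, rfl⟩ := (hasCrossing_linkCode hc).1 h₁.hasCrossing
      rw [hstrand] at h₁ h₂
      exact ⟨x, ⟨h₀, h₁.2, h₂.2⟩, rfl⟩
    · rintro ⟨x, ⟨h₀, h₁, h₂⟩, rfl⟩
      have hx : D.Survives c x := by
        have : ∀ t : ZMod 4, t = 0 ∨ t = 1 ∨ t = 0 + 2 ∨ t = 1 + 2 := by decide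
        intro t
        rcases this t with rfl | rfl | rfl | rfl
        · exact ⟨i, by rw [hopp]; exact h₁⟩
        · exact ⟨j, by rw [hopp]; exact h₂⟩
        · exact ⟨i, by simp only [hopp, SimpleGraph.Dart.symm_symm]; exact h₁.symm⟩
        · exact ⟨j, by simp only [hopp, SimpleGraph.Dart.symm_symm]; exact h₂.symm⟩
      exact ⟨h₀, (hstrand _ _ _).2 ⟨hx, h₁⟩, (hstrand _ _ _).2 ⟨hx, h₂⟩⟩
  rw [LinkCode.overLinking, hover, Set.ncard_image_of_injective _ (fun x y h => by
    simpa [Fin.ext_iff] using (Crossing.mk.injEq .. ▸ h).1)] at h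
  refine Eq.trans ?_ h
  rw [Finset.sum_filter, Set.ncard_eq_toFinset_card', Finset.card_eq_sum_ones, Nat.cast_sum,
    Set.toFinset_ofPred, Finset.sum_filter]
  refine Finset.sum_congr rfl fun x _ => ?_
  rw [hval (a _), hval (b _)]
  by_cases h₀ : D.virt x = false <;> by_cases h₁ : a (D.dartAt (x, 0)) = 0 <;>
    by_cases h₂ : b (D.dartAt (x, 1)) = 0 <;> simp [h₀, h₁, h₂]

end VirtualDiagram

end LinkDiagram

/-! ### Certificates for intrinsic linking -/

/-- The mod 2 value of a truth value. -/
def bit (b : Bool) : ZMod 2 := if b then 1 else 0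

theorem bit_xor (a b : Bool) : bit (xor a b) = bit a + bit b := by revert a b; decide

theorem bit_and (a b : Bool) : bit (a && b) = bit a * bit b := by revert a b; decide

theorem bit_injective : Function.Injective bit := by unfold Function.Injective; decide

theorem bit_ne_zero {a : Bool} : bit a ≠ 0 ↔ a = true := by revert a; decide

/-- The sum mod 2 of truth values. -/
def xorSum {α : Type*} (l : List α) (f : α → Bool) : Bool := l.foldr (fun a b => xor (f a) b) false

theorem bit_xorSum {α : Type*} (l : List α) (f : α → Bool) :
    bit (xorSum l f) = (l.map fun a => bit (f a)).sum := by
  induction l with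
  | nil => rfl
  | cons a l ih => rw [List.map_cons, List.sum_cons, ← ih, ← bit_xor]; rfl

theorem bit_xorSum_range (n : ℕ) (f : ℕ → Bool) :
    bit (xorSum (List.range n) f) = ∑ i ∈ Finset.range n, bit (f i) := bit_xorSum _ _

/-- The edges of the walk from `x` to `y` through the points of a list. -/
def pathEdge (u v y : ℕ) : List ℕ → ℕ → Bool
  | [], x => (x.beq u && y.beq v) || (x.beq v && y.beq u)
  | z :: l, x => ((x.beq u && z.beq v) || (x.beq v && z.beq u)) || pathEdge u v y l z

/-- The edges of the closed walk through the points of a list. -/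
def cycleEdge : List ℕ → ℕ → ℕ → Bool
  | [], _, _ => false
  | x :: l, u, v => pathEdge u v x l x

theorem pathEdge_eq_true {u v y : ℕ} (l : List ℕ) (x : ℕ) : pathEdge u v y l x = true ↔
    (u, v) ∈ (x :: l).zip (l ++ [y]) ∨ (v, u) ∈ (x :: l).zip (l ++ [y]) := by
  induction l generalizing x with
  | nil =>
    simp only [pathEdge, Bool.or_eq_true, Bool.and_eq_true, Nat.beq_eq, List.nil_append,
      List.zip_cons_cons, List.zip_nil_left, List.mem_singleton, Prod.mk.injEq]
    grind
  | cons z l ih =>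
    simp only [pathEdge, Bool.or_eq_true, Bool.and_eq_true, Nat.beq_eq, ih, List.cons_append,
      List.zip_cons_cons, List.mem_cons, Prod.mk.injEq]
    grind

theorem cycleEdge_eq_true {l : List ℕ} {u v : ℕ} :
    cycleEdge l u v = true ↔ CycNext l u v ∨ CycNext l v u := by
  cases l with
  | nil => simp [cycleEdge, CycNext]
  | cons x l =>
    unfold CycNext
    rw [cycleEdge, pathEdge_eq_true, List.rotate_cons_succ, List.rotate_zero]

theorem cycleEdge_comm (l : List ℕ) (u v : ℕ) : cycleEdge l u v = cycleEdge l v u := by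
  rw [Bool.eq_iff_iff, cycleEdge_eq_true, cycleEdge_eq_true, or_comm]

/-- The bilinear form given by a list of pairs of cycles. -/
def cycleForm (T : List (List ℕ × List ℕ)) (u v u' v' : ℕ) : Bool :=
  xorSum T fun t => cycleEdge t.1 u v && cycleEdge t.2 u' v'

/-- The symmetrization of `cycleForm`. -/
def symCycleForm (T : List (List ℕ × List ℕ)) (u v u' v' : ℕ) : Bool :=
  xor (cycleForm T u v u' v') (cycleForm T u' v' u v)

theorem cycleForm_comm_left (T : List (List ℕ × List ℕ)) (u v u' v' : ℕ) :
    cycleForm T u v u' v' = cycleForm T v u u' v' := by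
  simp only [cycleForm, cycleEdge_comm _ u v]

theorem cycleForm_comm_right (T : List (List ℕ × List ℕ)) (u v u' v' : ℕ) :
    cycleForm T u v u' v' = cycleForm T u v v' u' := by
  simp only [cycleForm, cycleEdge_comm _ u' v']

theorem symCycleForm_comm_left (T : List (List ℕ × List ℕ)) (u v u' v' : ℕ) :
    symCycleForm T u v u' v' = symCycleForm T v u u' v' := by
  rw [symCycleForm, symCycleForm, cycleForm_comm_left T u v, cycleForm_comm_right T u' v' u v]

theorem symCycleForm_comm_right (T : List (List ℕ × List ℕ)) (u v u' v' : ℕ) :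
    symCycleForm T u v u' v' = symCycleForm T u v v' u' := by
  rw [symCycleForm, symCycleForm, cycleForm_comm_left T u' v' u v, cycleForm_comm_right T u v u' v']

/-- A number recording which pairs of cycles separate two edges. -/
def separationCode (T : List (List ℕ × List ℕ)) (u v u' v' : ℕ) : ℕ :=
  T.foldr (fun t n => 2 * n + (symCycleForm [t] u v u' v').toNat) 0

theorem separationCode_congr {T : List (List ℕ × List ℕ)} {a b c d a' b' c' d' : ℕ}
    (h : ∀ t ∈ T, symCycleForm [t] a b c d = symCycleForm [t] a' b' c' d') :
    separationCode T a b c d = separationCode T a' b' c' d' := by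
  induction T with
  | nil => rfl
  | cons t T ih =>
    unfold separationCode at ih ⊢
    rw [List.foldr_cons, List.foldr_cons, h t List.mem_cons_self,
      ih fun t ht => h t (List.mem_cons_of_mem _ ht)]

/-- Both sides are unchanged when an edge is reversed, so the check on the listed directions covers
all four cases. -/
theorem symCycleForm_eq_decide {es : List (ℕ × ℕ)} {T P : List (List ℕ × List ℕ)} {codes : List ℕ}
    (hcodes : ∀ e ∈ es, ∀ f ∈ es, symCycleForm T e.1 e.2 f.1 f.2 =
      decide (separationCode P e.1 e.2 f.1 f.2 ∈ codes)) {u v u' v' : ℕ}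
    (h : (u, v) ∈ es ∨ (v, u) ∈ es) (h' : (u', v') ∈ es ∨ (v', u') ∈ es) :
    symCycleForm T u v u' v' = decide (separationCode P u v u' v' ∈ codes) := by
  have hl : ∀ u v u' v', separationCode P u v u' v' = separationCode P v u u' v' :=
    fun u v u' v' => separationCode_congr fun t _ => symCycleForm_comm_left [t] u v u' v'
  have hr : ∀ u v u' v', separationCode P u v u' v' = separationCode P u v v' u' :=
    fun u v u' v' => separationCode_congr fun t _ => symCycleForm_comm_right [t] u v u' v'
  rcases h with h | h <;> rcases h' with h' | h'
  · have := hcodes _ h _ h'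
    exact this
  · rw [symCycleForm_comm_right T u v u' v', hr u v u' v']
    have := hcodes _ h _ h'
    exact this
  · rw [symCycleForm_comm_left T u v u' v', hl u v u' v']
    have := hcodes _ h _ h'
    exact this
  · rw [symCycleForm_comm_left T u v u' v', hl u v u' v',
      symCycleForm_comm_right T v u u' v', hr v u u' v']
    have := hcodes _ h _ h'
    exact this

/-- The list is a cycle of the graph with the edges `es` on the points `0, …, n - 1`. -/
def IsCycleList (n : ℕ) (es : List (ℕ × ℕ)) (l : List ℕ) : Prop :=
  3 ≤ l.length ∧ l.Nodup ∧ (∀ i ∈ l, i < n) ∧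
    (∀ p ∈ l.zip (l.rotate 1), p ∈ es ∨ p.swap ∈ es) ∧
    ∀ u ∈ List.range n, xorSum (List.range n) (cycleEdge l u) = false

instance (n : ℕ) (es : List (ℕ × ℕ)) (l : List ℕ) : Decidable (IsCycleList n es l) := by
  unfold IsCycleList; infer_instance

/-- A certificate for intrinsic linking of the graph with the edges `es` on the points
`0, …, n - 1`: a mod 2 quadratic form which is odd for every diagram and is a sum of linking
numbers of pairs of disjoint cycles. -/
structure LinkCertificate (n : ℕ) (es : List (ℕ × ℕ)) (T P : List (List ℕ × List ℕ)) : Prop where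
  cycles : ∀ t ∈ T ++ P, IsCycleList n es t.1 ∧ IsCycleList n es t.2
  disjoint : ∀ t ∈ P, ∀ i ∈ t.1, i ∉ t.2
  adjacent : ∀ u ∈ List.range n, ∀ v ∈ List.range n, ∀ w ∈ List.range n, v ≠ w →
    symCycleForm T u v u w = false
  odd : xor (xorSum (List.range n) fun u => xorSum (List.range n) fun v =>
      decide (u < v) && cycleForm T u v u v)
    (xorSum (List.range n) fun u => xorSum (List.range n) fun v => xorSum (List.range n) fun w =>
      decide (w < v) && cycleForm T u v u w) = true
  linking : ∀ e ∈ es, ∀ f ∈ es, symCycleForm T e.1 e.2 f.1 f.2 = cycleForm P e.1 e.2 f.1 f.2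

/-! ### Cycles of a graph from lists of vertices -/

section Walks

variable {V : Type*} {G : SimpleGraph V}

theorem exists_walk_of_zip (l : List V) (a b : V)
    (h : ∀ p ∈ (a :: l).zip (l ++ [b]), G.Adj p.1 p.2) :
    ∃ w : G.Walk a b, w.support = a :: (l ++ [b]) := by
  induction l generalizing a with
  | nil => exact ⟨.cons (h (a, b) (by simp)) .nil, rfl⟩
  | cons x l ih =>
    obtain ⟨w, hw⟩ := ih x fun p hp => h p (by
      rw [List.cons_append, List.zip_cons_cons]
      exact List.mem_cons_of_mem _ hp)
    exact ⟨.cons (h (a, x) (by simp)) w, by rw [SimpleGraph.Walk.support_cons, hw]; rfl⟩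

theorem exists_cycle_of_list (l : List V) (hl : l.Nodup) (hlen : 3 ≤ l.length)
    (h : ∀ p ∈ l.zip (l.rotate 1), G.Adj p.1 p.2) :
    ∃ c : Σ v : V, G.Walk v v, c.2.IsCycle ∧ (∀ v ∈ c.2.support, v ∈ l) ∧
      ∀ d : G.Dart, CycNext l d.fst d.snd ↔ d ∈ c.2.darts := by
  match l, hl, hlen, h with
  | a :: b :: c :: t, hl, _, h =>
    simp only [List.rotate_cons_succ, List.rotate_zero] at h
    obtain ⟨w, hw⟩ := exists_walk_of_zip (G := G) (b :: c :: t) a a h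
    refine ⟨⟨a, w⟩, ?_, ?_, ?_⟩
    · have h₁ : G.Adj a b := h (a, b) (by simp)
      have h₂ : G.Adj b c := h (b, c) (by simp)
      obtain ⟨w', hw'⟩ := exists_walk_of_zip (G := G) t c a fun p hp => h p (by
        simp only [List.cons_append, List.zip_cons_cons]
        exact List.mem_cons_of_mem _ (List.mem_cons_of_mem _ hp))
      -- Two explicit initial edges expose the path condition; length at least three keeps the first
      -- edge from recurring in the rest.
      have hww' : w = .cons h₁ (.cons h₂ w') := by
        apply SimpleGraph.Walk.ext_support
        rw [hw, SimpleGraph.Walk.support_cons, SimpleGraph.Walk.support_cons, hw']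
        rfl
      have hnd : (b :: c :: (t ++ [a])).Nodup := by
        have : (a :: b :: c :: t).rotate 1 = b :: c :: (t ++ [a]) := by
          simp [List.rotate_cons_succ]
        rw [← this, List.nodup_rotate]
        exact hl
      show w.IsCycle
      rw [hww', SimpleGraph.Walk.cons_isCycle_iff]
      constructor
      · rw [SimpleGraph.Walk.isPath_def, SimpleGraph.Walk.support_cons, hw']
        exact hnd
      · rw [SimpleGraph.Walk.edges_cons, List.mem_cons]
        rintro (h | h)
        · have : a = c := by
            have := Sym2.eq_iff.1 h
            rcases this with ⟨h, -⟩ | ⟨h, -⟩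
            · exact absurd h h₁.ne
            · exact h
          subst this
          simp at hl
        · have := w'.snd_mem_support_of_mem_edges h
          rw [hw'] at this
          exact (List.nodup_cons.1 hnd).1 this
    · intro v hv
      rw [hw] at hv
      simp only [List.mem_cons, List.mem_append, List.cons_append] at hv ⊢
      tauto
    · intro d
      have h₁ := w.cons_map_snd_darts
      have h₂ := w.map_fst_darts_append
      rw [hw] at h₁ h₂
      have h₃ : w.darts.map (·.fst) = a :: b :: c :: t := by
        rw [← List.cons_append] at h₂
        exact List.append_cancel_right h₂
      have h₄ : w.darts.map (·.snd) = (a :: b :: c :: t).rotate 1 := by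
        simpa [List.rotate_cons_succ] using h₁
      unfold CycNext
      rw [← h₄, ← h₃, List.zip_map']
      rw [List.mem_map]
      constructor
      · rintro ⟨e, he, h⟩
        have : e = d := by
          rw [Prod.mk.injEq] at h
          exact SimpleGraph.Dart.ext _ _ (Prod.ext h.1 h.2)
        exact this ▸ he
      · exact fun hd => ⟨d, hd, rfl⟩

end Walks

/-! ### From certificates to linked cycles -/

section Certificates

variable {V : Type*} {G : SimpleGraph V}

theorem sum_darts [Fintype V] [Fintype G.Dart] (F : V → V → ZMod 2)
    (hF : ∀ u v, ¬ G.Adj u v → F u v = 0) :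
    ∑ d : G.Dart, F d.fst d.snd = ∑ u, ∑ v, F u v := by
  rw [← Fintype.sum_prod_type' F]
  symm
  refine Finset.sum_bij_ne_zero (fun p _ hp => ⟨p, ?_⟩) ?_ ?_ ?_ ?_
  · by_contra h
    exact hp (hF _ _ h)
  · intros; exact Finset.mem_univ _
  · intro a _ ha b _ hb h
    exact congrArg SimpleGraph.Dart.toProd h
  · intro d _ hd
    exact ⟨d.toProd, Finset.mem_univ _, hd, rfl⟩
  · intros; rfl

/-- A numbering of the vertices of a graph with edge list `es`. -/
structure VertexNumbering (G : SimpleGraph V) (n : ℕ) (es : List (ℕ × ℕ)) where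
  key : V → ℕ
  point : ℕ → V
  key_lt : ∀ v, key v < n
  point_key : ∀ v, point (key v) = v
  key_point : ∀ i < n, key (point i) = i
  adj_iff : ∀ u v, G.Adj u v ↔ (key u, key v) ∈ es ∨ (key v, key u) ∈ es

namespace VertexNumbering

variable {n : ℕ} {es : List (ℕ × ℕ)} (ν : VertexNumbering G n es)

theorem sum_key [Fintype V] (f : ℕ → ZMod 2) : ∑ v, f (ν.key v) = ∑ i ∈ Finset.range n, f i := by
  refine Finset.sum_bij (fun v _ => ν.key v) ?_ ?_ ?_ ?_
  · exact fun v _ => Finset.mem_range.2 (ν.key_lt v)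
  · intro u _ v _ h
    rw [← ν.point_key u, ← ν.point_key v, h]
  · exact fun i hi => ⟨ν.point i, Finset.mem_univ _, ν.key_point i (Finset.mem_range.1 hi)⟩
  · intros; rfl

theorem key_injective : Function.Injective ν.key := fun u v h => by
  rw [← ν.point_key u, ← ν.point_key v, h]

/-- The mod 2 cycle on the darts given by a list of numbers of vertices. -/
def cycleFn (l : List ℕ) (d : G.Dart) : ZMod 2 := bit (cycleEdge l (ν.key d.fst) (ν.key d.snd))

variable {ν}

theorem adj_of_cycleEdge {l : List ℕ} (hl : IsCycleList n es l) {u v : V}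
    (h : cycleEdge l (ν.key u) (ν.key v) = true) : G.Adj u v := by
  rw [ν.adj_iff]
  rcases cycleEdge_eq_true.1 h with h | h
  · exact hl.2.2.2.1 _ h
  · exact (hl.2.2.2.1 _ h).symm

theorem cycleEdge_eq_false {l : List ℕ} (hl : IsCycleList n es l) {u v : V}
    (h : ¬ G.Adj u v) : cycleEdge l (ν.key u) (ν.key v) = false := by
  by_contra h'
  exact h (adj_of_cycleEdge hl (by simpa using h'))

theorem isEvenFunction_cycleFn [Fintype V] [DecidableEq V] [Fintype G.Dart] {l : List ℕ}
    (hl : IsCycleList n es l) :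
    IsEvenFunction (ν.cycleFn l) := by
  refine ⟨fun d => congrArg bit (cycleEdge_comm _ _ _), fun v => ?_⟩
  rw [Finset.sum_filter]
  refine (sum_darts (fun u w => if u = v then bit (cycleEdge l (ν.key u) (ν.key w)) else 0)
    fun u w h => ?_).trans ?_
  · rw [cycleEdge_eq_false hl h]
    exact ite_self _
  · rw [Finset.sum_eq_single v]
    · simp only [if_true]
      rw [ν.sum_key fun w => bit (cycleEdge l (ν.key v) w), ← bit_xorSum_range,
        hl.2.2.2.2 _ (List.mem_range.2 (ν.key_lt v))]
      rfl
    · intro u _ hu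
      simp [hu]
    · exact fun h => absurd (Finset.mem_univ _) h

theorem exists_cycle {l : List ℕ} (hl : IsCycleList n es l) :
    ∃ c : Σ v : V, G.Walk v v, c.2.IsCycle ∧ (∀ v ∈ c.2.support, ν.key v ∈ l) ∧
      ∀ d : G.Dart, ν.cycleFn l d ≠ 0 ↔ d ∈ c.2.darts ∨ d.symm ∈ c.2.darts := by
  have hmap : (l.map ν.point).map ν.key = l := by
    rw [List.map_map]
    refine (List.map_congr_left fun i hi => ?_).trans (List.map_id l)
    exact ν.key_point i (hl.2.2.1 i hi)
  obtain ⟨c, h₁, h₂, h₃⟩ := exists_cycle_of_list (G := G) (l.map ν.point)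
    (List.Nodup.of_map ν.key (hmap.symm ▸ hl.2.1)) (by simpa using hl.1) (by
      rintro ⟨u, v⟩ h
      have h' : CycNext (l.map ν.point) u v := h
      rw [← cycNext_map ν.key_injective, hmap] at h'
      exact adj_of_cycleEdge hl (cycleEdge_eq_true.2 (Or.inl h')))
  refine ⟨c, h₁, fun v hv => ?_, fun d => ?_⟩
  · obtain ⟨i, hi, rfl⟩ := List.mem_map.1 (h₂ v hv)
    rw [ν.key_point i (hl.2.2.1 i hi)]
    exact hi
  · rw [← h₃, ← h₃, cycleFn, bit_ne_zero, cycleEdge_eq_true]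
    conv_lhs => rw [← hmap]
    rw [cycNext_map ν.key_injective, cycNext_map ν.key_injective]
    rfl

variable (ν)

theorem bit_cycleForm (T : List (List ℕ × List ℕ)) (d e : G.Dart) :
    bit (cycleForm T (ν.key d.fst) (ν.key d.snd) (ν.key e.fst) (ν.key e.snd)) =
      ∑ i : Fin T.length, ν.cycleFn T[i].1 d * ν.cycleFn T[i].2 e := by
  rw [cycleForm, bit_xorSum]
  simp only [bit_and]
  exact (Fin.sum_univ_fun_getElem T _).symm

/-- The value of a form on the two edges that cross at `x`. -/
noncomputable def atCrossing (D : VirtualDiagram G) (F : ℕ → ℕ → ℕ → ℕ → Bool) (x : Fin D.m) :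
    Bool :=
  F (ν.key (D.dartAt (x, 0)).fst) (ν.key (D.dartAt (x, 0)).snd)
    (ν.key (D.dartAt (x, 1)).fst) (ν.key (D.dartAt (x, 1)).snd)

theorem bit_atCrossing_symCycleForm (D : VirtualDiagram G) (T : List (List ℕ × List ℕ))
    (x : Fin D.m) : bit (ν.atCrossing D (symCycleForm T) x) =
      ∑ i : Fin T.length, D.crossingForm (ν.cycleFn T[i].1) (ν.cycleFn T[i].2) x := by
  rw [atCrossing, symCycleForm, bit_xor, bit_cycleForm, bit_cycleForm, ← Finset.sum_add_distrib]
  rfl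

theorem bit_atCrossing_singleton (D : VirtualDiagram G) (t : List ℕ × List ℕ) (x : Fin D.m) :
    bit (ν.atCrossing D (symCycleForm [t]) x) =
      D.crossingForm (ν.cycleFn t.1) (ν.cycleFn t.2) x := by
  rw [bit_atCrossing_symCycleForm]
  exact Fin.sum_univ_one _

variable {ν}

theorem key_mem_of_cycleFn_ne_zero {l : List ℕ} {d : G.Dart} (h : ν.cycleFn l d ≠ 0) :
    ν.key d.fst ∈ l := by
  rcases cycleEdge_eq_true.1 (bit_ne_zero.1 h) with h | h
  · exact h.mem_left
  · exact h.mem_right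

theorem adj_iff_symm_mem (ν : VertexNumbering G n es) (d : G.Dart) :
    (ν.key d.fst, ν.key d.snd) ∈ es ∨ (ν.key d.snd, ν.key d.fst) ∈ es := (ν.adj_iff _ _).1 d.adj

end VertexNumbering

open VertexNumbering

namespace LinkCertificate

variable {n : ℕ} {es : List (ℕ × ℕ)} {T P : List (List ℕ × List ℕ)}

theorem cycleFn_mul_eq_zero (C : LinkCertificate n es T P) (ν : VertexNumbering G n es)
    {t : List ℕ × List ℕ} (ht : t ∈ P) {d e : G.Dart} (h : d.fst = e.fst) :
    ν.cycleFn t.1 d * ν.cycleFn t.2 e = 0 := by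
  by_contra h'
  have h₁ := key_mem_of_cycleFn_ne_zero (left_ne_zero_of_mul h')
  have h₂ := key_mem_of_cycleFn_ne_zero (right_ne_zero_of_mul h')
  rw [h] at h₁
  exact C.disjoint t ht _ h₁ h₂

theorem linking_of_mem (C : LinkCertificate n es T P) {u v u' v' : ℕ}
    (h : (u, v) ∈ es ∨ (v, u) ∈ es) (h' : (u', v') ∈ es ∨ (v', u') ∈ es) :
    symCycleForm T u v u' v' = cycleForm P u v u' v' := by
  rcases h with h | h <;> rcases h' with h' | h'
  · have := C.linking _ h _ h'
    exact this
  · rw [symCycleForm_comm_right T u v u' v', cycleForm_comm_right P u v u' v']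
    have := C.linking _ h _ h'
    exact this
  · rw [symCycleForm_comm_left T u v u' v', cycleForm_comm_left P u v u' v']
    have := C.linking _ h _ h'
    exact this
  · rw [symCycleForm_comm_left T u v u' v', cycleForm_comm_left P u v u' v',
      symCycleForm_comm_right T v u u' v', cycleForm_comm_right P v u u' v']
    have := C.linking _ h _ h'
    exact this

theorem linking_atCrossing (C : LinkCertificate n es T P) (ν : VertexNumbering G n es)
    (D : VirtualDiagram G) (x : Fin D.m) :
    ν.atCrossing D (symCycleForm T) x = ν.atCrossing D (cycleForm P) x :=
  C.linking_of_mem (ν.adj_iff_symm_mem _) (ν.adj_iff_symm_mem _)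

/-- The two sums are the mod 2 linking numbers of the first cycle over the second and conversely.
For virtual links they are independent invariants, and both vanish for a split link. -/
theorem sum_classical (C : LinkCertificate n es T P) (ν : VertexNumbering G n es)
    (D : VirtualDiagram G)
    (hsplit : ∀ c : Fin 2 → Σ v : V, G.Walk v v, IsCycleLink c → (D.linkCode c).IsSplit)
    {t : List ℕ × List ℕ} (ht : t ∈ P) :
    ∑ x with D.virt x = false,
      ν.cycleFn t.1 (D.dartAt (x, 0)) * ν.cycleFn t.2 (D.dartAt (x, 1)) = 0 ∧
    ∑ x with D.virt x = false,
      ν.cycleFn t.2 (D.dartAt (x, 0)) * ν.cycleFn t.1 (D.dartAt (x, 1)) = 0 := by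
  have hcyc := C.cycles t (List.mem_append_right _ ht)
  obtain ⟨c₁, h₁, h₁', h₁''⟩ := exists_cycle (ν := ν) hcyc.1
  obtain ⟨c₂, h₂, h₂', h₂''⟩ := exists_cycle (ν := ν) hcyc.2
  have hc : IsCycleLink ![c₁, c₂] := by
    have hd : ∀ v ∈ c₁.2.support, v ∉ c₂.2.support := fun v hv hv' =>
      C.disjoint t ht _ (h₁' v hv) (h₂' v hv')
    refine ⟨le_rfl, fun j => ?_, fun i j hij v hi hj => ?_⟩
    · fin_cases j
      · exact h₁
      · exact h₂
    · fin_cases i <;> fin_cases j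
      · exact hij rfl
      · exact hd v hi hj
      · exact hd v hj hi
      · exact hij rfl
  exact ⟨D.sum_classical_eq_zero hc (hsplit _ hc) (i := 0) (j := 1) (by decide) h₁'' h₂'',
    D.sum_classical_eq_zero hc (hsplit _ hc) (i := 1) (j := 0) (by decide) h₂'' h₁''⟩

/-- Oddness gives a pair in `P` whose first cycle contains the strand 0 and whose second contains
the strand 1. Not being separated by this pair, `x` also has the first cycle on strand 1, so the
cycles share an edge. -/
theorem false_of_single (C : LinkCertificate n es T P) (ν : VertexNumbering G n es)
    (D : VirtualDiagram G) {x : Fin D.m} (h₁ : bit (ν.atCrossing D (symCycleForm T) x) = 1)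
    (h₂ : ∀ t ∈ P, bit (ν.atCrossing D (symCycleForm [t]) x) = 0) : False := by
  rw [C.linking_atCrossing ν D, atCrossing, ν.bit_cycleForm] at h₁
  obtain ⟨i, -, hi⟩ := Finset.exists_ne_zero_of_sum_ne_zero (h₁.trans_ne one_ne_zero)
  have h₃ := h₂ P[i] (List.getElem_mem _)
  rw [ν.bit_atCrossing_singleton, VirtualDiagram.crossingForm] at h₃
  have h₄ : ν.cycleFn P[i].1 (D.dartAt (x, 1)) ≠ 0 := by
    intro h
    rw [h, zero_mul, add_zero] at h₃
    exact hi h₃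
  exact mul_ne_zero h₄ (right_ne_zero_of_mul hi)
    (C.cycleFn_mul_eq_zero ν (List.getElem_mem _) rfl)

variable [Fintype V] [DecidableEq V] [DecidableRel G.Adj]

/-- The condition `adjacent` makes the sum independent of the diagram. The constant is computed with
edges directed towards the larger number and ordered at each vertex by the number of the far end;
its value is the field `odd`. -/
theorem sum_symCycleForm (C : LinkCertificate n es T P) (ν : VertexNumbering G n es)
    (D : VirtualDiagram G) : ∑ x, bit (ν.atCrossing D (symCycleForm T) x) = 1 := by
  have hcyc : ∀ i : Fin T.length, IsCycleList n es T[i].1 ∧ IsCycleList n es T[i].2 := fun i =>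
    C.cycles _ (List.mem_append_left _ (List.getElem_mem _))
  have hzero : ∀ (a b c d : V), ¬ G.Adj a b →
      cycleForm T (ν.key a) (ν.key b) (ν.key c) (ν.key d) = false := by
    intro a b c d h
    apply bit_injective
    rw [cycleForm, bit_xorSum]
    refine List.sum_eq_zero fun y hy => ?_
    obtain ⟨t, ht, rfl⟩ := List.mem_map.1 hy
    rw [cycleEdge_eq_false (C.cycles t (List.mem_append_left _ ht)).1 h]
    rfl
  have hzero' : ∀ (a b c d : V), ¬ G.Adj c d →
      cycleForm T (ν.key a) (ν.key b) (ν.key c) (ν.key d) = false := by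
    intro a b c d h
    apply bit_injective
    rw [cycleForm, bit_xorSum]
    refine List.sum_eq_zero fun y hy => ?_
    obtain ⟨t, ht, rfl⟩ := List.mem_map.1 hy
    rw [cycleEdge_eq_false (C.cycles t (List.mem_append_left _ ht)).2 h, Bool.and_false]
    rfl
  simp only [ν.bit_atCrossing_symCycleForm]
  rw [D.sum_crossingForm_eq (o := fun d => ν.key d.fst < ν.key d.snd) (fun d => by
      have : ν.key d.fst ≠ ν.key d.snd := fun h => d.adj.ne (ν.key_injective h)
      show ν.key d.snd < ν.key d.fst ↔ _
      omega) (fun i => isEvenFunction_cycleFn (hcyc i).1)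
          (fun i => isEvenFunction_cycleFn (hcyc i).2)
    (pos' := fun d => ν.key d.snd) ?_ ?_]
  · simp only [← ν.bit_cycleForm]
    have h₁ : ∑ d : G.Dart with ν.key d.fst < ν.key d.snd,
        bit (cycleForm T (ν.key d.fst) (ν.key d.snd) (ν.key d.fst) (ν.key d.snd)) =
        bit (xorSum (List.range n) fun u => xorSum (List.range n) fun v =>
          decide (u < v) && cycleForm T u v u v) := by
      rw [Finset.sum_filter]
      refine (sum_darts (fun u v => if ν.key u < ν.key v then
        bit (cycleForm T (ν.key u) (ν.key v) (ν.key u) (ν.key v)) else 0) fun u v h => ?_).trans ?_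
      · rw [hzero _ _ _ _ h]
        exact ite_self _
      · rw [bit_xorSum_range, ← ν.sum_key]
        refine Finset.sum_congr rfl fun u _ => ?_
        rw [bit_xorSum_range, ← ν.sum_key]
        refine Finset.sum_congr rfl fun v _ => ?_
        by_cases h : ν.key u < ν.key v <;> simp [h, bit]
    have h₂ : ∑ d : G.Dart, ∑ y : G.Dart with y.fst = d.fst ∧ ν.key y.snd < ν.key d.snd,
        bit (cycleForm T (ν.key d.fst) (ν.key d.snd) (ν.key y.fst) (ν.key y.snd)) =
        bit (xorSum (List.range n) fun u => xorSum (List.range n) fun v =>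
          xorSum (List.range n) fun w => decide (w < v) && cycleForm T u v u w) := by
      have hin : ∀ d : G.Dart, ∑ y : G.Dart with y.fst = d.fst ∧ ν.key y.snd < ν.key d.snd,
          bit (cycleForm T (ν.key d.fst) (ν.key d.snd) (ν.key y.fst) (ν.key y.snd)) =
          ∑ w, bit (decide (ν.key w < ν.key d.snd) &&
            cycleForm T (ν.key d.fst) (ν.key d.snd) (ν.key d.fst) (ν.key w)) := by
        intro d
        rw [Finset.sum_filter]
        refine (sum_darts (fun u w => if u = d.fst ∧ ν.key w < ν.key d.snd then
          bit (cycleForm T (ν.key d.fst) (ν.key d.snd) (ν.key u) (ν.key w)) else 0)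
          fun u v h => ?_).trans ?_
        · rw [hzero' _ _ _ _ h]
          exact ite_self _
        · rw [Finset.sum_eq_single d.fst]
          · refine Finset.sum_congr rfl fun w _ => ?_
            by_cases h : ν.key w < ν.key d.snd <;> simp [h, bit]
          · intro u _ hu
            simp [hu]
          · exact fun h => absurd (Finset.mem_univ _) h
      simp only [hin]
      refine (sum_darts (fun u v => ∑ w, bit (decide (ν.key w < ν.key v) &&
            cycleForm T (ν.key u) (ν.key v) (ν.key u) (ν.key w))) fun u v h => ?_).trans ?_
      · refine Finset.sum_eq_zero fun w _ => ?_
        rw [hzero _ _ _ _ h, Bool.and_false]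
        rfl
      · rw [bit_xorSum_range, ← ν.sum_key]
        refine Finset.sum_congr rfl fun u _ => ?_
        rw [bit_xorSum_range, ← ν.sum_key]
        refine Finset.sum_congr rfl fun v _ => ?_
        rw [bit_xorSum_range, ← ν.sum_key]
    refine (congrArg₂ (· + ·) h₁ h₂).trans ?_
    rw [← bit_xor, C.odd]
    rfl
  · intro d e hde hne
    rw [Finset.sum_add_distrib, ← ν.bit_cycleForm, ← ν.bit_cycleForm, ← bit_xor]
    have := C.adjacent (ν.key d.fst) (List.mem_range.2 (ν.key_lt _)) (ν.key d.snd)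
      (List.mem_range.2 (ν.key_lt _)) (ν.key e.snd) (List.mem_range.2 (ν.key_lt _)) (fun h =>
        hne (SimpleGraph.Dart.ext _ _ (Prod.ext hde (ν.key_injective h))))
    rw [symCycleForm] at this
    rw [← hde, this]
    rfl
  · intro d e hde h
    exact SimpleGraph.Dart.ext _ _ (Prod.ext hde (ν.key_injective h))

/-- Two disjoint cycles cross evenly often: they share neither edges nor vertices, so every local
term of the intersection formula is zero. -/
theorem sum_separation (C : LinkCertificate n es T P) (ν : VertexNumbering G n es)
    (D : VirtualDiagram G) {t : List ℕ × List ℕ} (ht : t ∈ P) :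
    ∑ x, bit (ν.atCrossing D (symCycleForm [t]) x) = 0 := by
  have hcyc := C.cycles t (List.mem_append_right _ ht)
  have h := D.sum_crossingForm_eq (o := fun d => ν.key d.fst < ν.key d.snd) (fun d => by
      have : ν.key d.fst ≠ ν.key d.snd := fun h => d.adj.ne (ν.key_injective h)
      show ν.key d.snd < ν.key d.fst ↔ _
      omega) (ι := Unit) (β := fun _ => ν.cycleFn t.1) (z := fun _ => ν.cycleFn t.2)
    (fun i => isEvenFunction_cycleFn hcyc.1) (fun i => isEvenFunction_cycleFn hcyc.2)
    (pos' := fun d => ν.key d.snd) (fun d e hde _ => by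
      rw [C.cycleFn_mul_eq_zero ν ht hde, C.cycleFn_mul_eq_zero ν ht hde.symm]
      simp) (fun d e hde h => SimpleGraph.Dart.ext _ _ (Prod.ext hde (ν.key_injective h)))
  simp only [Finset.univ_unique, Finset.sum_singleton] at h
  simp only [ν.bit_atCrossing_singleton]
  rw [h, Finset.sum_eq_zero fun d _ => C.cycleFn_mul_eq_zero ν ht rfl, zero_add]
  refine Finset.sum_eq_zero fun d _ => Finset.sum_eq_zero fun y hy => ?_
  exact C.cycleFn_mul_eq_zero ν ht (Finset.mem_filter.1 hy).2.1.symm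

/-- The totals over all crossings are known, and `linking` turns the classical part for `T` into a
sum of linking numbers. For a single pair the classical part is the sum of its two linking numbers.
Both parts vanish. -/
theorem sum_virtual (C : LinkCertificate n es T P) (ν : VertexNumbering G n es)
    (D : VirtualDiagram G)
    (hsplit : ∀ c : Fin 2 → Σ v : V, G.Walk v v, IsCycleLink c → (D.linkCode c).IsSplit) :
    ∑ x with D.virt x = true, bit (ν.atCrossing D (symCycleForm T) x) = 1 ∧
    ∀ t ∈ P, ∑ x with D.virt x = true, bit (ν.atCrossing D (symCycleForm [t]) x) = 0 := by
  have split : ∀ f : Fin D.m → ZMod 2, ∑ x with D.virt x = true, f x =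
      ∑ x, f x + ∑ x with D.virt x = false, f x := by
    intro f
    rw [← Finset.sum_filter_add_sum_filter_not Finset.univ (fun x => D.virt x = true) f]
    simp only [Bool.not_eq_true]
    rw [add_assoc, CharTwo.add_self_eq_zero, add_zero]
  constructor
  · rw [split, C.sum_symCycleForm ν D, add_eq_left]
    simp only [C.linking_atCrossing ν D]
    unfold atCrossing
    simp only [ν.bit_cycleForm]
    rw [Finset.sum_comm]
    exact Finset.sum_eq_zero fun i _ =>
      (C.sum_classical ν D hsplit (List.getElem_mem _)).1
  · intro t ht
    rw [split, C.sum_separation ν D ht, zero_add]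
    simp only [ν.bit_atCrossing_singleton, VirtualDiagram.crossingForm]
    rw [Finset.sum_add_distrib, (C.sum_classical ν D hsplit ht).1, zero_add,
      ← (C.sum_classical ν D hsplit ht).2]
    exact Finset.sum_congr rfl fun x _ => mul_comm _ _

theorem exists_link (C : LinkCertificate n es T P) (ν : VertexNumbering G n es) (κ : LinkNotion)
    (D : VirtualDiagram G)
    (h : ∑ x with D.virt x = true, bit (ν.atCrossing D (symCycleForm T) x) = 1 →
      (∀ t ∈ P, ∑ x with D.virt x = true, bit (ν.atCrossing D (symCycleForm [t]) x) = 0) → False) :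
    ∃ (k : ℕ) (c : Fin k → Σ v : V, G.Walk v v), IsCycleLink c ∧ κ.Holds (D.linkCode c) := by
  by_contra! hcon
  obtain ⟨h₁, h₂⟩ := C.sum_virtual ν D fun c hc => by
    by_contra hs
    exact hcon 2 c hc (κ.holds_of_not_isSplit le_rfl hs)
  exact h h₁ h₂

theorem isIVL_one (C : LinkCertificate n es T P) (ν : VertexNumbering G n es) (κ : LinkNotion) :
    IsIVL κ 1 G := by
  intro D hD
  refine C.exists_link ν κ D fun h₁ h₂ => ?_
  have hcard : (Finset.univ.filter fun x => D.virt x = true).card ≤ 1 := hD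
  interval_cases hn : (Finset.univ.filter fun x => D.virt x = true).card
  · rw [Finset.card_eq_zero.1 hn, Finset.sum_empty] at h₁
    exact zero_ne_one h₁
  · obtain ⟨x, hx⟩ := Finset.card_eq_one.1 hn
    simp only [hx, Finset.sum_singleton] at h₁ h₂
    exact C.false_of_single ν D h₁ h₂

/-- Two virtual crossings are separated by the same pairs of `P`, hence have the same code, hence
the same value of the form. Their contributions cancel, whereas the sum must be 1. -/
theorem isIVL_two (C : LinkCertificate n es T P) (ν : VertexNumbering G n es) (κ : LinkNotion)
    (codes : List ℕ) (hcodes : ∀ e ∈ es, ∀ f ∈ es, symCycleForm T e.1 e.2 f.1 f.2 =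
      decide (separationCode P e.1 e.2 f.1 f.2 ∈ codes)) : IsIVL κ 2 G := by
  intro D hD
  refine C.exists_link ν κ D fun h₁ h₂ => ?_
  have hcard : (Finset.univ.filter fun x => D.virt x = true).card ≤ 2 := hD
  interval_cases hn : (Finset.univ.filter fun x => D.virt x = true).card
  · rw [Finset.card_eq_zero.1 hn, Finset.sum_empty] at h₁
    exact zero_ne_one h₁
  · obtain ⟨x, hx⟩ := Finset.card_eq_one.1 hn
    simp only [hx, Finset.sum_singleton] at h₁ h₂
    exact C.false_of_single ν D h₁ h₂
  · obtain ⟨x, y, hxy, hs⟩ := Finset.card_eq_two.1 hn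
    simp only [hs, Finset.sum_pair hxy] at h₁ h₂
    have hcode : ∀ x, ν.atCrossing D (symCycleForm T) x = decide (separationCode P
        (ν.key (D.dartAt (x, 0)).fst) (ν.key (D.dartAt (x, 0)).snd)
        (ν.key (D.dartAt (x, 1)).fst) (ν.key (D.dartAt (x, 1)).snd) ∈ codes) := fun x =>
      symCycleForm_eq_decide hcodes (ν.adj_iff_symm_mem _) (ν.adj_iff_symm_mem _)
    have hsep : ∀ t ∈ P, ν.atCrossing D (symCycleForm [t]) x =
        ν.atCrossing D (symCycleForm [t]) y :=
      fun t ht => bit_injective (zmod_two_add_eq_zero.1 (h₂ t ht))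
    have : ν.atCrossing D (symCycleForm T) x = ν.atCrossing D (symCycleForm T) y := by
      rw [hcode, hcode, separationCode_congr hsep]
    rw [this, CharTwo.add_self_eq_zero] at h₁
    exact zero_ne_one h₁

end LinkCertificate

end Certificates

/-! ### Certificates for the Petersen family -/

/-- The edges of `graphK6`. -/
def edgesK6 : List (ℕ × ℕ) :=
  [(0, 1), (0, 2), (0, 3), (0, 4), (0, 5), (1, 2), (1, 3), (1, 4), (1, 5), (2, 3), (2, 4), (2, 5),
   (3, 4), (3, 5), (4, 5)]

/-- The terms of the certificate for `graphK6`. -/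
def termsK6 : List (List ℕ × List ℕ) :=
  [([1, 4, 3, 5], [0, 2, 5, 3]), ([2, 4, 3, 5], [0, 1, 5, 3])]

/-- Pairs of disjoint cycles of `graphK6`. -/
def pairsK6 : List (List ℕ × List ℕ) :=
  [([0, 1, 2], [3, 4, 5]), ([0, 1, 3], [2, 4, 5]), ([2, 3, 5], [0, 1, 4]), ([2, 3, 4], [0, 1, 5]),
   ([0, 2, 3], [1, 4, 5]), ([1, 3, 5], [0, 2, 4]), ([1, 3, 4], [0, 2, 5]), ([1, 2, 5], [0, 3, 4]),
   ([1, 2, 4], [0, 3, 5]), ([1, 2, 3], [0, 4, 5])]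

/-- The pairs are the ten partitions of the vertices into two triangles. The order within each pair
matters, since it decides which triangle is counted as passing over. -/
theorem certificateK6 : LinkCertificate 6 edgesK6 termsK6 pairsK6 := by
  constructor <;> decide +kernel

/-- The separation codes of the odd pairs of edges of `graphK6`. -/
def codesK6 : List ℕ :=
  [5, 6, 9, 10, 33, 40, 48, 65, 68, 80, 130, 136, 144, 192, 258, 260, 272, 288]

theorem separationK6 : ∀ e ∈ edgesK6, ∀ f ∈ edgesK6,
    symCycleForm termsK6 e.1 e.2 f.1 f.2 =
      decide (separationCode pairsK6 e.1 e.2 f.1 f.2 ∈ codesK6) := by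
  decide +kernel

/-- The numbering of the vertices of `graphK6`. -/
def numberingK6 : VertexNumbering graphK6 6 edgesK6 where
  key v := v.val
  point := Fin.ofNat 6
  key_lt := by decide
  point_key := by decide
  key_point := by decide
  adj_iff := by
    simp only [graphK6, SimpleGraph.top_adj]
    decide +kernel

/-- The edges of `graphK331`. -/
def edgesK331 : List (ℕ × ℕ) :=
  [(0, 3), (0, 4), (0, 5), (1, 3), (1, 4), (1, 5), (2, 3), (2, 4), (2, 5), (0, 6), (1, 6), (2, 6),
   (3, 6), (4, 6), (5, 6)]

/-- The terms of the certificate for `graphK331`. -/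
def termsK331 : List (List ℕ × List ℕ) :=
  [([1, 3, 2, 4], [2, 3, 6, 5]), ([1, 3, 2, 5], [2, 3, 6, 4])]

/-- Pairs of disjoint cycles of `graphK331`. -/
def pairsK331 : List (List ℕ × List ℕ) :=
  [([2, 5, 6], [0, 3, 1, 4]), ([2, 4, 6], [0, 3, 1, 5]), ([1, 5, 6], [0, 3, 2, 4]),
   ([1, 4, 6], [0, 3, 2, 5]), ([1, 4, 2, 5], [0, 3, 6]), ([2, 3, 6], [0, 4, 1, 5]),
   ([1, 3, 6], [0, 4, 2, 5]), ([1, 3, 2, 5], [0, 4, 6]), ([1, 3, 2, 4], [0, 5, 6])]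

theorem certificateK331 : LinkCertificate 7 edgesK331 termsK331 pairsK331 := by
  constructor <;> decide +kernel

/-- The separation codes of the odd pairs of edges of `graphK331`. -/
def codesK331 : List ℕ :=
  [6, 9, 36, 40, 48, 65, 66, 80, 130, 136, 257, 260]

theorem separationK331 : ∀ e ∈ edgesK331, ∀ f ∈ edgesK331,
    symCycleForm termsK331 e.1 e.2 f.1 f.2 =
      decide (separationCode pairsK331 e.1 e.2 f.1 f.2 ∈ codesK331) := by
  decide +kernel

/-- The numbering of the vertices of `graphK331`. -/
def numberingK331 : VertexNumbering graphK331 7 edgesK331 where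
  key v := v.val
  point := Fin.ofNat 7
  key_lt := by decide
  point_key := by decide
  key_point := by decide
  adj_iff := by
    simp only [graphK331, SimpleGraph.fromEdgeSet_adj, Set.mem_insert_iff, Set.mem_singleton_iff]
    decide +kernel

/-- The edges of `graphG7`. -/
def edgesG7 : List (ℕ × ℕ) :=
  [(0, 3), (0, 4), (0, 5), (1, 3), (1, 4), (1, 5), (2, 3), (2, 4), (2, 5), (3, 4), (3, 5), (4, 5),
   (0, 6), (1, 6), (2, 6)]

/-- The terms of the certificate for `graphG7`. -/
def termsG7 : List (List ℕ × List ℕ) :=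
  [([0, 5, 1, 6], [0, 4, 2, 5]), ([0, 4, 1, 5], [0, 5, 2, 6])]

/-- Pairs of disjoint cycles of `graphG7`. -/
def pairsG7 : List (List ℕ × List ℕ) :=
  [([0, 3, 1, 6], [2, 4, 5]), ([0, 3, 2, 6], [1, 4, 5]), ([0, 3, 4], [1, 5, 2, 6]),
   ([0, 3, 5], [1, 4, 2, 6]), ([2, 3, 5], [0, 4, 1, 6]), ([1, 3, 5], [0, 4, 2, 6]),
   ([1, 3, 2, 6], [0, 4, 5]), ([2, 3, 4], [0, 5, 1, 6]), ([1, 3, 4], [0, 5, 2, 6])]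

theorem certificateG7 : LinkCertificate 7 edgesG7 termsG7 pairsG7 := by
  constructor <;> decide +kernel

/-- The separation codes of the odd pairs of edges of `graphG7`. -/
def codesG7 : List ℕ :=
  [17, 20, 34, 36, 68, 72, 129, 136, 160, 258, 264, 272]

theorem separationG7 : ∀ e ∈ edgesG7, ∀ f ∈ edgesG7,
    symCycleForm termsG7 e.1 e.2 f.1 f.2 =
      decide (separationCode pairsG7 e.1 e.2 f.1 f.2 ∈ codesG7) := by
  decide +kernel

/-- The numbering of the vertices of `graphG7`. -/
def numberingG7 : VertexNumbering graphG7 7 edgesG7 where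
  key v := v.val
  point := Fin.ofNat 7
  key_lt := by decide
  point_key := by decide
  key_point := by decide
  adj_iff := by
    simp only [graphG7, SimpleGraph.fromEdgeSet_adj, Set.mem_insert_iff, Set.mem_singleton_iff]
    decide +kernel

/-- The edges of `graphG8`. -/
def edgesG8 : List (ℕ × ℕ) :=
  [(0, 5), (1, 3), (1, 4), (1, 5), (2, 3), (2, 4), (2, 5), (3, 5), (4, 5), (0, 6), (1, 6), (2, 6),
   (0, 7), (3, 7), (4, 7)]

/-- The terms of the certificate for `graphG8`. -/
def termsG8 : List (List ℕ × List ℕ) :=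
  [([1, 3, 2, 4], [0, 5, 3, 2, 6]), ([1, 3, 2, 6], [2, 3, 5, 4])]

/-- Pairs of disjoint cycles of `graphG8`. -/
def pairsG8 : List (List ℕ × List ℕ) :=
  [([0, 5, 1, 6], [2, 3, 7, 4]), ([0, 5, 2, 6], [1, 3, 7, 4]), ([1, 4, 2, 6], [0, 5, 3, 7]),
   ([1, 3, 2, 6], [0, 5, 4, 7]), ([2, 4, 5], [0, 6, 1, 3, 7]), ([2, 3, 5], [0, 6, 1, 4, 7]),
   ([1, 4, 5], [0, 6, 2, 3, 7]), ([1, 3, 5], [0, 6, 2, 4, 7])]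

/-- No list of codes can accompany this certificate: `drawingG8` yields a linkless diagram with two
virtual crossings. -/
theorem certificateG8 : LinkCertificate 8 edgesG8 termsG8 pairsG8 := by
  constructor <;> decide +kernel

/-- The numbering of the vertices of `graphG8`. -/
def numberingG8 : VertexNumbering graphG8 8 edgesG8 where
  key v := v.val
  point := Fin.ofNat 8
  key_lt := by decide
  point_key := by decide
  key_point := by decide
  adj_iff := by
    simp only [graphG8, SimpleGraph.fromEdgeSet_adj, Set.mem_insert_iff, Set.mem_singleton_iff]
    decide +kernel

/-- The edges of `graphG9`. -/
def edgesG9 : List (ℕ × ℕ) :=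
  [(0, 5), (1, 4), (2, 3), (2, 4), (2, 5), (4, 5), (0, 6), (1, 6), (2, 6), (0, 7), (3, 7), (4, 7),
   (1, 8), (3, 8), (5, 8)]

/-- The terms of the certificate for `graphG9`. -/
def termsG9 : List (List ℕ × List ℕ) :=
  [([2, 3, 8, 5], [1, 4, 5, 8]), ([1, 6, 2, 5, 8], [3, 7, 4, 5, 8])]

/-- Pairs of disjoint cycles of `graphG9`. -/
def pairsG9 : List (List ℕ × List ℕ) :=
  [([1, 4, 7, 3, 8], [0, 5, 2, 6]), ([1, 6, 2, 3, 8], [0, 5, 4, 7]),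
   ([2, 3, 7, 4], [0, 5, 8, 1, 6]), ([1, 4, 2, 6], [0, 5, 8, 3, 7]),
   ([2, 3, 8, 5], [0, 6, 1, 4, 7]), ([2, 4, 5], [0, 6, 1, 8, 3, 7]),
   ([1, 4, 5, 8], [0, 6, 2, 3, 7])]

theorem certificateG9 : LinkCertificate 9 edgesG9 termsG9 pairsG9 := by
  constructor <;> decide +kernel

/-- The numbering of the vertices of `graphG9`. -/
def numberingG9 : VertexNumbering graphG9 9 edgesG9 where
  key v := v.val
  point := Fin.ofNat 9
  key_lt := by decide
  point_key := by decide
  key_point := by decide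
  adj_iff := by
    simp only [graphG9, SimpleGraph.fromEdgeSet_adj, Set.mem_insert_iff, Set.mem_singleton_iff]
    decide +kernel

/-- The edges of `graphPetersen`. -/
def edgesPetersen : List (ℕ × ℕ) :=
  [(0, 1), (1, 2), (2, 3), (3, 4), (4, 0), (0, 5), (1, 6), (2, 7), (3, 8), (4, 9), (5, 7), (7, 9),
   (9, 6), (6, 8), (8, 5)]

/-- The terms of the certificate for `graphPetersen`. -/
def termsPetersen : List (List ℕ × List ℕ) :=
  [([2, 3, 8, 5, 7], [0, 1, 6, 8, 5]), ([0, 4, 3, 8, 5], [5, 7, 9, 6, 8])]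

/-- Pairs of disjoint cycles of `graphPetersen`. -/
def pairsPetersen : List (List ℕ × List ℕ) :=
  [([0, 1, 2, 3, 4], [5, 7, 9, 6, 8]), ([0, 1, 2, 7, 5], [3, 4, 9, 6, 8]),
   ([2, 3, 8, 5, 7], [0, 1, 6, 9, 4]), ([0, 1, 6, 8, 5], [2, 3, 4, 9, 7]),
   ([1, 2, 7, 9, 6], [0, 4, 3, 8, 5]), ([1, 2, 3, 8, 6], [0, 4, 9, 7, 5])]

/-- The complement of every 5-cycle of the Petersen graph is a 5-cycle; these are the six resulting
pairs. -/
theorem certificatePetersen : LinkCertificate 10 edgesPetersen termsPetersen pairsPetersen := by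
  constructor <;> decide +kernel

/-- The numbering of the vertices of `graphPetersen`. -/
def numberingPetersen : VertexNumbering graphPetersen 10 edgesPetersen where
  key v := v.val
  point := Fin.ofNat 10
  key_lt := by decide
  point_key := by decide
  key_point := by decide
  adj_iff := by
    simp only [graphPetersen, SimpleGraph.fromEdgeSet_adj, Set.mem_insert_iff,
        Set.mem_singleton_iff]
    decide +kernel

/-- The edges of `graphK44e`. -/
def edgesK44e : List (ℕ × ℕ) :=
  [(0, 5), (0, 6), (0, 7), (1, 4), (1, 5), (1, 6), (1, 7), (2, 4), (2, 5), (2, 6), (2, 7), (3, 4),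
   (3, 5), (3, 6), (3, 7)]

/-- The terms of the certificate for `graphK44e`. -/
def termsK44e : List (List ℕ × List ℕ) :=
  [([1, 6, 2, 7], [1, 5, 3, 7]), ([1, 5, 2, 7], [1, 6, 3, 7])]

/-- Pairs of disjoint cycles of `graphK44e`. -/
def pairsK44e : List (List ℕ × List ℕ) :=
  [([2, 4, 3, 7], [0, 5, 1, 6]), ([2, 4, 3, 6], [0, 5, 1, 7]), ([1, 4, 3, 7], [0, 5, 2, 6]),
   ([1, 4, 3, 6], [0, 5, 2, 7]), ([1, 4, 2, 7], [0, 5, 3, 6]), ([1, 4, 2, 6], [0, 5, 3, 7]),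
   ([2, 4, 3, 5], [0, 6, 1, 7]), ([1, 4, 3, 5], [0, 6, 2, 7]), ([1, 4, 2, 5], [0, 6, 3, 7])]

theorem certificateK44e : LinkCertificate 8 edgesK44e termsK44e pairsK44e := by
  constructor <;> decide +kernel

/-- The separation codes of the odd pairs of edges of `graphK44e`. -/
def codesK44e : List ℕ :=
  [6, 9, 18, 24, 33, 36, 68, 72, 80, 96, 129, 130, 144, 160, 257, 258, 260, 264]

theorem separationK44e : ∀ e ∈ edgesK44e, ∀ f ∈ edgesK44e,
    symCycleForm termsK44e e.1 e.2 f.1 f.2 =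
      decide (separationCode pairsK44e e.1 e.2 f.1 f.2 ∈ codesK44e) := by
  decide +kernel

/-- The numbering of the vertices of `graphK44e`. -/
def numberingK44e : VertexNumbering graphK44e 8 edgesK44e where
  key := Sum.elim (fun i => i.val) fun j => j.val + 4
  point i := if h : i < 4 then Sum.inl ⟨i, h⟩ else Sum.inr (Fin.ofNat 4 (i - 4))
  key_lt := by decide
  point_key := by decide
  key_point := by decide
  adj_iff := by
    simp only [graphK44e, SimpleGraph.deleteEdges_adj, completeBipartiteGraph_adj,
      Set.mem_singleton_iff]
    decide +kernel

theorem isIVL_two_graphK6 (κ : LinkNotion) : IsIVL κ 2 graphK6 := by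
  classical
  exact certificateK6.isIVL_two numberingK6 κ codesK6 separationK6

theorem isIVL_two_graphK331 (κ : LinkNotion) : IsIVL κ 2 graphK331 := by
  classical
  exact certificateK331.isIVL_two numberingK331 κ codesK331 separationK331

theorem isIVL_two_graphG7 (κ : LinkNotion) : IsIVL κ 2 graphG7 := by
  classical
  exact certificateG7.isIVL_two numberingG7 κ codesG7 separationG7

theorem isIVL_one_graphG8 (κ : LinkNotion) : IsIVL κ 1 graphG8 := by
  classical
  exact certificateG8.isIVL_one numberingG8 κ

theorem isIVL_one_graphG9 (κ : LinkNotion) : IsIVL κ 1 graphG9 := by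
  classical
  exact certificateG9.isIVL_one numberingG9 κ

theorem isIVL_one_graphPetersen (κ : LinkNotion) : IsIVL κ 1 graphPetersen := by
  classical
  exact certificatePetersen.isIVL_one numberingPetersen κ

theorem isIVL_two_graphK44e (κ : LinkNotion) : IsIVL κ 2 graphK44e := by
  classical
  exact certificateK44e.isIVL_two numberingK44e κ codesK44e separationK44e

/-! ### Restriction of diagrams to subgraphs -/

/-- The first return map of a permutation to a part of its domain. -/
theorem exists_firstReturn {E F : Type*} [Finite E] (ρ : Equiv.Perm E) {φ : F → E}
    (hφ : Function.Injective φ) :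
    ∃ τ : Equiv.Perm F, (∀ d, ∃ n > 0, (ρ ^ n) (φ d) = φ (τ d) ∧
        ∀ m, 0 < m → m < n → (ρ ^ m) (φ d) ∉ Set.range φ) ∧
      ∀ d e, τ.SameCycle d e ↔ ρ.SameCycle (φ d) (φ e) := by
  classical
  have hF : Finite F := Finite.of_injective φ hφ
  have hex : ∀ d, ∃ n, 0 < n ∧ (ρ ^ n) (φ d) ∈ Set.range φ := fun d =>
    ⟨orderOf ρ, orderOf_pos ρ, d, by rw [pow_orderOf_eq_one]; rfl⟩
  have hτ : ∀ d, ∃ y, φ y = (ρ ^ Nat.find (hex d)) (φ d) := fun d => (Nat.find_spec (hex d)).2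
  choose τ hτ using hτ
  have hmin : ∀ d m, 0 < m → m < Nat.find (hex d) → (ρ ^ m) (φ d) ∉ Set.range φ :=
    fun d m h₀ h h' => Nat.find_min (hex d) h ⟨h₀, h'⟩
  have hinj : Function.Injective τ := by
    have key : ∀ d e, τ d = τ e → Nat.find (hex d) ≤ Nat.find (hex e) → d = e := by
      intro d e h hle
      have h₁ : (ρ ^ Nat.find (hex d)) (φ d) = (ρ ^ Nat.find (hex e)) (φ e) := by
        rw [← hτ, ← hτ, h]
      obtain ⟨k, hk⟩ := Nat.exists_eq_add_of_le hle
      rw [hk, pow_add, Equiv.Perm.mul_apply] at h₁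
      have h₂ := (ρ ^ Nat.find (hex d)).injective h₁
      -- A positive difference `k` of the return times would be an earlier return of `e`.
      rcases Nat.eq_zero_or_pos k with rfl | hk0
      · exact hφ h₂
      · have := Nat.find_spec (hex d)
        exact absurd ⟨d, h₂⟩ (hmin e k hk0 (by omega))
    intro d e h
    rcases le_total (Nat.find (hex d)) (Nat.find (hex e)) with hle | hle
    · exact key d e h hle
    · exact (key e d h.symm hle).symm
  let τ' : Equiv.Perm F := Equiv.ofBijective τ (Finite.injective_iff_bijective.1 hinj)
  refine ⟨τ', fun d => ⟨Nat.find (hex d), (Nat.find_spec (hex d)).1, (hτ d).symm, hmin d⟩,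
    fun d e => ⟨?_, ?_⟩⟩
  · intro h
    obtain ⟨n, rfl⟩ := h.exists_nat_pow_eq
    clear h
    induction n with
    | zero => exact Equiv.Perm.SameCycle.refl _ _
    | succ n ih =>
      refine ih.trans ?_
      rw [pow_succ', Equiv.Perm.mul_apply]
      exact ⟨Nat.find (hex ((τ' ^ n) d)), by rw [zpow_natCast]; exact (hτ _).symm⟩
  · intro h
    obtain ⟨n, hn⟩ := h.exists_nat_pow_eq
    clear h
    induction n using Nat.strong_induction_on generalizing d with
    | _ n ih =>
      rcases Nat.eq_zero_or_pos n with rfl | hn0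
      · rw [hφ hn]
      · have hle : Nat.find (hex d) ≤ n := Nat.find_min' (hex d) ⟨hn0, e, hn.symm⟩
        have hpos := (Nat.find_spec (hex d)).1
        have h₁ : τ'.SameCycle d (τ d) := ⟨1, by rw [zpow_one]; rfl⟩
        refine h₁.trans (ih (n - Nat.find (hex d)) (by omega) (τ d) ?_)
        rw [hτ, ← Equiv.Perm.mul_apply, ← pow_add, Nat.sub_add_cancel hle, hn]

theorem SimpleGraph.Hom.mapDart_injective {U W : Type*} {A : SimpleGraph U} {H : SimpleGraph W}
    {f : H →g A} (hf : Function.Injective f) : Function.Injective f.mapDart := by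
  intro d e h
  have h' := congrArg SimpleGraph.Dart.toProd h
  exact SimpleGraph.Dart.ext _ _ (Prod.ext (hf (congrArg Prod.fst h')) (hf (congrArg Prod.snd h')))

theorem SimpleGraph.Hom.mapDart_symm {U W : Type*} {A : SimpleGraph U} {H : SimpleGraph W}
    (f : H →g A) (d : H.Dart) : f.mapDart d.symm = (f.mapDart d).symm := rfl

namespace EdgeWords

variable {V : Type*} {G : SimpleGraph V} {m : ℕ} {D : EdgeWords G m} {d : G.Dart}

theorem seg_of_nil (h : D.word d = []) : D.Seg (Sum.inl d) (Sum.inl d.symm) :=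
  ⟨d, by simp [outEnds, inEnds, h]⟩

theorem seg_of_singleton {a : Fin m × ZMod 4} (h : D.word d = [a]) :
    D.Seg (Sum.inl d) (Sum.inr (oppositeEnd a)) ∧ D.Seg (Sum.inr a) (Sum.inl d.symm) :=
  ⟨⟨d, by simp [outEnds, inEnds, h]⟩, ⟨d, by simp [outEnds, inEnds, h]⟩⟩

/-- In a diagram whose edges have at most one crossing, the ends of a segment. -/
theorem seg_cases (hD : ∀ d, (D.word d).length ≤ 1) {p q : D.End} (h : D.Seg p q) :
    (∃ d, D.word d = [] ∧ p = Sum.inl d ∧ q = Sum.inl d.symm) ∨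
    ∃ d a, D.word d = [a] ∧ ((p = Sum.inl d ∧ q = Sum.inr (oppositeEnd a)) ∨
      (p = Sum.inr a ∧ q = Sum.inl d.symm)) := by
  obtain ⟨d, h⟩ := h
  unfold outEnds inEnds at h
  rcases hw : D.word d with _ | ⟨a, _ | ⟨b, l⟩⟩
  · rw [hw] at h
    simp at h
    exact Or.inl ⟨d, hw, h⟩
  · rw [hw] at h
    simp at h
    exact Or.inr ⟨d, a, hw, h⟩
  · have := hD d
    rw [hw] at this
    simp at this

end EdgeWords

namespace VirtualDiagram

variable {U W : Type*} {A : SimpleGraph U} {H : SimpleGraph W}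

/-- Both strands of the crossing `x` belong to the image of `f`. -/
def Kept (D : VirtualDiagram A) (f : H →g A) (x : Fin D.m) : Prop :=
  ∀ i, D.dartAt (x, i) ∈ Set.range f.mapDart

theorem dartAt_add_two (D : VirtualDiagram A) (x : Fin D.m) (i : ZMod 4) :
    D.dartAt (x, i + 2) = (D.dartAt (x, i)).symm := D.dartAt_oppositeEnd (x, i)

theorem mem_range_mapDart_symm {f : H →g A} {d : A.Dart} :
    d.symm ∈ Set.range f.mapDart ↔ d ∈ Set.range f.mapDart := by
  constructor
  · rintro ⟨e, he⟩
    exact ⟨e.symm, by rw [SimpleGraph.Hom.mapDart_symm, he, SimpleGraph.Dart.symm_symm]⟩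
  · rintro ⟨e, rfl⟩
    exact ⟨e.symm, rfl⟩

theorem not_mem_range_of_not_kept {D : VirtualDiagram A} {f : H →g A} {x : Fin D.m}
    (hx : ¬ D.Kept f x) {i : ZMod 4} (hi : D.dartAt (x, i) ∈ Set.range f.mapDart) :
    D.dartAt (x, i + 1) ∉ Set.range f.mapDart := by
  intro h
  apply hx
  have hdec : ∀ i j : ZMod 4, j = i ∨ j = i + 1 ∨ j = i + 2 ∨ j = i + 1 + 2 := by decide
  intro j
  rcases hdec i j with rfl | rfl | rfl | rfl
  · exact hi
  · exact h
  · rw [dartAt_add_two, mem_range_mapDart_symm]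
    exact hi
  · rw [dartAt_add_two, mem_range_mapDart_symm]
    exact h

section Restrict

variable (D : VirtualDiagram A) (f : H →g A) {m' : ℕ} (e : Fin m' ≃ {x // D.Kept f x})

open scoped Classical in
/-- The passages of an edge of the subgraph through the crossings that are kept. -/
noncomputable def restrictWord (d : H.Dart) : List (Fin m' × ZMod 4) :=
  (D.word (f.mapDart d)).filterMap fun p =>
    if h : D.Kept f p.1 then some (e.symm ⟨p.1, h⟩, p.2) else none

variable {D f e}

theorem mem_restrictWord {d : H.Dart} {a : Fin m' × ZMod 4} :
    a ∈ D.restrictWord f e d ↔ ((e a.1).1, a.2) ∈ D.word (f.mapDart d) := by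
  unfold restrictWord
  rw [List.mem_filterMap]
  constructor
  · rintro ⟨p, hp, h⟩
    split_ifs at h with hk
    obtain rfl := Option.some_injective _ h
    simpa using hp
  · intro h
    refine ⟨_, h, ?_⟩
    rw [dif_pos (e a.1).2]
    simp

theorem nodup_restrictWord (d : H.Dart) : (D.restrictWord f e d).Nodup := by
  refine (D.nodup_word _).filterMap fun p q b hp hq => ?_
  simp only [Option.mem_def] at hp hq
  split_ifs at hp with h₁
  split_ifs at hq with h₂
  have := (Option.some_injective _ hp).trans (Option.some_injective _ hq).symm
  simp only [Prod.mk.injEq, EmbeddingLike.apply_eq_iff_eq, Subtype.mk.injEq] at this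
  exact Prod.ext this.1 this.2

variable (D f e)

/-- The passages of the edges of a subgraph. -/
noncomputable def restrictWords (hf : Function.Injective f) : EdgeWords H m' where
  word := D.restrictWord f e
  word_symm d := by
    unfold restrictWord
    rw [SimpleGraph.Hom.mapDart_symm, D.word_symm, List.filterMap_map, List.filterMap_reverse,
      List.map_reverse, List.map_filterMap]
    congr 2
    funext p
    by_cases hp : D.Kept f p.1
    · simp [oppositeEnd, hp]
    · simp [oppositeEnd, hp]
  word_unique a := by
    obtain ⟨d, hd⟩ := (e a.1).2 a.2
    have hmem : a ∈ D.restrictWord f e d := by rw [mem_restrictWord, D.mem_word_iff, hd]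
    obtain ⟨n, hn⟩ := List.mem_iff_getElem?.1 hmem
    refine ⟨(d, n), hn, ?_⟩
    rintro ⟨d', n'⟩ hn'
    have hmem' : a ∈ D.restrictWord f e d' := List.mem_iff_getElem?.2 ⟨n', hn'⟩
    obtain rfl : d' = d := by
      rw [mem_restrictWord, D.mem_word_iff, ← hd] at hmem'
      exact (SimpleGraph.Hom.mapDart_injective hf hmem').symm
    obtain ⟨h₁, h₂⟩ := List.getElem?_eq_some_iff.1 hn
    obtain ⟨h₁', h₂'⟩ := List.getElem?_eq_some_iff.1 hn'
    exact Prod.ext rfl ((nodup_restrictWord d').getElem_inj_iff.1 (h₂'.trans h₂.symm))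

variable {D f e}

theorem restrictWord_of_nil {d : H.Dart} (h : D.word (f.mapDart d) = []) :
    D.restrictWord f e d = [] := by
  rw [restrictWord, h]
  rfl

theorem restrictWord_of_kept {d : H.Dart} {p : Fin D.m × ZMod 4}
    (h : D.word (f.mapDart d) = [p]) (hk : D.Kept f p.1) :
    D.restrictWord f e d = [(e.symm ⟨p.1, hk⟩, p.2)] := by
  rw [restrictWord, h]
  simp [hk]

theorem restrictWord_of_not_kept {d : H.Dart} {p : Fin D.m × ZMod 4}
    (h : D.word (f.mapDart d) = [p]) (hk : ¬ D.Kept f p.1) : D.restrictWord f e d = [] := by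
  rw [restrictWord, h]
  simp [hk]

/-- A cycle of the subdrawing extends by zero to the whole drawing, going straight through the
crossings that disappear. A colouring of the whole drawing then restricts. -/
theorem isPlanarMap_restrict [Finite U] (hshort : ∀ d, (D.word d).length ≤ 1)
    (hf : Function.Injective f) {τ : Equiv.Perm H.Dart}
    (hτ : ∀ d, ∃ n > 0, (D.vertexRot ^ n) (f.mapDart d) = f.mapDart (τ d) ∧
      ∀ m, 0 < m → m < n → (D.vertexRot ^ m) (f.mapDart d) ∉ Set.range f.mapDart)
    (hτ' : ∀ d e : H.Dart, τ.SameCycle d e ↔ d.fst = e.fst) :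
    IsPlanarMap (fun p q => q = mapRot m' τ p) (D.restrictWords f e hf).Seg := by
  classical
  have hinj := SimpleGraph.Hom.mapDart_injective hf
  have : Fintype U := Fintype.ofFinite U
  have : Fintype H.Dart := @Fintype.ofFinite _ (Finite.of_injective _ hinj)
  set ws := D.restrictWords f e hf with hws
  have hwshort : ∀ d, (ws.word d).length ≤ 1 := fun d =>
    (List.length_filterMap_le _ _).trans (hshort _)
  rw [isPlanarMap_iff_hasColorings (seg := ws.Seg) (mapRot m' τ)
    (fun _ _ => ws.seg_symm) ws.seg_irrefl ws.existsUnique_seg]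
  intro z hz₁ hz₂
  -- the values of the given cycle on the ends of the large diagram
  let y : A.Dart → ZMod 2 := fun δ => if h : ∃ d, f.mapDart d = δ then z (Sum.inl h.choose) else 0
  have hy : ∀ d, y (f.mapDart d) = z (Sum.inl d) := by
    intro d
    have h : ∃ d', f.mapDart d' = f.mapDart d := ⟨d, rfl⟩
    show dite _ _ _ = _
    rw [dif_pos h, hinj h.choose_spec]
  have hy0 : ∀ δ, δ ∉ Set.range f.mapDart → y δ = 0 := fun δ h => dif_neg h
  let zt : D.End → ZMod 2 := Sum.elim y fun p =>
    if h : D.Kept f p.1 then z (Sum.inr (e.symm ⟨p.1, h⟩, p.2)) else y (D.dartAt p)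
  have hzk : ∀ (a : Fin m' × ZMod 4), zt (Sum.inr ((e a.1).1, a.2)) = z (Sum.inr a) := by
    intro a
    show dite _ _ _ = _
    rw [dif_pos (e a.1).2]
    simp
  have hznk : ∀ p : Fin D.m × ZMod 4, ¬ D.Kept f p.1 → zt (Sum.inr p) = y (D.dartAt p) :=
    fun p hp => dif_neg hp
  -- The dropped crossing is the only one on its edge, so in the subdrawing this edge is a single
  -- segment with equal values at both ends.
  have hdropsymm : ∀ p : Fin D.m × ZMod 4, ¬ D.Kept f p.1 →
      y (D.dartAt p).symm = y (D.dartAt p) := by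
    intro p hp
    by_cases h : D.dartAt p ∈ Set.range f.mapDart
    · obtain ⟨d, hd⟩ := h
      rw [← hd, ← SimpleGraph.Hom.mapDart_symm, hy, hy]
      have hmem : p ∈ D.word (f.mapDart d) := by rw [D.mem_word_iff, hd]
      have hw : D.word (f.mapDart d) = [p] := by
        have := hshort (f.mapDart d)
        rcases hw : D.word (f.mapDart d) with _ | ⟨a, _ | ⟨b, l⟩⟩
        · rw [hw] at hmem
          cases hmem
        · rw [hw, List.mem_singleton] at hmem
          rw [hmem]
        · rw [hw] at this
          simp at this
      exact (hz₁ _ _ (ws.seg_of_nil (d := d) (restrictWord_of_not_kept hw hp))).symm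
    · rw [hy0 _ h, hy0 _ (fun h' => h (mem_range_mapDart_symm.1 h'))]
  obtain ⟨h, hh₁, hh₂⟩ := D.hasColorings zt (by
    intro p q hpq
    rcases D.words.seg_cases hshort hpq with ⟨δ, hw, rfl, rfl⟩ | ⟨δ, a, hw, hpq⟩
    · by_cases hδ : δ ∈ Set.range f.mapDart
      · obtain ⟨d, rfl⟩ := hδ
        show y _ = y _
        rw [← SimpleGraph.Hom.mapDart_symm, hy, hy]
        exact hz₁ _ _ (ws.seg_of_nil (d := d) (restrictWord_of_nil hw))
      · show y _ = y _
        rw [hy0 _ hδ, hy0 _ (fun h' => hδ (mem_range_mapDart_symm.1 h'))]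
    · have hδ : D.dartAt a = δ := by
        rw [← D.mem_word_iff]
        exact (show D.word δ = [a] from hw) ▸ List.mem_singleton_self a
      have hδ' : D.dartAt (oppositeEnd a) = δ.symm := by rw [D.dartAt_oppositeEnd, hδ]
      by_cases hk : D.Kept f a.1
      · obtain ⟨d, hd⟩ := hk a.2
        have hd' : f.mapDart d = δ := hd.trans hδ
        subst hd'
        have hw' := ws.seg_of_singleton (d := d) (restrictWord_of_kept (e := e) hw hk)
        have ha := hzk (e.symm ⟨a.1, hk⟩, a.2)
        have ha' := hzk (oppositeEnd (e.symm ⟨a.1, hk⟩, a.2))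
        simp only [Equiv.apply_symm_apply, oppositeEnd] at ha ha'
        rcases hpq with ⟨rfl, rfl⟩ | ⟨rfl, rfl⟩
        · refine (hy d).trans (((hz₁ _ _ hw'.1)).trans ?_)
          exact ha'.symm
        · refine ha.trans ((hz₁ _ _ hw'.2).trans ?_)
          exact (hy d.symm).symm
      · have h₁ := hdropsymm a hk
        rw [hδ] at h₁
        rcases hpq with ⟨rfl, rfl⟩ | ⟨rfl, rfl⟩
        · rw [hznk (oppositeEnd a) hk, hδ']
          exact h₁.symm
        · rw [hznk a hk, hδ]
          exact h₁.symm) (by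
    rintro (δ | p)
    · simp only [quot_perm_eq_iff]
      refine (D.sum_sameCycle_inl δ zt).trans ?_
      by_cases hδ : ∃ d : H.Dart, f d.fst = δ.fst
      · obtain ⟨d, hd⟩ := hδ
        have := hz₂ (Sum.inl d)
        simp only [quot_perm_eq_iff] at this
        rw [sum_sameCycle_mapRot_inl hτ'] at this
        rw [← this]
        symm
        refine Finset.sum_bij_ne_zero (fun d' _ _ => f.mapDart d') ?_ ?_ ?_ ?_
        · intro d' hd' _
          rw [Finset.mem_filter] at hd' ⊢
          exact ⟨Finset.mem_univ _, (congrArg f hd'.2).trans hd⟩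
        · intro a _ _ b _ _ hab
          exact hinj hab
        · intro δ' hδ' hne
          by_cases hr : δ' ∈ Set.range f.mapDart
          · obtain ⟨d', rfl⟩ := hr
            refine ⟨d', ?_, ?_, rfl⟩
            · rw [Finset.mem_filter] at hδ' ⊢
              exact ⟨Finset.mem_univ _, hf (hδ'.2.trans hd.symm)⟩
            · rw [← hy]
              exact hne
          · exact absurd (hy0 _ hr) hne
        · intro d' _ _
          exact (hy d').symm
      · refine Finset.sum_eq_zero fun δ' hδ' => hy0 _ ?_
        rintro ⟨d, rfl⟩
        exact hδ ⟨d, (Finset.mem_filter.1 hδ').2⟩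
    · simp only [quot_perm_eq_iff]
      refine (D.sum_sameCycle_inr p zt).trans ?_
      by_cases hk : D.Kept f p.1
      · have := hz₂ (Sum.inr (e.symm ⟨p.1, hk⟩, 0))
        simp only [quot_perm_eq_iff] at this
        rw [sum_sameCycle_mapRot_inr hτ'] at this
        rw [← this]
        refine Finset.sum_congr rfl fun i _ => ?_
        have := hzk (e.symm ⟨p.1, hk⟩, i)
        simpa using this
      · rw [sum_zmod_four, hznk (p.1, 0) hk, hznk (p.1, 1) hk, hznk (p.1, 2) hk, hznk (p.1, 3) hk]
        have h₀ := hdropsymm (p.1, 0) hk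
        have h₁ := hdropsymm (p.1, 1) hk
        rw [← dartAt_add_two, show (0 : ZMod 4) + 2 = 2 from rfl] at h₀
        rw [← dartAt_add_two, show (1 : ZMod 4) + 2 = 3 from rfl] at h₁
        rw [h₀, h₁]
        grind)
  have hρ : ∀ p, h (D.rot p) = h p + zt p := fun p => hh₁ p _ rfl
  refine ⟨Sum.elim (fun d => h (Sum.inl (f.mapDart d))) fun a => h (Sum.inr ((e a.1).1, a.2)),
    ?_, ?_⟩
  · rintro (d | a) _ rfl
    · obtain ⟨n, hn0, hn, hnot⟩ := hτ d
      have hpow : ∀ k : ℕ, (D.rot ^ k) (Sum.inl (f.mapDart d)) =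
          Sum.inl ((D.vertexRot ^ k) (f.mapDart d)) := by
        intro k
        induction k with
        | zero => rfl
        | succ k ih => rw [pow_succ', Equiv.Perm.mul_apply, ih, pow_succ']; rfl
      -- The edge ends skipped by the first return are outside the subgraph and do not change the
      -- colour.
      have := color_iterate (x := Sum.inl (f.mapDart d)) hρ hn0 fun k h₀ hk => by
        rw [hpow]
        exact hy0 _ (hnot k h₀ hk)
      rw [hpow, hn] at this
      refine this.trans ?_
      show _ + y _ = _
      rw [hy]
      rfl
    · refine (hρ (Sum.inr ((e a.1).1, a.2))).trans ?_
      rw [hzk]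
      rfl
  · intro p q hpq
    rcases ws.seg_cases hwshort hpq with ⟨d, hw, rfl, rfl⟩ | ⟨d, a, hw, hpq⟩
    · show h (Sum.inl (f.mapDart d).symm) = h (Sum.inl (f.mapDart d)) + z (Sum.inl d)
      rcases hw' : D.word (f.mapDart d) with _ | ⟨p, _ | ⟨b, l⟩⟩
      · rw [hh₂ _ _ (D.words.seg_of_nil hw')]
        show _ + y _ = _
        rw [hy]
      · have hp : D.dartAt p = f.mapDart d := by
          rw [← D.mem_word_iff, hw']
          exact List.mem_singleton_self p
        have hk : ¬ D.Kept f p.1 := by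
          intro hk
          have := restrictWord_of_kept (e := e) hw' hk
          rw [show D.restrictWord f e d = [] from hw] at this
          cases this
        -- At the dropped crossing the other strand carries zero. The two halves of the edge and the
        -- turn at the crossing change the colour three times by `z (Sum.inl d)`, which equals one
        -- change mod 2.
        have e₁ := hh₂ _ _ (D.words.seg_of_singleton hw').1
        have e₂ := hh₂ _ _ (D.words.seg_of_singleton hw').2
        have e₃ := hρ (Sum.inr p)
        have e₄ := hρ (Sum.inr (p.1, p.2 + 1))
        have e₅ : zt (Sum.inr (p.1, p.2 + 1)) = 0 := by
          rw [hznk (p.1, p.2 + 1) hk]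
          exact hy0 _ (not_mem_range_of_not_kept (i := p.2) hk ⟨d, hp.symm⟩)
        have e₆ : zt (Sum.inr p) = z (Sum.inl d) := by rw [hznk _ hk, hp, hy]
        have e₇ : zt (Sum.inl (f.mapDart d)) = z (Sum.inl d) := hy d
        rw [rot_inr] at e₃ e₄
        rw [e₅] at e₄
        rw [e₆] at e₂ e₃
        rw [e₇] at e₁
        have e₈ : ((p.1, p.2 + 1).1, (p.1, p.2 + 1).2 + 1) = oppositeEnd p := by
          simp only [oppositeEnd, add_assoc]
          rfl
        rw [e₈] at e₄
        grind
      · have := hshort (f.mapDart d)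
        rw [hw'] at this
        simp at this
    · have hmem : ((e a.1).1, a.2) ∈ D.word (f.mapDart d) := by
        rw [← mem_restrictWord (e := e), show D.restrictWord f e d = [a] from hw]
        exact List.mem_singleton_self a
      have hw' : D.word (f.mapDart d) = [((e a.1).1, a.2)] := by
        have := hshort (f.mapDart d)
        rcases hw' : D.word (f.mapDart d) with _ | ⟨b, _ | ⟨b', l⟩⟩
        · rw [hw'] at hmem
          cases hmem
        · rw [hw', List.mem_singleton] at hmem
          rw [hmem]
        · rw [hw'] at this
          simp at this
      rcases hpq with ⟨rfl, rfl⟩ | ⟨rfl, rfl⟩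
      · refine (hh₂ _ _ (D.words.seg_of_singleton hw').1).trans ?_
        exact congrArg (_ + ·) (hy d)
      · refine (hh₂ _ _ (D.words.seg_of_singleton hw').2).trans ?_
        exact congrArg (_ + ·) (hzk a)

end Restrict

/-- The restriction of a diagram to a subgraph; crossings with other edges disappear. -/
theorem exists_restrict [Finite U] (D : VirtualDiagram A) (hshort : ∀ d, (D.word d).length ≤ 1)
    (f : H →g A) (hf : Function.Injective f) :
    ∃ D' : VirtualDiagram H, D'.m = Nat.card {x // D.Kept f x} ∧
      ∀ x, ∃ x', D'.virt x = D.virt x' := by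
  have hinj := SimpleGraph.Hom.mapDart_injective hf
  have : Finite A.Dart :=
    Finite.of_injective SimpleGraph.Dart.toProd SimpleGraph.Dart.toProd_injective
  obtain ⟨τ, hτ, hsame⟩ := exists_firstReturn D.vertexRot hinj
  have hτ' : ∀ d e : H.Dart, τ.SameCycle d e ↔ d.fst = e.fst := fun d e => by
    rw [hsame, D.vertexRot_sameCycle]
    exact hf.eq_iff
  let e := (Finite.equivFin {x // D.Kept f x}).symm
  have hplanar := isPlanarMap_restrict (e := e) hshort hf hτ hτ'
  refine ⟨⟨_, fun x => D.virt (e x).1, τ, hτ', (D.restrictWords f e hf).word,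
    (D.restrictWords f e hf).word_symm, (D.restrictWords f e hf).word_unique, ?_⟩, rfl,
    fun x => ⟨_, rfl⟩⟩
  simp only [mapRot_eq_iff] at hplanar
  exact hplanar

end VirtualDiagram

/-! ### Drawings with at most one crossing on every edge -/

/-- A map whose Euler characteristic is large enough is planar. -/
theorem isPlanarMap_of_le {E : Type*} [Fintype E] (ρ : Equiv.Perm E) {seg : E → E → Prop}
    (hsymm : ∀ p q, seg p q → seg q p) (hirr : ∀ p, ¬ seg p p) (huniq : ∀ p, ∃! q, seg p q)
    {v f : ℕ} (hv : v ≤ Nat.card (Quot fun p q => q = ρ p))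
    (hf : f ≤ Nat.card (Quot fun p r => ∃ q, seg p q ∧ r = ρ q))
    (hc : ∀ p q, Quot.mk (fun p q => q = ρ p ∨ seg p q) p = Quot.mk _ q)
    (h : Nat.card E + 4 ≤ 2 * (v + f)) :
    IsPlanarMap (fun p q => q = ρ p) seg := by
  rw [isPlanarMap_iff_hasColorings ρ hsymm hirr huniq]
  obtain ⟨σ, rfl, hσ, hne⟩ := exists_involution hsymm hirr huniq
  simp only [exists_eq_left] at hf
  have h₁ : 2 * Nat.card (Quot fun p q => q = σ p) ≤ Nat.card E := by
    refine LinkCode.mul_card_quot_le fun p => ⟨![p, σ p], ?_, ?_⟩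
    · intro i j hij
      fin_cases i <;> fin_cases j
      · rfl
      · exact absurd hij.symm (hne p)
      · exact absurd hij (hne p)
      · rfl
    · intro i
      fin_cases i
      · rfl
      · exact ((quot_involution_eq_iff σ hσ p (σ p)).2 (Or.inr rfl)).symm
  have h₂ : Nat.card (Quot fun p q => q = ρ p ∨ q = σ p) ≤ 1 := by
    rw [Finite.card_le_one_iff_subsingleton]
    exact ⟨by rintro ⟨a⟩ ⟨b⟩; exact hc a b⟩
  exact hasColorings_of_le ρ σ hσ hne (by omega)

/-- The combinatorial data of a drawing with vertices `Fin n` and crossings `Fin m`. -/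
structure PlaneData (n m : ℕ) where
  /-- the neighbours of a vertex, in cyclic order -/
  rotation : Fin n → List (Fin n)
  /-- the endpoints of the two edges through a crossing, in cyclic order -/
  corner : Fin m → ZMod 4 → Fin n
  /-- the faces next to the edges at a vertex -/
  vertexFace : Fin n → List ℕ
  /-- the faces next to the ends at a crossing -/
  crossFace : Fin m → ZMod 4 → ℕ
  numFaces : ℕ
  root : Fin n

namespace PlaneData

variable {n m : ℕ} (P : PlaneData n m)

/-- The neighbour of `u` after `v`. -/
def next (u v : Fin n) : Fin n :=
  (P.rotation u).getD (((P.rotation u).idxOf v + 1) % (P.rotation u).length) v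

/-- The face next to the edge from `u` to `v`. -/
def dartFace (u v : Fin n) : ℕ := (P.vertexFace u).getD ((P.rotation u).idxOf v) 0

end PlaneData

/-- A connected plane drawing in which every edge has at most one crossing. -/
structure PlaneDrawing (n m : ℕ) extends PlaneData n m where
  mem_symm : ∀ u, ∀ v ∈ rotation u, u ∈ rotation v := by decide +kernel
  not_mem_self : ∀ u, u ∉ rotation u := by decide +kernel
  exists_mem : ∀ u, ∃ v, v ∈ rotation u := by decide +kernel
  next_mem : ∀ u, ∀ v ∈ rotation u, toPlaneData.next u v ∈ rotation u := by decide +kernel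
  next_injective : ∀ u, ∀ v ∈ rotation u, ∀ w ∈ rotation u,
    toPlaneData.next u v = toPlaneData.next u w → v = w := by decide +kernel
  next_transitive : ∀ u, ∀ v ∈ rotation u, ∀ w ∈ rotation u,
    ∃ k : Fin n, (toPlaneData.next u)^[k] v = w := by decide +kernel
  corner_adj : ∀ x i, corner x i ∈ rotation (corner x (i + 2)) := by decide +kernel
  corner_injective : ∀ x i y j, corner x i = corner y j → corner x (i + 2) = corner y (j + 2) →
    x = y ∧ i = j := by decide +kernel
  face_edge : ∀ u, ∀ v ∈ rotation u, (∀ x i, ¬ (corner x i = v ∧ corner x (i + 2) = u)) →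
    toPlaneData.dartFace v (toPlaneData.next v u) = toPlaneData.dartFace u v := by decide +kernel
  face_crossing : ∀ x i,
    crossFace x (i + 3) = toPlaneData.dartFace (corner x (i + 2)) (corner x i) ∧
    toPlaneData.dartFace (corner x i) (toPlaneData.next (corner x i) (corner x (i + 2))) =
      crossFace x i := by decide +kernel
  face_surjective : ∀ f < numFaces, ∃ u, ∃ v ∈ rotation u, toPlaneData.dartFace u v = f := by
    decide +kernel
  connected : ∀ v, ∃ a b, (a = root ∨ a ∈ rotation root) ∧ (b = a ∨ b ∈ rotation a) ∧
    (v = b ∨ v ∈ rotation b) := by decide +kernel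
  -- Twice Euler's inequality for one component: twice the number of segments is the total of the
  -- degrees plus `4 * m`, and there are `n + m` points.
  euler : ∑ u, (rotation u).length + 2 * m + 4 ≤ 2 * (n + numFaces) := by decide +kernel

namespace PlaneDrawing

variable {n m : ℕ} (P : PlaneDrawing n m)

/-- The graph of the drawing. -/
def graph : SimpleGraph (Fin n) where
  Adj u v := v ∈ P.rotation u
  symm.symm u v h := P.mem_symm u v h
  loopless.irrefl u := P.not_mem_self u

instance : DecidableRel P.graph.Adj := fun u v => inferInstanceAs (Decidable (v ∈ P.rotation u))

/-- The edge leaving the crossing `p.1` through its end `p.2`. -/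
def edgeAt (p : Fin m × ZMod 4) : P.graph.Dart :=
  ⟨(P.corner p.1 (p.2 + 2), P.corner p.1 p.2), P.corner_adj p.1 p.2⟩

theorem edgeAt_injective : Function.Injective P.edgeAt := by
  intro p q h
  have h' := congrArg SimpleGraph.Dart.toProd h
  obtain ⟨h₁, h₂⟩ := P.corner_injective p.1 p.2 q.1 q.2
    (congrArg Prod.snd h') (congrArg Prod.fst h')
  exact Prod.ext h₁ h₂

theorem edgeAt_oppositeEnd (p : Fin m × ZMod 4) : P.edgeAt (oppositeEnd p) = (P.edgeAt p).symm := by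
  refine SimpleGraph.Dart.ext _ _ (Prod.ext ?_ rfl)
  show P.corner p.1 (p.2 + 2 + 2) = P.corner p.1 p.2
  rw [add_assoc, show (2 + 2 : ZMod 4) = 0 from rfl, add_zero]

open scoped Classical in
/-- The crossing on an edge, if there is one. -/
noncomputable def edgeWord (d : P.graph.Dart) : List (Fin m × ZMod 4) :=
  if h : ∃ p, P.edgeAt p = d then [h.choose] else []

theorem edgeWord_edgeAt (p : Fin m × ZMod 4) : P.edgeWord (P.edgeAt p) = [p] := by
  have h : ∃ q, P.edgeAt q = P.edgeAt p := ⟨p, rfl⟩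
  rw [edgeWord, dif_pos h, P.edgeAt_injective h.choose_spec]

theorem edgeWord_eq_nil {d : P.graph.Dart} (h : ∀ p, P.edgeAt p ≠ d) : P.edgeWord d = [] :=
  dif_neg (by simpa using h)

theorem length_edgeWord (d : P.graph.Dart) : (P.edgeWord d).length ≤ 1 := by
  unfold edgeWord
  split_ifs <;> simp

theorem mem_edgeWord {d : P.graph.Dart} {p : Fin m × ZMod 4} :
    p ∈ P.edgeWord d ↔ P.edgeAt p = d := by
  constructor
  · intro h
    by_cases hd : ∃ q, P.edgeAt q = d
    · obtain ⟨q, rfl⟩ := hd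
      rw [edgeWord_edgeAt, List.mem_singleton] at h
      rw [h]
    · rw [P.edgeWord_eq_nil (not_exists.1 hd)] at h
      cases h
  · rintro rfl
    rw [edgeWord_edgeAt]
    exact List.mem_singleton_self p

/-- The crossings on the edges of the drawing. -/
noncomputable def words : EdgeWords P.graph m where
  word := P.edgeWord
  word_symm d := by
    by_cases hd : ∃ q, P.edgeAt q = d
    · obtain ⟨q, rfl⟩ := hd
      rw [← P.edgeAt_oppositeEnd, edgeWord_edgeAt, edgeWord_edgeAt]
      rfl
    · rw [P.edgeWord_eq_nil (not_exists.1 hd), P.edgeWord_eq_nil]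
      · rfl
      · intro p hp
        refine hd ⟨oppositeEnd p, ?_⟩
        rw [P.edgeAt_oppositeEnd, hp, SimpleGraph.Dart.symm_symm]
  word_unique p := by
    refine ⟨(P.edgeAt p, 0), by simp [edgeWord_edgeAt], ?_⟩
    rintro ⟨d, k⟩ h
    obtain rfl := P.mem_edgeWord.1 (List.mem_iff_getElem?.2 ⟨k, h⟩)
    have hk := (List.getElem?_eq_some_iff.1 h).1
    have := P.length_edgeWord (P.edgeAt p)
    exact Prod.ext rfl (show k = 0 by dsimp only at hk; omega)

/-- The next edge at a vertex. -/
def nextDart (d : P.graph.Dart) : P.graph.Dart :=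
  ⟨(d.fst, P.next d.fst d.snd), P.next_mem d.fst d.snd d.adj⟩

theorem nextDart_injective : Function.Injective P.nextDart := by
  rintro ⟨⟨u, v⟩, h⟩ ⟨⟨u', v'⟩, h'⟩ hd
  have hd := congrArg SimpleGraph.Dart.toProd hd
  obtain rfl : u = u' := congrArg Prod.fst hd
  obtain rfl := P.next_injective u v h v' h' (congrArg Prod.snd hd)
  rfl

/-- The rotation at the vertices. -/
noncomputable def vertexRot : Equiv.Perm P.graph.Dart :=
  Equiv.ofBijective P.nextDart (Finite.injective_iff_bijective.1 P.nextDart_injective)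

theorem vertexRot_apply (d : P.graph.Dart) : P.vertexRot d = P.nextDart d := rfl

theorem vertexRot_sameCycle (d e : P.graph.Dart) : P.vertexRot.SameCycle d e ↔ d.fst = e.fst := by
  constructor
  · intro h
    exact (eq_of_sameCycle (S := fun d : P.graph.Dart => d.fst) (fun _ => rfl) h).symm
  · rcases d with ⟨⟨u, v⟩, h⟩
    rcases e with ⟨⟨u', v'⟩, h'⟩
    rintro (rfl : u = u')
    obtain ⟨k, hk⟩ := P.next_transitive u v h v' h'
    have key : ∀ k : ℕ, ((P.vertexRot ^ k) ⟨(u, v), h⟩).toProd = (u, (P.next u)^[k] v) := by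
      intro k
      induction k with
      | zero => rfl
      | succ k ih =>
        rw [pow_succ', Equiv.Perm.mul_apply, Function.iterate_succ_apply', vertexRot_apply]
        generalize (P.vertexRot ^ k) ⟨(u, v), h⟩ = d at ih
        rcases d with ⟨⟨a, b⟩, hab⟩
        obtain ⟨rfl, rfl⟩ := Prod.mk.inj ih
        rfl
    refine ⟨(k : ℕ), ?_⟩
    rw [zpow_natCast]
    exact SimpleGraph.Dart.ext _ _ ((key k).trans (by rw [hk]))

/-- The face next to an end. -/
def endFace : P.words.End → ℕ :=
  Sum.elim (fun d => P.dartFace d.fst d.snd) fun p => P.crossFace p.1 p.2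

/-- Since the labels are constant along faces, distinct labels certify distinct faces; merged labels
would only weaken the bound. -/
theorem endFace_rot {p q : P.words.End} (h : P.words.Seg p q) :
    P.endFace (mapRot m P.vertexRot q) = P.endFace p := by
  rcases P.words.seg_cases P.length_edgeWord h with ⟨d, hw, rfl, rfl⟩ | ⟨d, a, hw, hpq⟩
  · refine P.face_edge d.fst d.snd d.adj fun x i hxi => ?_
    have : P.edgeAt (x, i) = d := SimpleGraph.Dart.ext _ _ (Prod.ext hxi.2 hxi.1)
    rw [← P.mem_edgeWord, show P.edgeWord d = [] from hw] at this
    cases this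
  · have hd : P.edgeAt a = d := by
      rw [← P.mem_edgeWord, show P.edgeWord d = [a] from hw]
      exact List.mem_singleton_self a
    subst hd
    rcases hpq with ⟨rfl, rfl⟩ | ⟨rfl, rfl⟩
    · refine Eq.trans ?_ (P.face_crossing a.1 a.2).1
      show P.crossFace a.1 (a.2 + 2 + 1) = _
      rw [add_assoc]
      rfl
    · exact (P.face_crossing a.1 a.2).2

theorem card_dart_le : Nat.card P.graph.Dart ≤ ∑ u, (P.rotation u).length := by
  rw [Nat.card_eq_fintype_card, SimpleGraph.dart_card_eq_sum_degrees]
  refine Finset.sum_le_sum fun u _ => ?_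
  refine (Finset.card_le_card (t := (P.rotation u).toFinset) fun v hv => ?_).trans
    (List.toFinset_card_le _)
  rw [SimpleGraph.mem_neighborFinset] at hv
  exact List.mem_toFinset.2 hv

/-- Only lower bounds are needed: points are counted by projecting the ends to them, faces by their
labels. Connectedness is traced to the root, entering each crossing from an edge through it. -/
theorem isPlanarMap_words :
    IsPlanarMap (fun p q => q = mapRot m P.vertexRot p) P.words.Seg := by
  refine isPlanarMap_of_le (v := n + m) (f := P.numFaces) _ (fun _ _ => P.words.seg_symm)
    P.words.seg_irrefl P.words.existsUnique_seg ?_ ?_ ?_ ?_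
  · let φ : (Quot fun p q : P.words.End => q = mapRot m P.vertexRot p) → Fin n ⊕ Fin m :=
      Quot.lift (Sum.map (fun d => d.fst) Prod.fst) (by rintro (d | p) _ rfl <;> rfl)
    have hφ : Function.Surjective φ := by
      rintro (u | x)
      · obtain ⟨v, hv⟩ := P.exists_mem u
        exact ⟨Quot.mk _ (Sum.inl ⟨(u, v), hv⟩), rfl⟩
      · exact ⟨Quot.mk _ (Sum.inr (x, 0)), rfl⟩
    have := Nat.card_le_card_of_surjective φ hφ
    rwa [Nat.card_sum, Nat.card_fin, Nat.card_fin] at this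
  · have hex : ∀ f : Fin P.numFaces, ∃ d : P.graph.Dart, P.endFace (Sum.inl d) = f := by
      intro f
      obtain ⟨u, v, hv, h⟩ := P.face_surjective f f.2
      exact ⟨⟨(u, v), hv⟩, h⟩
    choose d hd using hex
    let φ : (Quot fun p r : P.words.End => ∃ q, P.words.Seg p q ∧ r = mapRot m P.vertexRot q) → ℕ :=
      Quot.lift P.endFace (by rintro p _ ⟨q, hq, rfl⟩; exact (P.endFace_rot hq).symm)
    have := Nat.card_le_card_of_injective (fun f => (Quot.mk _ (Sum.inl (d f)) :
      Quot fun p r : P.words.End => ∃ q, P.words.Seg p q ∧ r = mapRot m P.vertexRot q)) (by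
        intro f g hfg
        have := congrArg φ hfg
        exact Fin.ext ((hd f).symm.trans (this.trans (hd g))))
    rwa [Nat.card_fin] at this
  · set r : P.words.End → P.words.End → Prop :=
      fun p q => q = mapRot m P.vertexRot p ∨ P.words.Seg p q with hr
    have hrot : ∀ p q, (mapRot m P.vertexRot).SameCycle p q → Quot.mk r p = Quot.mk r q := by
      intro p q h
      refine (eq_of_sameCycle (S := Quot.mk r) (fun p => ?_) h).symm
      exact (Quot.sound (show r p (mapRot m P.vertexRot p) from Or.inl rfl)).symm
    have hseg : ∀ p q, P.words.Seg p q → Quot.mk r p = Quot.mk r q :=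
      fun p q h => Quot.sound (Or.inr h)
    have hcross : ∀ p : Fin m × ZMod 4,
        Quot.mk r (Sum.inr p) = Quot.mk r (Sum.inl (P.edgeAt p).symm) := fun p =>
      hseg _ _ (P.words.seg_of_singleton (P.edgeWord_edgeAt p)).2
    have hdart : ∀ d : P.graph.Dart, Quot.mk r (Sum.inl d) = Quot.mk r (Sum.inl d.symm) := by
      intro d
      by_cases hd : ∃ p, P.edgeAt p = d
      · obtain ⟨p, rfl⟩ := hd
        rw [hseg _ _ (P.words.seg_of_singleton (P.edgeWord_edgeAt p)).1, ← hcross]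
        exact hrot _ _ ((sameCycle_mapRot_inr P.vertexRot_sameCycle).2 ⟨p.2, rfl⟩)
      · exact hseg _ _ (P.words.seg_of_nil (P.edgeWord_eq_nil (not_exists.1 hd)))
    have hvert : ∀ d e : P.graph.Dart, d.fst = e.fst →
        Quot.mk r (Sum.inl d) = Quot.mk r (Sum.inl e) := fun d e h =>
      hrot _ _ ((sameCycle_mapRot_inl P.vertexRot_sameCycle).2 ⟨e, rfl, h.symm⟩)
    have hadj : ∀ d e : P.graph.Dart, (e.fst = d.fst ∨ e.fst ∈ P.rotation d.fst) →
        Quot.mk r (Sum.inl d) = Quot.mk r (Sum.inl e) := by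
      rintro d e (h | h)
      · exact hvert d e h.symm
      · have hde : P.graph.Adj d.fst e.fst := h
        rw [hvert d ⟨(d.fst, e.fst), hde⟩ rfl, hdart]
        exact hvert _ _ rfl
    obtain ⟨v₀, hv₀⟩ := P.exists_mem P.root
    suffices hroot : ∀ p, Quot.mk r p = Quot.mk r (Sum.inl ⟨(P.root, v₀), hv₀⟩) from
      fun p q => (hroot p).trans (hroot q).symm
    have hroot : ∀ d, Quot.mk r (Sum.inl d) = Quot.mk r (Sum.inl ⟨(P.root, v₀), hv₀⟩) := by
      intro d
      obtain ⟨a, b, ha, hb, hv⟩ := P.connected d.fst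
      obtain ⟨a', ha'⟩ := P.exists_mem a
      obtain ⟨b', hb'⟩ := P.exists_mem b
      rw [hadj ⟨(P.root, v₀), hv₀⟩ ⟨(a, a'), ha'⟩ ha, hadj ⟨(a, a'), ha'⟩ ⟨(b, b'), hb'⟩ hb,
        hadj ⟨(b, b'), hb'⟩ d hv]
    rintro (d | p)
    · exact hroot d
    · rw [hcross]
      exact hroot _
  · have := P.card_dart_le
    have := P.euler
    rw [Nat.card_sum, Nat.card_prod, Nat.card_fin, Nat.card_zmod]
    omega

/-- The diagram in which all crossings of the drawing are virtual. -/
noncomputable def diagram : VirtualDiagram P.graph where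
  m := m
  virt _ := true
  vertexRot := P.vertexRot
  vertexRot_sameCycle := P.vertexRot_sameCycle
  word := P.edgeWord
  word_symm := P.words.word_symm
  word_unique := P.words.word_unique
  planar := by
    have h := P.isPlanarMap_words
    simp only [mapRot_eq_iff] at h
    exact h

theorem dartAt_diagram (p : Fin m × ZMod 4) : P.diagram.dartAt p = P.edgeAt p :=
  P.diagram.mem_word_iff.1 (P.mem_edgeWord.2 rfl)

/-- The crossing `x` remains when the graph `H` is placed on the drawing by `f`. -/
def Crosses {W : Type*} (H : SimpleGraph W) (f : W → Fin n) (x : Fin m) : Prop :=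
  ∀ i, ∃ w w', H.Adj w w' ∧ f w = P.corner x (i + 2) ∧ f w' = P.corner x i

/-- A subgraph of the graph of the drawing inherits a diagram with virtual crossings. -/
theorem exists_linkless {W : Type*} {H : SimpleGraph W} {f : W → Fin n}
    (hf : Function.Injective f) (hadj : ∀ w w', H.Adj w w' → f w' ∈ P.rotation (f w))
    (hm : m ≤ 5) :
    ∃ D : VirtualDiagram H, D.numVirtual = Nat.card {x // P.Crosses H f x} ∧ D.IsLinkless := by
  let F : H →g P.graph := ⟨f, fun {w w'} h => hadj w w' h⟩
  obtain ⟨D, hD, hv⟩ := P.diagram.exists_restrict P.length_edgeWord F hf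
  have hinj := SimpleGraph.Hom.mapDart_injective (f := F) hf
  have : Fintype H.Dart := @Fintype.ofFinite _ (Finite.of_injective _ hinj)
  have hvirt : ∀ x, D.virt x = true := fun x => (hv x).choose_spec
  have hiff : ∀ x, P.diagram.Kept F x ↔ P.Crosses H f x := by
    intro x
    refine forall_congr' fun i => ?_
    rw [show P.diagram.dartAt (x, i) = P.edgeAt (x, i) from P.dartAt_diagram (x, i)]
    constructor
    · rintro ⟨d, hd⟩
      have hd := congrArg SimpleGraph.Dart.toProd hd
      exact ⟨d.fst, d.snd, d.adj, congrArg Prod.fst hd, congrArg Prod.snd hd⟩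
    · rintro ⟨w, w', h, h₁, h₂⟩
      exact ⟨⟨(w, w'), h⟩, SimpleGraph.Dart.ext _ _ (Prod.ext h₁ h₂)⟩
  have hcard : D.m = Nat.card {x // P.Crosses H f x} :=
    hD.trans (Nat.card_congr (Equiv.subtypeEquivRight hiff))
  refine ⟨D, ?_, D.isLinkless_of_virtual hvirt ?_⟩
  · rw [← hcard, VirtualDiagram.numVirtual, Finset.filter_true_of_mem fun x _ => hvirt x,
      Finset.card_fin]
  · rw [hcard]
    refine (Finite.card_subtype_le _).trans ?_
    rwa [Nat.card_fin]

theorem exists_linkless_of_forall {W : Type*} {H : SimpleGraph W} {f : W → Fin n}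
    (hf : Function.Injective f) (hadj : ∀ w w', H.Adj w w' → f w' ∈ P.rotation (f w))
    (hm : m ≤ 5) (h : ∀ x, P.Crosses H f x) :
    ∃ D : VirtualDiagram H, D.numVirtual = m ∧ D.IsLinkless := by
  obtain ⟨D, h₁, h₂⟩ := P.exists_linkless hf hadj hm
  refine ⟨D, ?_, h₂⟩
  rw [h₁, Nat.card_congr (Equiv.subtypeUnivEquiv h), Nat.card_fin]

end PlaneDrawing

theorem VirtualDiagram.IsLinkless.not_isIVL {V : Type*} {G : SimpleGraph V} {D : VirtualDiagram G}
    (hD : D.IsLinkless) (κ : LinkNotion) {n : ℕ} (hn : D.numVirtual ≤ n) : ¬ IsIVL κ n G := by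
  intro h
  obtain ⟨k, c, hc, hκ⟩ := h D hn
  exact κ.not_holds_of_isTrivial hc.1 (hD k c hc) hκ

namespace PlaneDrawing

variable {n m : ℕ} (P : PlaneDrawing n m)

theorem not_isIVL {W : Type*} {H : SimpleGraph W} {f : W → Fin n}
    (hf : Function.Injective f) (hadj : ∀ w w', H.Adj w w' → f w' ∈ P.rotation (f w))
    (hm : m ≤ 5) (κ : LinkNotion) : ¬ IsIVL κ m H := by
  obtain ⟨D, h₁, h₂⟩ := P.exists_linkless hf hadj hm
  refine h₂.not_isIVL κ (h₁.trans_le ((Finite.card_subtype_le _).trans ?_))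
  rw [Nat.card_fin]

/-- If an edge through a crossing is missing, then fewer virtual crossings suffice. -/
theorem not_isIVL_of_missing {W : Type*} {H : SimpleGraph W} {f : W → Fin n}
    (hf : Function.Injective f) (hadj : ∀ w w', H.Adj w w' → f w' ∈ P.rotation (f w))
    (hm : m ≤ 5) (κ : LinkNotion) {x : Fin m} {i : ZMod 4}
    (h : ∀ w w', H.Adj w w' → ¬ (f w = P.corner x (i + 2) ∧ f w' = P.corner x i)) :
    ¬ IsIVL κ (m - 1) H := by
  obtain ⟨D, h₁, h₂⟩ := P.exists_linkless hf hadj hm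
  refine h₂.not_isIVL κ (h₁.trans_le (Nat.le_sub_one_of_lt ?_))
  have := Finite.card_subtype_lt (p := P.Crosses H f) (x := x) fun hx => by
    obtain ⟨w, w', h₁, h₂⟩ := hx i
    exact h w w' h₁ h₂
  rwa [Nat.card_fin] at this

end PlaneDrawing

/-! ### Drawings of the graphs of the Petersen family -/

/-- A drawing of `K_6`. -/
def drawingK6 : PlaneDrawing 6 3 where
  rotation :=
    ![[1, 2, 4, 5, 3], [0, 3, 5, 2, 4], [1, 3, 5, 4, 0], [0, 4, 5, 2, 1], [0, 1, 2, 5, 3],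
      [2, 1, 3, 0, 4]]
  corner := ![![0, 1, 2, 4], ![0, 4, 5, 3], ![1, 3, 5, 2]]
  vertexFace :=
    ![[0, 1, 2, 3, 4], [1, 0, 5, 6, 7], [7, 6, 8, 9, 10], [0, 4, 11, 12, 5], [3, 2, 10, 9, 13],
      [9, 8, 12, 11, 13]]
  crossFace := ![![2, 1, 7, 10], ![4, 3, 13, 11], ![6, 5, 12, 8]]
  numFaces := 14
  root := 0

/-- A drawing of `K_{3,3,1}`. -/
def drawingK331 : PlaneDrawing 7 3 where
  rotation :=
    ![[5, 4, 6, 3], [3, 6, 4, 5], [3, 4, 5, 6], [1, 2, 0, 6], [1, 6, 0, 2], [0, 2, 1, 6],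
      [0, 5, 4, 1, 3, 2]]
  corner := ![![0, 6, 3, 2], ![0, 5, 4, 6], ![1, 4, 5, 2]]
  vertexFace :=
    ![[0, 1, 2, 3], [4, 5, 6, 7], [8, 4, 9, 0], [5, 4, 8, 10], [7, 6, 11, 12], [1, 0, 9, 12],
      [3, 2, 11, 6, 5, 10]]
  crossFace := ![![0, 3, 10, 8], ![2, 1, 12, 11], ![4, 7, 12, 9]]
  numFaces := 13
  root := 6

/-- A drawing of `K_{4,4}` minus an edge. -/
def drawingK44e : PlaneDrawing 8 3 where
  rotation :=
    ![[5, 7, 6], [5, 6, 4, 7], [4, 6, 5, 7], [4, 7, 5, 6], [2, 3, 1], [0, 1, 3, 2], [0, 2, 3, 1],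
      [2, 0, 1, 3]]
  corner := ![![0, 5, 7, 2], ![1, 6, 4, 3], ![1, 3, 7, 5]]
  vertexFace :=
    ![[0, 1, 2], [3, 0, 4, 5], [6, 7, 2, 8], [9, 6, 10, 5], [7, 6, 9], [1, 0, 3, 11],
      [0, 2, 7, 4], [6, 8, 11, 10]]
  crossFace := ![![2, 1, 11, 8], ![5, 4, 7, 9], ![3, 5, 10, 11]]
  numFaces := 12
  root := 1

/-- A drawing of `G_7`. -/
def drawingG7 : PlaneDrawing 7 3 where
  rotation :=
    ![[3, 4, 5, 6], [4, 3, 6, 5], [3, 6, 5, 4], [0, 2, 1, 4, 5], [1, 5, 0, 3, 2],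
      [0, 3, 4, 1, 2], [0, 1, 2]]
  corner := ![![0, 3, 4, 5], ![1, 4, 3, 2], ![2, 6, 5, 1]]
  vertexFace :=
    ![[0, 1, 2, 3], [4, 5, 6, 7], [8, 0, 9, 6], [1, 0, 8, 10, 11], [5, 4, 12, 11, 10],
      [3, 2, 12, 4, 7], [0, 3, 9]]
  crossFace := ![![2, 1, 11, 12], ![6, 5, 10, 8], ![6, 9, 3, 7]]
  numFaces := 13
  root := 0

/-- A drawing of `G_8`. -/
def drawingG8 : PlaneDrawing 8 2 where
  rotation :=
    ![[6, 7, 5], [3, 6, 4, 5], [4, 6, 3, 5], [1, 5, 2, 7], [1, 7, 2, 5], [1, 4, 2, 0, 3],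
      [0, 2, 1], [0, 4, 3]]
  corner := ![![0, 3, 5, 2], ![1, 7, 6, 4]]
  vertexFace :=
    ![[0, 1, 2], [3, 4, 5, 6], [7, 8, 0, 9], [4, 3, 10, 2], [6, 5, 8, 7], [3, 6, 7, 9, 10],
      [1, 0, 8], [2, 1, 4]]
  crossFace := ![![0, 2, 10, 9], ![5, 4, 1, 8]]
  numFaces := 11
  root := 0

/-- A drawing of `G_9`. -/
def drawingG9 : PlaneDrawing 9 2 where
  rotation :=
    ![[5, 6, 7], [6, 8, 4], [3, 6, 5, 4], [2, 7, 8], [2, 1, 5, 7], [0, 4, 2, 8], [1, 2, 0],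
      [0, 3, 4], [1, 3, 5]]
  corner := ![![1, 5, 4, 2], ![0, 8, 6, 3]]
  vertexFace :=
    ![[0, 1, 2], [3, 4, 5], [6, 7, 3, 8], [7, 6, 2], [6, 8, 9, 0], [1, 0, 9, 5], [4, 3, 7],
      [0, 2, 6], [5, 4, 1]]
  crossFace := ![![3, 5, 9, 8], ![2, 1, 4, 7]]
  numFaces := 10
  root := 0

/-- A drawing of the Petersen graph. -/
def drawingPetersen : PlaneDrawing 10 2 where
  rotation :=
    ![[1, 4, 5], [0, 6, 2], [3, 1, 7], [2, 8, 4], [0, 9, 3], [7, 8, 0], [1, 8, 9], [2, 9, 5],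
      [5, 6, 3], [6, 7, 4]]
  corner := ![![1, 9, 2, 4], ![0, 3, 5, 8]]
  vertexFace :=
    ![[0, 1, 2], [1, 0, 3], [4, 5, 6], [5, 4, 2], [2, 1, 5], [4, 7, 8], [3, 0, 7], [4, 6, 7],
      [8, 7, 0], [3, 7, 6]]
  crossFace := ![![1, 3, 6, 5], ![0, 2, 4, 8]]
  numFaces := 9
  root := 0

/-! ### Proper minors -/

/-- Rotate the blocks `a, a + 1, a + 2` and `b, b + 1, b + 2` by `i` and `j` places. -/
def blockShift {n : ℕ} [NeZero n] (a b i j : ℕ) (v : Fin n) : Fin n :=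
  Fin.ofNat n (if a ≤ v.1 ∧ v.1 < a + 3 then a + (v.1 - a + i) % 3 else
    if b ≤ v.1 ∧ v.1 < b + 3 then b + (v.1 - b + j) % 3 else v.1)

namespace PlaneDrawing

variable {n m : ℕ}

/-- `g` is a symmetry of the drawn graph that takes the edge from `a` to `b` to an edge with a
crossing. -/
def MovesToCrossing (P : PlaneDrawing n m) (a b : Fin n) (g : Fin n → Fin n) : Prop :=
  (∀ u v, g u = g v → u = v) ∧ (∀ u, ∀ v ∈ P.rotation u, g v ∈ P.rotation (g u)) ∧
    ∃ x i, g a = P.corner x (i + 2) ∧ g b = P.corner x i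

instance (P : PlaneDrawing n m) (a b : Fin n) (g : Fin n → Fin n) :
    Decidable (P.MovesToCrossing a b g) := by
  unfold MovesToCrossing
  infer_instance

/-- Redrawing `H` by `g ∘ f` makes the missing edge a crossed one, so at least one crossing
disappears. -/
theorem not_isIVL_of_missing_edge (P : PlaneDrawing n m) (hm : m ≤ 5) (κ : LinkNotion)
    {W : Type*} {H : SimpleGraph W} {f : W → Fin n} (hf : Function.Injective f)
    (hadj : ∀ w w', H.Adj w w' → f w' ∈ P.rotation (f w)) {a b : Fin n}
    (hab : ∃ g, P.MovesToCrossing a b g) (h : ∀ w w', H.Adj w w' → ¬ (f w = a ∧ f w' = b)) :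
    ¬ IsIVL κ (m - 1) H := by
  obtain ⟨g, hg, hg', x, i, ha, hb⟩ := hab
  refine P.not_isIVL_of_missing (f := g ∘ f) (x := x) (i := i) (fun w w' e => hf (hg _ _ e))
    (fun w w' e => hg' _ _ (hadj w w' e)) hm κ fun w w' e hw => ?_
  exact h w w' e ⟨hg _ _ (hw.1.trans ha.symm), hg _ _ (hw.2.trans hb.symm)⟩

/-- `g` contracts the edge from `a` to `b` of the first drawn graph to a subgraph of the second one
in which an edge with a crossing is missing. -/
def ContractsTo {n' m' : ℕ} (P : PlaneDrawing n m) (Q : PlaneDrawing n' m') (a b : Fin n)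
    (g : Fin n → Fin n') : Prop :=
  g a = g b ∧ (∀ u v, g u = g v → u = v ∨ u = b ∨ v = b) ∧
    (∀ u, ∀ v ∈ P.rotation u, g u = g v ∨ g v ∈ Q.rotation (g u)) ∧
    ∃ x i, ∀ u, ∀ v ∈ P.rotation u, ¬ (g u = Q.corner x (i + 2) ∧ g v = Q.corner x i)

instance {n' m' : ℕ} (P : PlaneDrawing n m) (Q : PlaneDrawing n' m') (a b : Fin n)
    (g : Fin n → Fin n') : Decidable (P.ContractsTo Q a b g) := by
  unfold ContractsTo
  infer_instance

end PlaneDrawing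

/-! ### Symmetries and contractions of the four drawn graphs -/

theorem exists_movesToCrossing_drawingK6 : ∀ a b, a ≠ b →
    ∃ g, drawingK6.MovesToCrossing a b g := by
  -- The edge from 0 to 2 is crossed, and two transpositions carry any ordered pair to it.
  have h : ∀ a b : Fin 6, a ≠ b → ∃ p q : Fin 6,
      drawingK6.MovesToCrossing a b (Equiv.swap 0 p * Equiv.swap 2 q : Equiv.Perm (Fin 6)) := by
    decide +kernel
  intro a b hab
  obtain ⟨p, q, hpq⟩ := h a b hab
  exact ⟨_, hpq⟩

/-- Rotating the two blocks of three independently is transitive on the edges between the blocks and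
on the edges from either block to the vertex 6. Each of these types contains a crossed edge. -/
theorem exists_movesToCrossing_drawingK331 : ∀ a, ∀ b ∈ drawingK331.rotation a,
    ∃ g, drawingK331.MovesToCrossing a b g := by
  have h : ∀ a, ∀ b ∈ drawingK331.rotation a, ∃ i j : Fin 3,
      drawingK331.MovesToCrossing a b (blockShift 0 3 i j) := by
    decide +kernel
  intro a b hab
  obtain ⟨i, j, hij⟩ := h a b hab
  exact ⟨_, hij⟩

theorem exists_movesToCrossing_drawingG7 : ∀ a, ∀ b ∈ drawingG7.rotation a,
    ∃ g, drawingG7.MovesToCrossing a b g := by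
  have h : ∀ a, ∀ b ∈ drawingG7.rotation a, ∃ i j : Fin 3,
      drawingG7.MovesToCrossing a b (blockShift 0 3 i j) := by
    decide +kernel
  intro a b hab
  obtain ⟨i, j, hij⟩ := h a b hab
  exact ⟨_, hij⟩

theorem exists_movesToCrossing_drawingK44e : ∀ a, ∀ b ∈ drawingK44e.rotation a,
    ∃ g, drawingK44e.MovesToCrossing a b g := by
  have h : ∀ a, ∀ b ∈ drawingK44e.rotation a, ∃ i j : Fin 3,
      drawingK44e.MovesToCrossing a b (blockShift 1 5 i j) := by
    decide +kernel
  intro a b hab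
  obtain ⟨i, j, hij⟩ := h a b hab
  exact ⟨_, hij⟩

/-- Contractions of edges of `K_{4,4}` minus an edge to subgraphs of `K_{3,3,1}`. -/
def contractionsK44e : List (Fin 8 → Fin 7) :=
  [![0, 6, 1, 2, 3, 6, 4, 5], ![6, 3, 4, 5, 2, 6, 0, 1], ![2, 6, 0, 1, 6, 3, 4, 5]]

/-- Up to block rotations there are three types of edges, with one contraction listed for each. The
contracted edge becomes the vertex 6 of `K_{3,3,1}`. -/
theorem exists_contractsTo_drawingK44e : ∀ a, ∀ b ∈ drawingK44e.rotation a,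
    ∃ g, drawingK44e.ContractsTo drawingK331 a b g := by
  have h : ∀ a, ∀ b ∈ drawingK44e.rotation a, ∃ i j : Fin 3, ∃ g ∈ contractionsK44e,
      drawingK44e.ContractsTo drawingK331 a b (g ∘ blockShift 1 5 i j) := by
    decide +kernel
  intro a b hab
  obtain ⟨i, j, g, -, hij⟩ := h a b hab
  exact ⟨_, hij⟩

theorem graphK6_adj (u v : Fin 6) : graphK6.Adj u v ↔ v ∈ drawingK6.rotation u := by
  simp only [graphK6, SimpleGraph.top_adj]
  revert u v
  decide +kernel

theorem graphK331_adj (u v : Fin 7) : graphK331.Adj u v ↔ v ∈ drawingK331.rotation u := by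
  simp only [graphK331, SimpleGraph.fromEdgeSet_adj, Set.mem_insert_iff, Set.mem_singleton_iff]
  revert u v
  decide +kernel

theorem graphK44e_adj (u v : Fin 4 ⊕ Fin 4) : graphK44e.Adj u v ↔
    finSumFinEquiv v ∈ drawingK44e.rotation (finSumFinEquiv u) := by
  simp only [graphK44e, SimpleGraph.deleteEdges_adj, completeBipartiteGraph_adj,
    Set.mem_singleton_iff]
  revert u v
  decide +kernel

theorem graphG7_adj (u v : Fin 7) : graphG7.Adj u v ↔ v ∈ drawingG7.rotation u := by
  simp only [graphG7, SimpleGraph.fromEdgeSet_adj, Set.mem_insert_iff, Set.mem_singleton_iff]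
  revert u v
  decide +kernel

theorem graphG8_adj (u v : Fin 8) : graphG8.Adj u v ↔ v ∈ drawingG8.rotation u := by
  simp only [graphG8, SimpleGraph.fromEdgeSet_adj, Set.mem_insert_iff, Set.mem_singleton_iff]
  revert u v
  decide +kernel

theorem graphG9_adj (u v : Fin 9) : graphG9.Adj u v ↔ v ∈ drawingG9.rotation u := by
  simp only [graphG9, SimpleGraph.fromEdgeSet_adj, Set.mem_insert_iff, Set.mem_singleton_iff]
  revert u v
  decide +kernel

theorem graphPetersen_adj (u v : Fin 10) :
    graphPetersen.Adj u v ↔ v ∈ drawingPetersen.rotation u := by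
  simp only [graphPetersen, SimpleGraph.fromEdgeSet_adj, Set.mem_insert_iff,
    Set.mem_singleton_iff]
  revert u v
  decide +kernel

/-- Two distinct vertices of a connected subgraph force an edge in it. -/
theorem exists_adj_of_connected_induce {V : Type*} {G : SimpleGraph V} {S : Set V}
    (h : (G.induce S).Connected) {a b : V} (ha : a ∈ S) (hb : b ∈ S) (hab : a ≠ b) :
    ∃ c ∈ S, ∃ d ∈ S, G.Adj c d := by
  obtain ⟨p⟩ := h.preconnected ⟨a, ha⟩ ⟨b, hb⟩
  cases p with
  | nil => exact absurd rfl hab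
  | cons e _ => exact ⟨_, ha, _, Subtype.property _, e⟩

section Contraction

variable {V W : Type*} {B : W → Set V} {w₀ : W} {a b : V}

/-- Representatives of disjoint nonempty sets, one of which contains another element `b`. -/
theorem exists_representatives (hne : ∀ w, (B w).Nonempty)
    (hdisj : ∀ w w', w ≠ w' → Disjoint (B w) (B w')) (ha : a ∈ B w₀) (hb : b ∈ B w₀)
    (hab : a ≠ b) : ∃ r : W → V, (∀ w, r w ∈ B w) ∧ Function.Injective r ∧ r w₀ = a ∧
      ∀ w, r w ≠ b := by
  classical
  choose s hs using hne
  have hr : ∀ w, Function.update s w₀ a w ∈ B w := by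
    intro w
    by_cases hw : w = w₀
    · subst hw
      rwa [Function.update_self]
    · rw [Function.update_of_ne hw]
      exact hs w
  refine ⟨Function.update s w₀ a, hr, fun w w' h => ?_, Function.update_self .., fun w h => ?_⟩
  · by_contra hw
    exact Set.disjoint_left.1 (hdisj w w' hw) (hr w) (h ▸ hr w')
  · by_cases hw : w = w₀
    · subst hw
      rw [Function.update_self] at h
      exact hab h
    · exact Set.disjoint_left.1 (hdisj w w₀ hw) (h ▸ hr w) hb

theorem option_elim_injective {r : W → V} (hinj : Function.Injective r) (hrb : ∀ w, r w ≠ b) :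
    Function.Injective fun o : Option W => o.elim b r := by
  rintro (_ | w) (_ | w') h
  · rfl
  · exact absurd h.symm (hrb w')
  · exact absurd h (hrb w)
  · exact congrArg some (hinj h)

end Contraction

section Minor

variable {V W : Type*} {G : SimpleGraph V} {H : SimpleGraph W} {n m : ℕ}

/-- A proper subgraph of a drawn graph whose edges can all be moved to crossings. -/
theorem not_isIVL_of_proper_subgraph (P : PlaneDrawing n m) (hm : m ≤ 5) (ν : V ≃ Fin n)
    (hG : ∀ u v, G.Adj u v ↔ ν v ∈ P.rotation (ν u))
    (hP : ∀ a, ∀ b ∈ P.rotation a, ∃ g, P.MovesToCrossing a b g) (κ : LinkNotion)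
    {f : W → V} (hf : Function.Injective f) (hadj : ∀ w w', H.Adj w w' → G.Adj (f w) (f w'))
    (hiso : ¬ Nonempty (H ≃g G)) : ¬ IsIVL κ (m - 1) H := by
  obtain ⟨a, b, hab, h⟩ :
      ∃ a b, G.Adj a b ∧ ∀ w w', H.Adj w w' → ¬ (f w = a ∧ f w' = b) := by
    -- If every edge of `G` were used, `f` would be onto, since no vertex is isolated, and thus an
    -- isomorphism.
    by_contra! hcon
    have hsurj : Function.Surjective f := by
      intro v
      obtain ⟨u, hu⟩ := P.exists_mem (ν v)
      obtain ⟨w, w', -, hw, -⟩ := hcon v (ν.symm u) (by rwa [hG, Equiv.apply_symm_apply])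
      exact ⟨w, hw⟩
    refine hiso ⟨⟨Equiv.ofBijective f ⟨hf, hsurj⟩, fun {w w'} => ⟨fun h => ?_, hadj w w'⟩⟩⟩
    obtain ⟨u, u', huu, hu, hu'⟩ := hcon _ _ h
    rwa [hf hu, hf hu'] at huu
  refine P.not_isIVL_of_missing_edge hm κ (f := ν ∘ f) (ν.injective.comp hf)
    (fun w w' e => (hG _ _).1 (hadj w w' e)) (hP (ν a) (ν b) ((hG _ _).1 hab)) fun w w' e hw => ?_
  exact h w w' e ⟨ν.injective hw.1, ν.injective hw.2⟩

/-- Placed on the vertices of `K_6`, the graph misses some pair of vertices, and every edge of `K_6`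
can be moved to a crossing. -/
theorem not_isIVL_of_card_le_six [Finite W] (κ : LinkNotion) (hW : Nat.card W ≤ 6)
    (h : Nat.card W = 6 → ∃ w w', w ≠ w' ∧ ¬ H.Adj w w') : ¬ IsIVL κ 2 H := by
  obtain ⟨f, hf⟩ : ∃ f : W → Fin 6, Function.Injective f :=
    ⟨fun w => Fin.castLE hW (Finite.equivFin W w),
      (Fin.castLE_injective hW).comp (Finite.equivFin W).injective⟩
  have hK : ∀ u v : Fin 6, u ≠ v → v ∈ drawingK6.rotation u := by decide +kernel
  obtain ⟨a, b, hab, hmiss⟩ :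
      ∃ a b : Fin 6, a ≠ b ∧ ∀ w w', H.Adj w w' → ¬ (f w = a ∧ f w' = b) := by
    by_cases hs : Function.Surjective f
    · have hcard : Nat.card W = 6 := by
        rw [Nat.card_congr (Equiv.ofBijective f ⟨hf, hs⟩), Nat.card_fin]
      obtain ⟨w, w', hne, hw⟩ := h hcard
      refine ⟨f w, f w', hf.ne hne, fun u u' huu hu => hw ?_⟩
      rwa [← hf hu.1, ← hf hu.2]
    · rw [Function.Surjective] at hs
      push Not at hs
      obtain ⟨a, ha⟩ := hs
      have hne : ∀ a : Fin 6, a ≠ a + 1 := by decide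
      exact ⟨a, a + 1, hne a, fun w _ _ hw => ha w hw.1⟩
  exact drawingK6.not_isIVL_of_missing_edge (by norm_num) κ hf
    (fun w w' e => hK _ _ (hf.ne e.ne)) (exists_movesToCrossing_drawingK6 a b hab) hmiss

/-- Contracting an edge of a graph with fifteen edges does not give `K_6`. -/
theorem exists_not_adj_of_contraction (P : PlaneDrawing n m) (ν : V ≃ Fin n)
    (hG : ∀ u v, G.Adj u v ↔ ν v ∈ P.rotation (ν u)) (hdarts : Nat.card P.graph.Dart ≤ 30)
    {B : W → Set V} (hdisj : ∀ w w', w ≠ w' → Disjoint (B w) (B w'))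
    (hadj : ∀ w w', H.Adj w w' → ∃ u ∈ B w, ∃ v ∈ B w', G.Adj u v)
    {w₀ : W} {a b : V} (ha : a ∈ B w₀) (hb : b ∈ B w₀) (hab : G.Adj a b)
    (hW : Nat.card W = 6) : ∃ w w', w ≠ w' ∧ ¬ H.Adj w w' := by
  by_contra! hcon
  have : Finite W := Nat.finite_of_card_ne_zero (by omega)
  let e : Fin 6 ≃ W := (finCongr hW.symm).trans (Finite.equivFin W).symm
  have hedge : ∀ p : {p : Fin 6 × Fin 6 // p.1 ≠ p.2}, ∃ d : P.graph.Dart,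
      ν.symm d.fst ∈ B (e p.1.1) ∧ ν.symm d.snd ∈ B (e p.1.2) := by
    rintro ⟨⟨i, j⟩, hij⟩
    obtain ⟨u, hu, v, hv, huv⟩ := hadj _ _ (hcon (e i) (e j) (e.injective.ne hij))
    exact ⟨⟨(ν u, ν v), (hG _ _).1 huv⟩, by simpa using hu, by simpa using hv⟩
  choose d hd₁ hd₂ using hedge
  have huniq : ∀ {w w' v}, v ∈ B w → v ∈ B w' → w = w' := by
    intro w w' v hv hv'
    by_contra hw
    exact Set.disjoint_left.1 (hdisj w w' hw) hv hv'
  -- This dart stays inside one branch set, so it is unavailable for joining two different ones.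
  let d₀ : P.graph.Dart := ⟨(ν a, ν b), (hG _ _).1 hab⟩
  have hne : ∀ p, d p ≠ d₀ := by
    intro p hp
    have h₁ := hd₁ p
    have h₂ := hd₂ p
    rw [hp] at h₁ h₂
    have h₁ : a ∈ B (e p.1.1) := by simpa [d₀] using h₁
    have h₂ : b ∈ B (e p.1.2) := by simpa [d₀] using h₂
    exact p.2 (e.injective ((huniq h₁ ha).trans (huniq hb h₂)))
  have hinj : Function.Injective fun p => (⟨d p, hne p⟩ : {d // d ≠ d₀}) := by
    intro p q h
    have hpq : d p = d q := congrArg Subtype.val h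
    refine Subtype.ext (Prod.ext (e.injective ?_) (e.injective ?_))
    · exact huniq (hd₁ p) (hpq ▸ hd₁ q)
    · exact huniq (hd₂ p) (hpq ▸ hd₂ q)
  have h₁ := Nat.card_le_card_of_injective _ hinj
  have h₂ := Finite.card_subtype_lt (p := fun d => d ≠ d₀) (x := d₀) (by simp)
  have h₃ : Nat.card {p : Fin 6 × Fin 6 // p.1 ≠ p.2} = 30 := by
    rw [Nat.card_eq_fintype_card]
    decide +kernel
  omega

/-- A minor obtained by contracting a single edge, whose contraction is part of a drawn graph. -/
theorem not_isIVL_of_contractsTo {n' m' : ℕ} [Finite V] (P : PlaneDrawing n m)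
    (Q : PlaneDrawing n' m') (hm : m' ≤ 5) (ν : V ≃ Fin n)
    (hG : ∀ u v, G.Adj u v ↔ ν v ∈ P.rotation (ν u)) (κ : LinkNotion)
    {B : W → Set V} (hdisj : ∀ w w', w ≠ w' → Disjoint (B w) (B w'))
    (hadj : ∀ w w', H.Adj w w' → ∃ u ∈ B w, ∃ v ∈ B w', G.Adj u v)
    {w₀ : W} {a b : V} (hb : b ∈ B w₀) {r : W → V} (hr : ∀ w, r w ∈ B w)
    (hinj : Function.Injective r) (hr₀ : r w₀ = a) (hrb : ∀ w, r w ≠ b)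
    (hW : Nat.card V ≤ Nat.card W + 1) (hab : ∃ g, P.ContractsTo Q (ν a) (ν b) g) :
    ¬ IsIVL κ (m' - 1) H := by
  obtain ⟨g, hg, hg', hadj', x, i, hx⟩ := hab
  have : Finite W := Finite.of_injective r hinj
  have huniq : ∀ {w w' v}, v ∈ B w → v ∈ B w' → w = w' := by
    intro w w' v hv hv'
    by_contra hw
    exact Set.disjoint_left.1 (hdisj w w' hw) hv hv'
  -- By counting, the representatives together with `b` exhaust the vertices, so only the edge from
  -- `a` to `b` is contracted and nothing is deleted.
  have hsurj : Function.Surjective fun o : Option W => o.elim b r := by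
    refine ((option_elim_injective hinj hrb).bijective_of_nat_card_le ?_).2
    rwa [Finite.card_option]
  have hrep : ∀ w, ∀ u ∈ B w, g (ν u) = g (ν (r w)) := by
    intro w u hu
    obtain ⟨_ | w', rfl⟩ := hsurj u
    · obtain rfl := huniq hb hu
      rw [hr₀, hg]
      rfl
    · obtain rfl := huniq (hr w') hu
      rfl
  have hf : Function.Injective fun w => g (ν (r w)) := by
    intro w w' h
    rcases hg' _ _ h with h | h | h
    · exact hinj (ν.injective h)
    · exact absurd (ν.injective h) (hrb w)
    · exact absurd (ν.injective h) (hrb w')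
  refine Q.not_isIVL_of_missing hf (fun w w' e => ?_) hm κ (x := x) (i := i) fun w w' e hw => ?_
  · obtain ⟨u, hu, v, hv, huv⟩ := hadj w w' e
    rcases hadj' (ν u) (ν v) ((hG _ _).1 huv) with h | h
    · rw [hrep w u hu, hrep w' v hv] at h
      exact absurd (hf h) e.ne
    · rwa [hrep w u hu, hrep w' v hv] at h
  · obtain ⟨u, hu, v, hv, huv⟩ := hadj w w' e
    refine hx (ν u) (ν v) ((hG _ _).1 huv) ?_
    rwa [hrep w u hu, hrep w' v hv]

/-- Minor-minimality of a drawn graph with at most fifteen edges. -/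
theorem isMinorMinimalIVL_of_drawing (P : PlaneDrawing n 3) (ν : V ≃ Fin n)
    (hG : ∀ u v, G.Adj u v ↔ ν v ∈ P.rotation (ν u)) (hdarts : Nat.card P.graph.Dart ≤ 30)
    (hP : ∀ a, ∀ b ∈ P.rotation a, ∃ g, P.MovesToCrossing a b g)
    (hn : n ≤ 7 ∨ n = 8 ∧
      ∀ a, ∀ b ∈ P.rotation a, ∃ g, P.ContractsTo drawingK331 a b g)
    (κ : LinkNotion) (hIVL : IsIVL κ 2 G) : IsMinorMinimalIVL κ 2 G := by
  refine ⟨hIVL, ?_⟩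
  rintro W _ H ⟨B, hconn, hdisj, hadj⟩ hiso
  have hne : ∀ w, (B w).Nonempty := fun w => Set.nonempty_coe_sort.1 (hconn w).nonempty
  have hV : Finite V := Finite.of_injective ν ν.injective
  have hVn : Nat.card V = n := by rw [Nat.card_congr ν, Nat.card_fin]
  -- Either all branch sets are single vertices and the minor is a subgraph, or some branch set
  -- contains an edge, which is contracted.
  by_cases hsub : ∀ w, (B w).Subsingleton
  · choose f hf using hne
    refine not_isIVL_of_proper_subgraph P (by norm_num) ν hG hP κ (f := f) ?_ ?_ hiso
    · intro w w' h
      by_contra hw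
      exact Set.disjoint_left.1 (hdisj w w' hw) (hf w) (h ▸ hf w')
    · intro w w' e
      obtain ⟨u, hu, v, hv, huv⟩ := hadj w w' e
      rwa [hsub w (hf w) hu, hsub w' (hf w') hv]
  · push Not at hsub
    obtain ⟨w₀, hw₀⟩ := hsub
    obtain ⟨a', ha', b', hb', hab'⟩ := hw₀
    obtain ⟨a, ha, b, hb, hab⟩ := exists_adj_of_connected_induce (hconn w₀) ha' hb' hab'
    obtain ⟨r, hr, hinj, hr₀, hrb⟩ := exists_representatives hne hdisj ha hb hab.ne
    have hcard : Nat.card W < n := by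
      have := Nat.card_le_card_of_injective _ (option_elim_injective hinj hrb)
      rwa [Finite.card_option, hVn] at this
    by_cases h6 : Nat.card W ≤ 6
    · exact not_isIVL_of_card_le_six κ h6
        (exists_not_adj_of_contraction P ν hG hdarts hdisj hadj ha hb hab)
    · rcases hn with hn | ⟨rfl, hn⟩
      · omega
      · exact not_isIVL_of_contractsTo P drawingK331 (by norm_num) ν hG κ hdisj hadj hb hr hinj
          hr₀ hrb (by omega) (hn _ _ ((hG _ _).1 hab))

end Minor

/-! ### The Petersen family -/

theorem IsIVL.mono {V : Type*} {G : SimpleGraph V} {κ : LinkNotion} {n n' : ℕ} (h : IsIVL κ n G)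
    (hn : n' ≤ n) : IsIVL κ n' G := fun D hD => h D (hD.trans hn)

theorem not_isIVL_three_graphK6 (κ : LinkNotion) : ¬ IsIVL κ 3 graphK6 :=
  drawingK6.not_isIVL (f := id) Function.injective_id (fun u v => (graphK6_adj u v).1)
    (by norm_num) κ

theorem not_isIVL_three_graphK331 (κ : LinkNotion) : ¬ IsIVL κ 3 graphK331 :=
  drawingK331.not_isIVL (f := id) Function.injective_id (fun u v => (graphK331_adj u v).1)
    (by norm_num) κ

theorem not_isIVL_three_graphK44e (κ : LinkNotion) : ¬ IsIVL κ 3 graphK44e :=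
  drawingK44e.not_isIVL finSumFinEquiv.injective (fun u v => (graphK44e_adj u v).1)
    (by norm_num) κ

theorem not_isIVL_three_graphG7 (κ : LinkNotion) : ¬ IsIVL κ 3 graphG7 :=
  drawingG7.not_isIVL (f := id) Function.injective_id (fun u v => (graphG7_adj u v).1)
    (by norm_num) κ

theorem exists_linkless_diagram_graphG8 :
    ∃ D : VirtualDiagram graphG8, D.numVirtual = 2 ∧ D.IsLinkless :=
  drawingG8.exists_linkless_of_forall (f := id) Function.injective_id
    (fun u v => (graphG8_adj u v).1) (by norm_num)
    -- Every edge of the drawing belongs to the graph, so no crossing is lost and there are exactly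
    -- two.
    fun x i => ⟨_, _, (graphG8_adj _ _).2 (drawingG8.corner_adj x i), rfl, rfl⟩

theorem exists_linkless_diagram_graphG9 :
    ∃ D : VirtualDiagram graphG9, D.numVirtual = 2 ∧ D.IsLinkless :=
  drawingG9.exists_linkless_of_forall (f := id) Function.injective_id
    (fun u v => (graphG9_adj u v).1) (by norm_num)
    fun x i => ⟨_, _, (graphG9_adj _ _).2 (drawingG9.corner_adj x i), rfl, rfl⟩

theorem exists_linkless_diagram_graphPetersen :
    ∃ D : VirtualDiagram graphPetersen, D.numVirtual = 2 ∧ D.IsLinkless :=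
  drawingPetersen.exists_linkless_of_forall (f := id) Function.injective_id
    (fun u v => (graphPetersen_adj u v).1) (by norm_num)
    fun x i => ⟨_, _, (graphPetersen_adj _ _).2 (drawingPetersen.corner_adj x i), rfl, rfl⟩

theorem isMinorMinimalIVL_graphK6 (κ : LinkNotion) : IsMinorMinimalIVL κ 2 graphK6 :=
  isMinorMinimalIVL_of_drawing drawingK6 (Equiv.refl _) graphK6_adj
    (drawingK6.card_dart_le.trans (by decide +kernel))
    (fun a b hab => exists_movesToCrossing_drawingK6 a b
      (show drawingK6.graph.Adj a b from hab).ne)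
    (Or.inl (by norm_num)) κ (isIVL_two_graphK6 κ)

theorem isMinorMinimalIVL_graphK331 (κ : LinkNotion) : IsMinorMinimalIVL κ 2 graphK331 :=
  isMinorMinimalIVL_of_drawing drawingK331 (Equiv.refl _) graphK331_adj
    (drawingK331.card_dart_le.trans (by decide +kernel))
    exists_movesToCrossing_drawingK331 (Or.inl le_rfl) κ (isIVL_two_graphK331 κ)

theorem isMinorMinimalIVL_graphK44e (κ : LinkNotion) : IsMinorMinimalIVL κ 2 graphK44e :=
  isMinorMinimalIVL_of_drawing drawingK44e finSumFinEquiv graphK44e_adj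
    (drawingK44e.card_dart_le.trans (by decide +kernel))
    exists_movesToCrossing_drawingK44e (Or.inr ⟨rfl, exists_contractsTo_drawingK44e⟩) κ
    (isIVL_two_graphK44e κ)

theorem isMinorMinimalIVL_graphG7 (κ : LinkNotion) : IsMinorMinimalIVL κ 2 graphG7 :=
  isMinorMinimalIVL_of_drawing drawingG7 (Equiv.refl _) graphG7_adj
    (drawingG7.card_dart_le.trans (by decide +kernel))
    exists_movesToCrossing_drawingG7 (Or.inl le_rfl) κ (isIVL_two_graphG7 κ)

theorem mainTheorem7 (κ : LinkNotion) :
    -- all seven graphs are 1-IVL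
    (IsIVL κ 1 graphK6 ∧ IsIVL κ 1 graphK331 ∧ IsIVL κ 1 graphK44e ∧ IsIVL κ 1 graphG7 ∧
      IsIVL κ 1 graphG8 ∧ IsIVL κ 1 graphG9 ∧ IsIVL κ 1 graphPetersen) ∧
    -- the first four are 2-IVL but not 3-IVL
    (IsIVL κ 2 graphK6 ∧ ¬ IsIVL κ 3 graphK6) ∧
    (IsIVL κ 2 graphK331 ∧ ¬ IsIVL κ 3 graphK331) ∧
    (IsIVL κ 2 graphK44e ∧ ¬ IsIVL κ 3 graphK44e) ∧
    (IsIVL κ 2 graphG7 ∧ ¬ IsIVL κ 3 graphG7) ∧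
    -- the last three have linkless diagrams with two virtual crossings and are not 2-IVL
    ((∃ D : VirtualDiagram graphG8, D.numVirtual = 2 ∧ D.IsLinkless) ∧ ¬ IsIVL κ 2 graphG8) ∧
    ((∃ D : VirtualDiagram graphG9, D.numVirtual = 2 ∧ D.IsLinkless) ∧ ¬ IsIVL κ 2 graphG9) ∧
    ((∃ D : VirtualDiagram graphPetersen, D.numVirtual = 2 ∧ D.IsLinkless) ∧
      ¬ IsIVL κ 2 graphPetersen) ∧
    -- the first four are minor-minimal with respect to being 2-IVL
    (IsMinorMinimalIVL κ 2 graphK6 ∧ IsMinorMinimalIVL κ 2 graphK331 ∧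
      IsMinorMinimalIVL κ 2 graphK44e ∧ IsMinorMinimalIVL κ 2 graphG7) := by
  have hlinkless : ∀ {n : ℕ} {G : SimpleGraph (Fin n)},
      (∃ D : VirtualDiagram G, D.numVirtual = 2 ∧ D.IsLinkless) → ¬ IsIVL κ 2 G :=
    fun ⟨_, h, hD⟩ => hD.not_isIVL κ h.le
  exact ⟨⟨(isIVL_two_graphK6 κ).mono one_le_two, (isIVL_two_graphK331 κ).mono one_le_two,
      (isIVL_two_graphK44e κ).mono one_le_two, (isIVL_two_graphG7 κ).mono one_le_two,
      isIVL_one_graphG8 κ, isIVL_one_graphG9 κ, isIVL_one_graphPetersen κ⟩,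
    ⟨isIVL_two_graphK6 κ, not_isIVL_three_graphK6 κ⟩,
    ⟨isIVL_two_graphK331 κ, not_isIVL_three_graphK331 κ⟩,
    ⟨isIVL_two_graphK44e κ, not_isIVL_three_graphK44e κ⟩,
    ⟨isIVL_two_graphG7 κ, not_isIVL_three_graphG7 κ⟩,
    ⟨exists_linkless_diagram_graphG8, hlinkless exists_linkless_diagram_graphG8⟩,
    ⟨exists_linkless_diagram_graphG9, hlinkless exists_linkless_diagram_graphG9⟩,
    ⟨exists_linkless_diagram_graphPetersen, hlinkless exists_linkless_diagram_graphPetersen⟩,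
    isMinorMinimalIVL_graphK6 κ, isMinorMinimalIVL_graphK331 κ, isMinorMinimalIVL_graphK44e κ,
    isMinorMinimalIVL_graphG7 κ⟩
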